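/- Let $p\ge 1$ and let $\kappa_{\ell+1/2}>0$ be diffusivities with $\ell$ taken modulo $p$. For a lattice spacing $d>0$, the ensemble of all phase shifts of the heterogeneous diffusion $d^2\partial_t u_i=\kappa_{i+1/2}(u_{i+1}-u_i)+\kappa_{i-1/2}(u_{i-1}-u_i)$ is the system (with $\ell$ modulo $p$) $$d^2\partial_t v_{i,\ell}=\kappa_{\ell+1/2}(v_{i+1,\ell+1}-v_{i,\ell})+\kappa_{\ell-1/2}(v_{i-1,\ell-1}-v_{i,\ell}),\qquad(\mathrm E)$$ whose Fourier transform at grid-scaled wavenumber $k$ is $d^2\partial_t\tilde v_\ell=\kappa_{\ell+1/2}(e^{ik}\tilde v_{\ell+1}-\tilde v_\ell)+\kappa_{\ell-1/2}(e^{-ik}\tilde v_{\ell-1}-\tilde v_\ell)$. All evolutions are for $t\ge0$. **Homogenisation.** There are $k_0>0$, vectors $w(k)\in\mathbb C^p$ analytic in $k\in(-k_0,k_0)$ with $w(0)=(1,\dots,1)$ and $\frac1p\sum_\ell w_\ell(k)=1$, and real coefficients $\mathcal K_2,\mathcal K_4,\dots$ such that $\{\tilde V w(k):\tilde V\in\mathbb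 C\}$ is an emergent slow manifold of the Fourier-transformed system: it is invariant with evolution $d^2\partial_t\tilde V=\lambda(k)\tilde V$, $\lambda(k)=-\mathcal K_2k^2+\mathcal K_4k^4-\cdots$ (convergent for $|k|<k_0$), and there are $\beta>0$ and $C$ with $|\lambda(k)|<\beta$ for $|k|<k_0$ such that every solution $\tilde v$ approaches some solution on the manifold with error at most $C\|\tilde v(0)\|e^{-\beta t/d^2}$. The coefficients $\mathcal K_{2m}$ are the same for every such slow manifold, and $\mathcal K_2=p/\sum_\ell\kappa_{\ell+1/2}^{-1}$. For $0<k_c<k_0$ and continuous $Y$, set $\tilde V(k,t)=Y(k)e^{\lambda(k)t/d^2}$. Then $v_{i,\ell}(t)=\int_{-k_c}^{k_c}e^{iki}\,w_\ell(k)\tilde V(k,t)\,dk$ (in $e^{iki}$ the first $i$ is $\sqrt{-1}$, the second the lattice index) solves (E); for every $\phi$ the sequence $v_{i,i+\phi}$ solves the heterogeneous diffusion phase-shifted by $\phi$; and its ensemble mean at site $i$ is $V(id,t)$, where $V(x,t)=\int_{-k_c}^{k_c}e^{ikx/d}\tilde V(k,t)\,dk$ solves the homogenised PDE $$V_t=\mathcal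 K_2V_{xx}+\mathcal K_4d^2V_{xxxx}+\mathcal K_6d^4V_{xxxxxx}+\cdots.\qquad(\mathrm H)$$ **Patch scheme.** Let $n\ge1$ be any patch size, $0<r\le1$ and $L>0$. For $N\ge1$ put $H=L/N$ and $d=rH/n$. Patches $I\in\mathbb Z$ ($N$-periodic in $I$) have points $x^I_i=x_0+IH+id$, $i=0,\dots,n+1$, where $x_0$ is an arbitrary real origin; the system (E) holds for the values $v^I_{i,\ell}$ at the interior points $i=1,\dots,n$, and the edge values are $v^I_{n+1,\ell}=E^{r}v^I_{1,\ell}$, $v^I_{0,\ell}=E^{-r}v^I_{n,\ell}$, where the shift $E^{\pm r}$ by $\pm r$ patch spacings is computed either by spectral interpolation over the $N$ patches, using a set $S$ of wavenumbers $2\pi j/L$ whose indices $j$ form a complete residue system modulo $N$, or by Lagrangian interpolation of order $P\ge1$, $$E^{\rho}f=f+\sum_{k=1}^{P}\Big(\prod_{l=0}^{k-1}(\rho^2-l^2)\Big)\frac{(2k/\rho)\mu\delta^{2k-1}+\delta^{2k}}{(2k)!}f,\qquad \rho=\pm r,$$ with $\mu\delta f^I=\frac12(f^{I+1}-f^{I-1})$,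 $\delta^2f^I=f^{I+1}-2f^I+f^{I-1}$. **Consistency.** The patch scheme is consistent with (H) to arbitrarily high order in $H$: 1. *Spectral coupling.* Let $V$ be a real solution of (H) that is an $L$-periodic trigonometric polynomial in $x$ with wavenumbers $q$ in the set $S$ satisfying $|q|d<k_0$. Then there is an exact real solution of the patch scheme with $\frac1p\sum_\ell v^I_{i,\ell}(t)=V(x^I_i,t)$ for all $t\ge0$, all $I$ and $1\le i\le n$. 2. *Lagrangian coupling of order $P$.* For every finite set $B$ of wavenumbers in $\frac{2\pi}{L}\mathbb Z$ and every $T$ there are $C$ and $N_0$ such that, for all $N\ge N_0$, all $x_0$ and every real solution $V$ of (H) that is a trigonometric polynomial in $x$ with wavenumbers in $B$ and $|V(\cdot,0)|\le M$, there is an exact real solution of the patch scheme with $$\Big|\tfrac1p\sum_\ell v^I_{i,\ell}(t)-V(x^I_i,t)\Big|\le CMH^{2P},\qquad \Big|\partial_t\Big(\tfrac1p\sum_\ell v^I_{i,\ell}(t)-V(x^I_i,t)\Big)\Big|\le CMH^{2P}$$ for $0\le t\le T$, all $I$ and $1\le i\le n$. The same holds for the scheme written for the members $u_{i,\ell}$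 with phase $\ell$, that is $d^2\partial_tu_{i,\ell}=\kappa_{i+\ell+1/2}(u_{i+1,\ell}-u_{i,\ell})+\kappa_{i+\ell-1/2}(u_{i-1,\ell}-u_{i,\ell})$ on the patches, with edge values $u^I_{n+1,\ell}=E^{r}u^I_{1,\ell+n}$ and $u^I_{0,\ell}=E^{-r}u^I_{n,\ell-n}$. -/

import Mathlib

open Set Filter Topology
open scoped ContDiff

noncomputable section

namespace PatchEnsemble

/-! The diffusivity `κ_{ℓ+1/2}` is stored as `κ ℓ`, with `ℓ` in `ZMod p`; hence `κ_{ℓ-1/2}` is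
`κ (ℓ - 1)`.  Evolution equations hold for times `t ≥ 0`, one-sidedly at `t = 0`. -/

section Lattice

variable {p : ℕ} {E : Type*} [NormedAddCommGroup E] [NormedSpace ℝ E]

/-- Right-hand side, at site `i`, of the heterogeneous diffusion with diffusivities phase-shifted
by `φ`:  `d² ∂ₜ uᵢ = κ_{i+φ+1/2} (uᵢ₊₁ - uᵢ) + κ_{i+φ-1/2} (uᵢ₋₁ - uᵢ)`. -/
def diffusionRate (κ : ZMod p → ℝ) (d : ℝ) (φ : ZMod p) (u : ℤ → E) (i : ℤ) : E :=
  (d ^ 2)⁻¹ • (κ ((i : ZMod p) + φ) • (u (i + 1) - u i)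
    + κ ((i : ZMod p) + φ - 1) • (u (i - 1) - u i))

/-- The heterogeneous diffusion, phase-shifted by `φ`, on the whole lattice. -/
def IsDiffusionSolution (κ : ZMod p → ℝ) (d : ℝ) (φ : ZMod p) (u : ℝ → ℤ → E) : Prop :=
  ∀ t, 0 ≤ t → ∀ i : ℤ,
    HasDerivWithinAt (fun s => u s i) (diffusionRate κ d φ (u t) i) (Ici 0) t

/-- Two arrangements of the same ensemble of the `p` phase-shifted diffusions.
`stacked`: `u i ℓ` is the value at site `i` of the member with phase `ℓ`.
`wrapped`: `v i ℓ` is the value at site `i` of the member with phase `ℓ - i`. -/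
inductive Arrangement
  | wrapped
  | stacked

/-- Right-hand side of the ensemble system at site `i`, component `ℓ`.  In the wrapped arrangement
`d² ∂ₜ v_{i,ℓ} = κ_{ℓ+1/2} (v_{i+1,ℓ+1} - v_{i,ℓ}) + κ_{ℓ-1/2} (v_{i-1,ℓ-1} - v_{i,ℓ})`. -/
def ensembleRate (a : Arrangement) (κ : ZMod p → ℝ) (d : ℝ) (v : ℤ → ZMod p → E)
    (i : ℤ) (l : ZMod p) : E :=
  match a with
  | .wrapped => (d ^ 2)⁻¹ • (κ l • (v (i + 1) (l + 1) - v i l)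
      + κ (l - 1) • (v (i - 1) (l - 1) - v i l))
  | .stacked => diffusionRate κ d l (fun j => v j l) i

/-- The ensemble system on the whole lattice. -/
def IsEnsembleSolution (a : Arrangement) (κ : ZMod p → ℝ) (d : ℝ)
    (v : ℝ → ℤ → ZMod p → E) : Prop :=
  ∀ t, 0 ≤ t → ∀ (i : ℤ) (l : ZMod p),
    HasDerivWithinAt (fun s => v s i l) (ensembleRate a κ d (v t) i l) (Ici 0) t

/-- The mean over the `p` components of an ensemble vector. -/
def ensembleMean [NeZero p] (y : ZMod p → E) : E := (p : ℝ)⁻¹ • ∑ l, y l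

/-- `V` solves the homogenised equation
`V_t = K₀ V_xx + K₁ d² V_xxxx + K₂ d⁴ V_xxxxxx + ⋯` for `t ≥ 0`, the series converging at every
point.  So `K m` is the coefficient of the derivative of order `2 m + 2`. -/
def IsHomogenisedSolution (K : ℕ → ℝ) (d : ℝ) (V : ℝ → ℝ → E) : Prop :=
  ∀ t, 0 ≤ t → ContDiff ℝ ∞ (V t) ∧ ∀ x, ∃ F : E,
    HasSum (fun m : ℕ => (K m * d ^ (2 * m)) • iteratedDeriv (2 * m + 2) (V t) x) F ∧
    HasDerivWithinAt (fun s => V s x) F (Ici 0) t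

end Lattice

section Fourier

variable {p : ℕ}

/-- The operator of the wrapped ensemble system at grid-scaled wavenumber `k`, in units `d⁻²`. -/
def symbol (κ : ZMod p → ℝ) (k : ℝ) (y : ZMod p → ℂ) (l : ZMod p) : ℂ :=
  κ l * (Complex.exp (Complex.I * k) * y (l + 1) - y l)
    + κ (l - 1) * (Complex.exp (-(Complex.I * k)) * y (l - 1) - y l)

/-- `d² ∂ₜ y = symbol κ k y`, the Fourier transform of the wrapped ensemble system at `k`. -/
def IsFourierSolution (κ : ZMod p → ℝ) (d k : ℝ) (y : ℝ → ZMod p → ℂ) : Prop :=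
  ∀ t, 0 ≤ t → ∀ l : ZMod p,
    HasDerivWithinAt (fun s => y s l) (((d : ℂ) ^ 2)⁻¹ * symbol κ k (y t) l) (Ici 0) t

/-- The emergent slow manifold of the Fourier-transformed ensemble, for wavenumbers `|k| < k₀`.
It is `{Y • w k | Y ∈ ℂ}`, parametrised by the ensemble mean `Y` of its points; it consists of
equilibria (constant vectors) at `k = 0`, it is analytic in `k`, it is invariant with evolution
`d² ∂ₜ Y = lam k * Y`, and every solution approaches a solution on the manifold at an exponential
rate `β / d²` that beats all rates on the manifold. -/
structure IsSlowManifold [NeZero p] (κ : ZMod p → ℝ) (k₀ : ℝ) (w : ℝ → ZMod p → ℂ)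
    (lam : ℝ → ℝ) : Prop where
  pos : 0 < k₀
  analytic : AnalyticOnNhd ℝ w (Ioo (-k₀) k₀)
  equilibria : w 0 = fun _ => 1
  mean : ∀ k, |k| < k₀ → ensembleMean (w k) = 1
  invariant : ∀ k, |k| < k₀ → ∀ l, symbol κ k (w k) l = lam k * w k l
  emergent : ∃ β C : ℝ, 0 < β ∧ ∀ k, |k| < k₀ → |lam k| < β ∧
    ∀ (d : ℝ) (y : ℝ → ZMod p → ℂ), 0 < d → IsFourierSolution κ d k y →
      ∃ Y₀ : ℂ, ∀ t, 0 ≤ t →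
        ‖y t - (Y₀ * (Real.exp (lam k * t / d ^ 2) : ℂ)) • w k‖
          ≤ C * ‖y 0‖ * Real.exp (-β * t / d ^ 2)

/-- The evolution on the slow manifold is `d² ∂ₜ Y = (-K₀ k² + K₁ k⁴ - K₂ k⁶ + ⋯) Y`. -/
def HasSlowExpansion (k₀ : ℝ) (lam : ℝ → ℝ) (K : ℕ → ℝ) : Prop :=
  ∀ k, |k| < k₀ → HasSum (fun m : ℕ => (-1) ^ (m + 1) * K m * k ^ (2 * m + 2)) (lam k)

end Fourier

section Patches

/-- Spectral approximation of the macroscale shift by `ρ` patch spacings, applied to the values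
`f J` of a field at patches `J`: the Fourier interpolant of the values at patches `1, …, N`, with
wavenumbers `2 π j / L` for `j ∈ S`, evaluated a distance `ρ H = ρ L / N` to the right of
patch `I`. -/
def spectralShift (N : ℕ) (S : Finset ℤ) (ρ : ℝ) (f : ℤ → ℂ) (I : ℤ) : ℂ :=
  ∑ j ∈ S, ((N : ℂ)⁻¹ * ∑ J ∈ Finset.Icc (1 : ℤ) N,
      f J * Complex.exp (-(2 * Real.pi * Complex.I * j * J / N)))
    * Complex.exp (2 * Real.pi * Complex.I * j * (I + ρ) / N)

/-- The squared centred macroscale difference `δ²`. -/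
def deltaSq (f : ℤ → ℂ) (I : ℤ) : ℂ := f (I + 1) - 2 * f I + f (I - 1)

/-- The mean centred macroscale difference `μδ`. -/
def muDelta (f : ℤ → ℂ) (I : ℤ) : ℂ := (f (I + 1) - f (I - 1)) / 2

/-- Lagrangian approximation, of order `P`, of the macroscale shift by `ρ` patch spacings:
`1 + ∑_{k=1}^{P} (∏_{l=0}^{k-1} (ρ² - l²)) ((2k/ρ) μδ^{2k-1} + δ^{2k}) / (2k)!`. -/
def lagrangeShift (P : ℕ) (ρ : ℝ) (f : ℤ → ℂ) (I : ℤ) : ℂ :=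
  f I + ∑ k ∈ Finset.Icc 1 P, (∏ l ∈ Finset.range k, ((ρ : ℂ) ^ 2 - (l : ℂ) ^ 2))
    * ((2 * k / ρ) * muDelta (deltaSq^[k - 1] f) I + deltaSq^[k] f I) / (2 * k).factorial

variable {p : ℕ}

/-- Position of the point `i` of the patch `I`, for patch spacing `H` and lattice spacing `d`. -/
def patchPoint (x₀ H d : ℝ) (I i : ℤ) : ℝ := x₀ + I * H + i * d

/-- Component whose next-to-left-edge values determine the right-edge values of component `l`
is `l + memberShift n`; it has the same diffusivity across that edge. -/
def memberShift (n : ℕ) : Arrangement → ZMod p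
  | .wrapped => 0
  | .stacked => (n : ZMod p)

/-- The patch scheme with `N` patches (indexed by the integers, periodically) of `n` interior points
`i = 1, …, n`, applied to the ensemble.  `v t I i l` is component `l` at point `i` of patch `I`.
The ensemble system holds at interior points, and the edge values `i = n + 1` and `i = 0` are
obtained from the next-to-edge values `i = 1` and `i = n` on the opposite side by the approximate
macroscale shifts `shift r` and `shift (-r)`. -/
structure IsPatchSolution (a : Arrangement) (κ : ZMod p → ℝ) (d : ℝ) (n N : ℕ) (r : ℝ)
    (shift : ℝ → (ℤ → ℂ) → ℤ → ℂ) (v : ℝ → ℤ → ℤ → ZMod p → ℝ) : Prop where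
  interior : ∀ t, 0 ≤ t → ∀ I i : ℤ, 1 ≤ i → i ≤ n → ∀ l : ZMod p,
    HasDerivWithinAt (fun s => v s I i l) (ensembleRate a κ d (v t I) i l) (Ici 0) t
  rightEdge : ∀ t, 0 ≤ t → ∀ (I : ℤ) (l : ZMod p),
    (v t I (n + 1) l : ℂ) = shift r (fun J => (v t J 1 (l + memberShift n a) : ℂ)) I
  leftEdge : ∀ t, 0 ≤ t → ∀ (I : ℤ) (l : ZMod p),
    (v t I 0 l : ℂ) = shift (-r) (fun J => (v t J n (l - memberShift n a) : ℂ)) I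
  periodic : ∀ t, 0 ≤ t → ∀ (I i : ℤ) (l : ZMod p), v t (I + N) i l = v t I i l

/-- `f` is a real trigonometric polynomial, `L`-periodic, with wavenumbers `2 π j / L`, `j ∈ B`. -/
def IsBandLimited (L : ℝ) (B : Finset ℤ) (f : ℝ → ℝ) : Prop :=
  ∃ c : ℤ → ℂ, ∀ x : ℝ,
    (f x : ℂ) = ∑ j ∈ B, c j * Complex.exp (2 * Real.pi * Complex.I * j * x / L)

end Patches

end PatchEnsemble

end

/-!
The ensemble of phase shifts turns the heterogeneous lattice into a system that is homogeneous in
the site index, so that the Fourier transform decouples it into the finite systems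
`d² ∂ₜ y = symbol κ k y`.  The operator `symbol κ k` is minus the Hermitian form `dirichlet κ k`,
hence symmetric and nonpositive; at `k = 0` its kernel consists of the constant vectors.  The
implicit function theorem, applied over the complex numbers, continues the constant vector to an
analytic branch of eigenvectors of mean one (`exists_eigenvector_branch`), while the spectral gap on
the orthogonal complement persists for small `k` (`exists_gap`).  The gap makes the branch attract
all solutions (`exists_slowManifold`), makes it unique, hence also the coefficients of its
eigenvalue (`coefficients_unique`), and makes it compatible with complex conjugation.  The
eigenvalue is even in `k`, and constancy of the flux to first order in `k` gives the harmonic mean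
as leading coefficient.  Superpositions of the modes `exp (i k j) w(k)` solve the ensemble system,
and their mean fields solve the homogenised equation, whose right-hand side acts on a Fourier mode
as the power series of the eigenvalue.

For the patch scheme, `exists_modes` writes a band-limited solution of the homogenised equation as
a finite sum of Fourier modes, each decaying at the rate on the slow manifold.  Spectral
interpolation shifts all these modes exactly, so lifting each of them to the slow manifold gives an
exact solution of the patch scheme.

Lagrangian interpolation of order `P` multiplies a mode with phase `θ` per patch by
`lagrangeMultiplier P r θ`, which differs from `exp (i r θ)`.  The multiplier satisfies a linear
differential equation in `θ` with a right-hand side of order `θ ^ (2 P)`, and that right-hand side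
is such that the phase error is `O(θ ^ (2 P + 1))` and the modulus error only `O(θ ^ (2 P + 2))`
(`exists_polar_lagrangeMultiplier`).  The phase error is absorbed exactly by changing the lattice
wavenumber of the mode on the slow manifold; since the rates vary quadratically with the
wavenumber and are measured in units `d⁻²`, the rate changes by `O(H ^ (2 P))`.  The modulus error
then leaves a residual of size `d⁻² O(H ^ (2 P + 2)) = O(H ^ (2 P))` in the evolution of one mode on
a patch, and the evolution on a patch is stable in the maximum norm uniformly in `H`
(`norm_patchGenerator_add_le`, `exp_smul_apply_near`), which bounds the errors of values and of
time derivatives (`exists_lagrange_patch_mode`).  Real parts of superpositions of these solutions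
are the required solutions of the scheme.  The two arrangements of the ensemble are related by a
permutation of the components at every site (`IsPatchSolution.stacked`).
-/

namespace PatchEnsemble

open scoped ComplexConjugate

/-! ### The Fourier symbol: summation by parts and the spectral gap -/

section Symbol

variable {p : ℕ}

/-- The difference along the bond from component `l` to component `l + 1`, at wavenumber `k`. -/
noncomputable def bondDiff (k : ℝ) (y : ZMod p → ℂ) (l : ZMod p) : ℂ :=
  Complex.exp (Complex.I * k) * y (l + 1) - y l

theorem conj_exp_I_mul (k : ℝ) :
    conj (Complex.exp (Complex.I * k)) = Complex.exp (-(Complex.I * k)) := by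
  rw [← Complex.exp_conj]; simp

/-- The symbol is the divergence of the flux `κ_{l+1/2} (e^{ik} y_{l+1} - y_l)`. -/
theorem symbol_eq_flux (κ : ZMod p → ℝ) (k : ℝ) (y : ZMod p → ℂ) (l : ZMod p) :
    symbol κ k y l = κ l * bondDiff k y l
      - Complex.exp (-(Complex.I * k)) * (κ (l - 1) * bondDiff k y (l - 1)) := by
  have h : Complex.exp (-(Complex.I * k)) * Complex.exp (Complex.I * k) = 1 := by
    rw [← Complex.exp_add]; simp
  simp only [symbol, bondDiff, sub_add_cancel]
  linear_combination (κ (l - 1) * y l : ℂ) * h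

theorem conj_symbol (κ : ZMod p → ℝ) (k : ℝ) (y : ZMod p → ℂ) (l : ZMod p) :
    conj (symbol κ k y l) = symbol κ (-k) (fun m => conj (y m)) l := by
  have h2 := conj_exp_I_mul (-k)
  simp only [Complex.ofReal_neg, mul_neg, neg_neg] at h2
  simp [symbol, ← h2]

theorem symbol_sub (κ : ZMod p → ℝ) (k : ℝ) (x y : ZMod p → ℂ) (l : ZMod p) :
    symbol κ k (x - y) l = symbol κ k x l - symbol κ k y l := by
  simp only [symbol, Pi.sub_apply]; ring

theorem symbol_smul (κ : ZMod p → ℝ) (k : ℝ) (c : ℂ) (y : ZMod p → ℂ) (l : ZMod p) :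
    symbol κ k (c • y) l = c * symbol κ k y l := by
  simp only [symbol, Pi.smul_apply, smul_eq_mul]; ring

variable [NeZero p]

/-- The Dirichlet form of the symbol at wavenumber `k`. -/
noncomputable def dirichlet (κ : ZMod p → ℝ) (k : ℝ) (y : ZMod p → ℂ) : ℝ :=
  ∑ l, κ l * ‖bondDiff k y l‖ ^ 2

theorem sum_shift {M : Type*} [AddCommMonoid M] (f : ZMod p → M) :
    ∑ l, f (l - 1) = ∑ l, f l :=
  Equiv.sum_comp (Equiv.subRight (1 : ZMod p)) f

theorem sum_conj_mul_symbol (κ : ZMod p → ℝ) (k : ℝ) (x y : ZMod p → ℂ) :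
    ∑ l, conj (x l) * symbol κ k y l
      = -∑ l, (κ l : ℂ) * (conj (bondDiff k x l) * bondDiff k y l) := by
  have h := sum_shift (fun l => Complex.exp (-(Complex.I * k)) * conj (x (l + 1))
    * (κ l * bondDiff k y l))
  simp only [sub_add_cancel] at h
  calc ∑ l, conj (x l) * symbol κ k y l
      = ∑ l, conj (x l) * (κ l * bondDiff k y l)
        - ∑ l, Complex.exp (-(Complex.I * k)) * conj (x l) * (κ (l - 1) * bondDiff k y (l - 1)) := by
        rw [← Finset.sum_sub_distrib]
        refine Finset.sum_congr rfl fun l _ => ?_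
        rw [symbol_eq_flux]; ring
    _ = _ := by
        rw [h, ← Finset.sum_sub_distrib, ← Finset.sum_neg_distrib]
        refine Finset.sum_congr rfl fun l _ => ?_
        have : conj (bondDiff k x l)
            = Complex.exp (-(Complex.I * k)) * conj (x (l + 1)) - conj (x l) := by
          rw [bondDiff, map_sub, map_mul, conj_exp_I_mul]
        rw [this]; ring

theorem sum_conj_mul_symbol_self (κ : ZMod p → ℝ) (k : ℝ) (y : ZMod p → ℂ) :
    ∑ l, conj (y l) * symbol κ k y l = -(dirichlet κ k y : ℂ) := by
  rw [sum_conj_mul_symbol, dirichlet]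
  push_cast
  congr 1
  refine Finset.sum_congr rfl fun l _ => ?_
  rw [Complex.conj_mul']

/-- The symbol at a real wavenumber is Hermitian. -/
theorem sum_conj_mul_symbol_comm (κ : ZMod p → ℝ) (k : ℝ) (x y : ZMod p → ℂ) :
    ∑ l, conj (x l) * symbol κ k y l = ∑ l, conj (symbol κ k x l) * y l := by
  have h := congrArg conj (sum_conj_mul_symbol κ k y x)
  rw [sum_conj_mul_symbol]
  simp only [map_sum, map_mul, map_neg, Complex.conj_conj, Complex.conj_ofReal] at h
  rw [show ∑ l, conj (symbol κ k x l) * y l = ∑ l, y l * conj (symbol κ k x l) from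
    Finset.sum_congr rfl fun l _ => mul_comm _ _, h]
  congr 1
  exact Finset.sum_congr rfl fun l _ => by ring

theorem dirichlet_nonneg {κ : ZMod p → ℝ} (hκ : ∀ l, 0 < κ l) (k : ℝ) (y : ZMod p → ℂ) :
    0 ≤ dirichlet κ k y :=
  Finset.sum_nonneg fun l _ => mul_nonneg (hκ l).le (sq_nonneg _)

theorem sum_norm_sq_pos {y : ZMod p → ℂ} (hy : y ≠ 0) : 0 < ∑ l, ‖y l‖ ^ 2 := by
  obtain ⟨l, hl⟩ := Function.ne_iff.1 hy
  exact Finset.sum_pos' (fun _ _ => sq_nonneg _)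
    ⟨l, Finset.mem_univ l, pow_pos (norm_pos_iff.2 hl) 2⟩

theorem sum_conj_mul_self (y : ZMod p → ℂ) :
    ∑ l, conj (y l) * y l = ((∑ l, ‖y l‖ ^ 2 : ℝ) : ℂ) := by
  push_cast
  exact Finset.sum_congr rfl fun l _ => Complex.conj_mul' _

theorem eigenvalue_mul_sum_norm_sq {κ : ZMod p → ℝ} {k : ℝ} {μ : ℂ} {y : ZMod p → ℂ}
    (h : ∀ l, symbol κ k y l = μ * y l) :
    μ * ((∑ l, ‖y l‖ ^ 2 : ℝ) : ℂ) = -(dirichlet κ k y : ℂ) := by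
  rw [← sum_conj_mul_symbol_self, ← sum_conj_mul_self, Finset.mul_sum]
  exact Finset.sum_congr rfl fun l _ => by rw [h]; ring

theorem eigenvalue_eq_neg_div {κ : ZMod p → ℝ} {k : ℝ} {μ : ℂ} {y : ZMod p → ℂ} (hy : y ≠ 0)
    (h : ∀ l, symbol κ k y l = μ * y l) :
    μ = ((-(dirichlet κ k y / ∑ l, ‖y l‖ ^ 2) : ℝ) : ℂ) := by
  have h1 := eigenvalue_mul_sum_norm_sq h
  have h2 : ((∑ l, ‖y l‖ ^ 2 : ℝ) : ℂ) ≠ 0 := by exact_mod_cast (sum_norm_sq_pos hy).ne'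
  rw [eq_comm, Complex.ofReal_neg, Complex.ofReal_div, ← neg_div, ← h1]
  field_simp

theorem const_of_shift_invariant {α : Type*} {y : ZMod p → α} (h : ∀ l, y (l + 1) = y l)
    (l : ZMod p) : y l = y 0 := by
  have : ∀ m : ℕ, y (m : ZMod p) = y 0 := by
    intro m
    induction m with
    | zero => simp
    | succ m ih => rw [Nat.cast_succ, h, ih]
  simpa using this l.val

theorem const_of_dirichlet_eq_zero {κ : ZMod p → ℝ} (hκ : ∀ l, 0 < κ l) {y : ZMod p → ℂ}
    (h : dirichlet κ 0 y = 0) (l : ZMod p) : y l = y 0 := by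
  refine const_of_shift_invariant (fun m => ?_) l
  have := (Finset.sum_eq_zero_iff_of_nonneg
    (fun l _ => mul_nonneg (hκ l).le (sq_nonneg ‖bondDiff 0 y l‖))).1 h m (Finset.mem_univ m)
  have h1 : bondDiff 0 y m = 0 := by simpa [(hκ m).ne'] using this
  simpa [bondDiff, sub_eq_zero] using h1

theorem card_mul_eq_sum_of_const {y : ZMod p → ℂ} (h : ∀ l, y l = y 0) :
    ∑ l, y l = p * y 0 := by
  rw [Finset.sum_congr rfl fun l _ => h l]
  simp [ZMod.card]

/-- Near `k = 0` the Dirichlet form is bounded below on the orthogonal complement of any vector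
that depends continuously on `k` and equals the constant vector at `k = 0`.  At `k = 0` this holds
since the ring of bonds is connected; it persists by compactness of the unit sphere. -/
theorem exists_gap {κ : ZMod p → ℝ} (hκ : ∀ l, 0 < κ l) {w : ℝ → ZMod p → ℂ}
    (hw : ContinuousAt w 0) (hw0 : w 0 = fun _ => 1) :
    ∃ β : ℝ, 0 < β ∧ ∀ᶠ k in 𝓝 (0 : ℝ), ∀ z : ZMod p → ℂ, ∑ l, conj (w k l) * z l = 0 →
      β * ∑ l, ‖z l‖ ^ 2 ≤ dirichlet κ k z := by
  set F : ℝ × (ZMod p → ℂ) → ℝ := fun x =>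
    dirichlet κ x.1 x.2 + ‖∑ l, conj (w x.1 l) * x.2 l‖ ^ 2 with hF
  have hFc : ∀ z, ContinuousAt F (0, z) := by
    intro z
    have h1 : ContinuousAt (fun x : ℝ × (ZMod p → ℂ) => w x.1) (0, z) :=
      ContinuousAt.comp (f := Prod.fst) (g := w) (x := ((0 : ℝ), z)) hw continuousAt_fst
    have h2 : ∀ l, ContinuousAt (fun x : ℝ × (ZMod p → ℂ) => w x.1 l) (0, z) := fun l =>
      (continuousAt_pi.1 h1) l
    refine ContinuousAt.add ?_ ?_
    · have : Continuous fun x : ℝ × (ZMod p → ℂ) => dirichlet κ x.1 x.2 := by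
        unfold dirichlet bondDiff; fun_prop
      exact this.continuousAt
    · refine ContinuousAt.pow (ContinuousAt.norm ?_) 2
      refine tendsto_finsetSum _ fun l _ => ?_
      refine ContinuousAt.mul ?_ (by fun_prop)
      exact Complex.continuous_conj.continuousAt.comp (h2 l)
  have hF0 : ∀ z, z ≠ 0 → 0 < F (0, z) := by
    intro z hz
    have hd := dirichlet_nonneg hκ 0 z
    have hn : 0 ≤ ‖∑ l, conj (w 0 l) * z l‖ ^ 2 := sq_nonneg _
    by_contra hle
    have hle : dirichlet κ 0 z + ‖∑ l, conj (w 0 l) * z l‖ ^ 2 ≤ 0 := not_lt.1 hle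
    have hconst := const_of_dirichlet_eq_zero hκ (le_antisymm (by linarith) hd)
    have hs : ‖∑ l, conj (w 0 l) * z l‖ ^ 2 = 0 := le_antisymm (by linarith) hn
    rw [hw0] at hs
    simp only [map_one, one_mul] at hs
    rw [card_mul_eq_sum_of_const hconst] at hs
    have : z 0 = 0 := by simpa [NeZero.ne p] using hs
    exact hz (funext fun l => by rw [hconst, this]; rfl)
  have hcpt : IsCompact (Metric.sphere (0 : ZMod p → ℂ) 1) := isCompact_sphere _ _
  have hne : (Metric.sphere (0 : ZMod p → ℂ) 1).Nonempty := NormedSpace.sphere_nonempty.2 zero_le_one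
  obtain ⟨z₀, hz₀, hmin⟩ := hcpt.exists_isMinOn hne
    (f := fun z => F (0, z)) fun z _ => by
      exact (ContinuousAt.comp (f := fun z => ((0 : ℝ), z)) (g := F) (x := z) (hFc z)
        (by fun_prop)).continuousWithinAt
  have hz₀' : z₀ ≠ 0 := by
    rintro rfl; simp at hz₀
  set b := F (0, z₀) with hb
  have hbpos : 0 < b := hF0 z₀ hz₀'
  have hev : ∀ᶠ k in 𝓝 (0 : ℝ), ∀ z ∈ Metric.sphere (0 : ZMod p → ℂ) 1, b / 2 < F (k, z) := by
    refine hcpt.eventually_forall_of_forall_eventually fun z hz => ?_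
    refine (hFc z).eventually (lt_mem_nhds ?_)
    have : b ≤ F (0, z) := hmin hz
    linarith
  have hp : (0 : ℝ) < p := by exact_mod_cast Nat.pos_of_ne_zero (NeZero.ne p)
  refine ⟨b / 2 / p, by positivity, hev.mono fun k hk z hz => ?_⟩
  rcases eq_or_ne z 0 with rfl | hz0
  · simp [dirichlet, bondDiff]
  have hzn : 0 < ‖z‖ := norm_pos_iff.2 hz0
  have h1 := hk ((‖z‖⁻¹ : ℂ) • z) (by simp [norm_smul, hzn.ne'])
  have h2 : F (k, (‖z‖⁻¹ : ℂ) • z) = ‖z‖⁻¹ ^ 2 * dirichlet κ k z := by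
    have hb : ∀ l, bondDiff k ((‖z‖⁻¹ : ℂ) • z) l = (‖z‖⁻¹ : ℂ) * bondDiff k z l := fun l => by
      simp only [bondDiff, Pi.smul_apply, smul_eq_mul]; ring
    have hs : ∑ l, conj (w k l) * ((‖z‖⁻¹ : ℂ) • z) l = 0 := by
      rw [← mul_zero (‖z‖⁻¹ : ℂ), ← hz, Finset.mul_sum]
      exact Finset.sum_congr rfl fun l _ => by simp only [Pi.smul_apply, smul_eq_mul]; ring
    simp only [hF, hs, dirichlet, hb]
    rw [Finset.mul_sum]
    simp only [norm_zero, ne_eq, OfNat.ofNat_ne_zero, not_false_eq_true, zero_pow, add_zero]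
    refine Finset.sum_congr rfl fun l _ => ?_
    rw [norm_mul, norm_inv, Complex.norm_real, norm_norm]; ring
  rw [h2] at h1
  have h3 : ∑ l, ‖z l‖ ^ 2 ≤ p * ‖z‖ ^ 2 := by
    calc ∑ l, ‖z l‖ ^ 2 ≤ ∑ _l : ZMod p, ‖z‖ ^ 2 :=
          Finset.sum_le_sum fun l _ => pow_le_pow_left₀ (norm_nonneg _) (norm_le_pi_norm z l) 2
      _ = p * ‖z‖ ^ 2 := by simp [ZMod.card]
  have h4 : b / 2 * ‖z‖ ^ 2 ≤ dirichlet κ k z := by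
    have := mul_le_mul_of_nonneg_right h1.le (sq_nonneg ‖z‖)
    calc _ ≤ _ := this
      _ = _ := by field_simp
  calc b / 2 / p * ∑ l, ‖z l‖ ^ 2 ≤ b / 2 / p * (p * ‖z‖ ^ 2) := by gcongr
    _ = b / 2 * ‖z‖ ^ 2 := by field_simp
    _ ≤ _ := h4

/-- Below the spectral gap, an eigenvector of the symbol with unit mean is unique. -/
theorem eigenvector_unique {κ : ZMod p → ℝ} {k β lam μ : ℝ} {w u : ZMod p → ℂ}
    (hgap : ∀ z : ZMod p → ℂ, ∑ l, conj (w l) * z l = 0 → β * ∑ l, ‖z l‖ ^ 2 ≤ dirichlet κ k z)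
    (hw : ∀ l, symbol κ k w l = lam * w l) (hwm : ensembleMean w = 1)
    (hu : ∀ l, symbol κ k u l = μ * u l) (hum : ensembleMean u = 1) (hμ : |μ| < β) :
    u = w ∧ μ = lam := by
  have hw0 : w ≠ 0 := by
    rintro rfl; simp [ensembleMean] at hwm
  have hS : ((∑ l, ‖w l‖ ^ 2 : ℝ) : ℂ) ≠ 0 := by exact_mod_cast (sum_norm_sq_pos hw0).ne'
  set c : ℂ := (∑ l, conj (w l) * u l) / ((∑ l, ‖w l‖ ^ 2 : ℝ) : ℂ) with hc
  set z : ZMod p → ℂ := u - c • w with hz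
  have horth : ∑ l, conj (w l) * z l = 0 := by
    have : ∑ l, conj (w l) * z l = ∑ l, conj (w l) * u l - c * ∑ l, conj (w l) * w l := by
      rw [Finset.mul_sum, ← Finset.sum_sub_distrib]
      exact Finset.sum_congr rfl fun l _ => by
        simp only [hz, Pi.sub_apply, Pi.smul_apply, smul_eq_mul]; ring
    rw [this, sum_conj_mul_self, hc, div_mul_cancel₀ _ hS, sub_self]
  have hAz : ∀ l, symbol κ k z l = μ * u l - c * (lam * w l) := fun l => by
    rw [hz, symbol_sub, symbol_smul, hu, hw]
  -- Testing with `z`, the component along `w` drops out.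
  have hzw : ∑ l, conj (z l) * w l = 0 := by
    have := congrArg conj horth
    simp only [map_sum, map_mul, Complex.conj_conj, map_zero] at this
    rw [← this]; exact Finset.sum_congr rfl fun l _ => mul_comm _ _
  have hq : -(dirichlet κ k z : ℂ) = μ * ((∑ l, ‖z l‖ ^ 2 : ℝ) : ℂ) := by
    rw [← sum_conj_mul_symbol_self, ← sum_conj_mul_self]
    have : ∀ l, conj (z l) * symbol κ k z l
        = μ * (conj (z l) * z l) + (μ * c - c * lam) * (conj (z l) * w l) := fun l => by
      have hul : u l = z l + c * w l := by simp [hz]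
      rw [hAz, hul]; ring
    simp only [this]
    rw [Finset.sum_add_distrib, ← Finset.mul_sum, ← Finset.mul_sum, hzw, mul_zero, add_zero]
  have hq' : -dirichlet κ k z = μ * ∑ l, ‖z l‖ ^ 2 := by exact_mod_cast hq
  have hz0 : z = 0 := by
    by_contra hne
    have hpos := sum_norm_sq_pos hne
    have h1 := hgap z horth
    have h2 : -μ < β := (neg_le_abs μ).trans_lt hμ
    nlinarith
  have huw : u = c • w := by
    rw [hz, sub_eq_zero] at hz0; exact hz0
  have hc1 : c = 1 := by
    rw [huw] at hum
    have : ensembleMean (c • w) = c * ensembleMean w := by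
      simp only [ensembleMean, Pi.smul_apply, smul_eq_mul, ← Finset.mul_sum, Complex.real_smul]
      ring
    rw [this, hwm, mul_one] at hum; exact hum
  have huw' : u = w := by rw [huw, hc1, one_smul]
  refine ⟨huw', ?_⟩
  obtain ⟨l, hl⟩ := Function.ne_iff.1 hw0
  have h1 := hu l
  rw [huw', hw l] at h1
  exact_mod_cast (mul_right_cancel₀ hl h1).symm

end Symbol

/-! ### The analytic branch of slow eigenvectors -/

section Branch

variable {p : ℕ}

/-- The symbol, continued to complex wavenumbers. -/
noncomputable def complexSymbol (κ : ZMod p → ℝ) (k : ℂ) (y : ZMod p → ℂ) (l : ZMod p) : ℂ :=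
  κ l * (Complex.exp (Complex.I * k) * y (l + 1) - y l)
    + κ (l - 1) * (Complex.exp (-(Complex.I * k)) * y (l - 1) - y l)

theorem symbol_eq_complexSymbol (κ : ZMod p → ℝ) (k : ℝ) (y : ZMod p → ℂ) :
    symbol κ k y = complexSymbol κ k y := rfl

theorem complexSymbol_zero_const (κ : ZMod p → ℝ) (c : ℂ) :
    complexSymbol κ 0 (fun _ => c) = 0 := by
  ext l; simp [complexSymbol]

theorem complexSymbol_add (κ : ZMod p → ℝ) (k : ℂ) (x y : ZMod p → ℂ) :
    complexSymbol κ k (x + y) = complexSymbol κ k x + complexSymbol κ k y := by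
  ext l; simp only [complexSymbol, Pi.add_apply]; ring

theorem complexSymbol_smul (κ : ZMod p → ℝ) (k c : ℂ) (y : ZMod p → ℂ) :
    complexSymbol κ k (c • y) = c • complexSymbol κ k y := by
  ext l; simp only [complexSymbol, Pi.smul_apply, smul_eq_mul]; ring

variable [NeZero p]

theorem ensembleMean_add {E : Type*} [NormedAddCommGroup E] [NormedSpace ℝ E]
    (x y : ZMod p → E) : ensembleMean (x + y) = ensembleMean x + ensembleMean y := by
  simp [ensembleMean, Finset.sum_add_distrib]

theorem ensembleMean_smul (c : ℂ) (y : ZMod p → ℂ) :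
    ensembleMean (c • y) = c * ensembleMean y := by
  simp only [ensembleMean, Pi.smul_apply, smul_eq_mul, ← Finset.mul_sum, Complex.real_smul]
  ring

theorem ensembleMean_const {E : Type*} [NormedAddCommGroup E] [NormedSpace ℝ E] (c : E) :
    ensembleMean (fun _ : ZMod p => c) = c := by
  have : (p : ℝ) ≠ 0 := by exact_mod_cast NeZero.ne p
  simp only [ensembleMean, Finset.sum_const, Finset.card_univ, ZMod.card]
  rw [← Nat.cast_smul_eq_nsmul ℝ, smul_smul, inv_mul_cancel₀ this, one_smul]

theorem ensembleMean_symbol_zero (κ : ZMod p → ℝ) (y : ZMod p → ℂ) :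
    ensembleMean (complexSymbol κ 0 y) = 0 := by
  have h := sum_conj_mul_symbol κ 0 (fun _ => 1) y
  have hs : symbol κ 0 y = complexSymbol κ 0 y := by rw [symbol_eq_complexSymbol]; simp
  simp only [bondDiff, hs] at h
  simp only [map_one, one_mul, Complex.ofReal_zero, mul_zero, Complex.exp_zero, mul_one, sub_self,
    map_zero, zero_mul, Finset.sum_const_zero, neg_zero] at h
  simp [ensembleMean, h]

/-- The bordered eigenvalue equation: near `(0, 1)` its zeros `(k, y)` are the eigenvectors `y` of
the symbol with unit mean, since taking means gives `(mean y - 1) (1 - mean (symbol y)) = 0`. -/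
noncomputable def branchEquation (κ : ZMod p → ℝ) (x : ℂ × (ZMod p → ℂ)) : ZMod p → ℂ :=
  fun l => complexSymbol κ x.1 x.2 l - ensembleMean (complexSymbol κ x.1 x.2) * x.2 l
    + (ensembleMean x.2 - 1)

theorem contDiff_complexSymbol (κ : ZMod p → ℝ) (l : ZMod p) {n : WithTop ℕ∞} :
    ContDiff ℂ n fun x : ℂ × (ZMod p → ℂ) => complexSymbol κ x.1 x.2 l := by
  unfold complexSymbol
  have h1 : ∀ m : ZMod p, ContDiff ℂ n fun x : ℂ × (ZMod p → ℂ) => x.2 m := fun m =>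
    (contDiff_apply ℂ ℂ m).comp contDiff_snd
  have h2 : ContDiff ℂ n fun x : ℂ × (ZMod p → ℂ) => Complex.exp (Complex.I * x.1) :=
    (contDiff_const.mul contDiff_fst).cexp
  have h3 : ContDiff ℂ n fun x : ℂ × (ZMod p → ℂ) => Complex.exp (-(Complex.I * x.1)) :=
    (contDiff_const.mul contDiff_fst).neg.cexp
  exact (contDiff_const.mul ((h2.mul (h1 _)).sub (h1 _))).add
    (contDiff_const.mul ((h3.mul (h1 _)).sub (h1 _)))

theorem contDiff_ensembleMean_complexSymbol (κ : ZMod p → ℝ) {n : WithTop ℕ∞} :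
    ContDiff ℂ n fun x : ℂ × (ZMod p → ℂ) => ensembleMean (complexSymbol κ x.1 x.2) := by
  simp only [ensembleMean, Complex.real_smul]
  exact contDiff_const.mul (ContDiff.sum fun l _ => contDiff_complexSymbol κ l)

theorem contDiff_branchEquation (κ : ZMod p → ℝ) {n : WithTop ℕ∞} :
    ContDiff ℂ n (branchEquation κ) := by
  refine contDiff_pi.2 fun l => ?_
  have h1 : ∀ m : ZMod p, ContDiff ℂ n fun x : ℂ × (ZMod p → ℂ) => x.2 m := fun m =>
    (contDiff_apply ℂ ℂ m).comp contDiff_snd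
  unfold branchEquation
  refine ((contDiff_complexSymbol κ l).sub
    ((contDiff_ensembleMean_complexSymbol κ).mul (h1 l))).add (ContDiff.sub ?_ contDiff_const)
  simp only [ensembleMean, Complex.real_smul]
  exact contDiff_const.mul (ContDiff.sum fun l _ => h1 l)

theorem branchEquation_zero_one (κ : ZMod p → ℝ) : branchEquation κ (0, fun _ => 1) = 0 := by
  ext l
  simp [branchEquation, complexSymbol_zero_const, ensembleMean_const]
  simp [ensembleMean]

/-- The derivative of the bordered equation in the eigenvector is the symbol at `k = 0` plus the
mean; it is injective since the kernel of the symbol consists of the constants. -/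
theorem isInvertible_fderiv_branchEquation {κ : ZMod p → ℝ} (hκ : ∀ l, 0 < κ l) :
    (fderiv ℂ (branchEquation κ) (0, fun _ => 1)
      ∘L .inr ℂ ℂ (ZMod p → ℂ)).IsInvertible := by
  set A := fderiv ℂ (branchEquation κ) (0, fun _ => 1) ∘L .inr ℂ ℂ (ZMod p → ℂ) with hA
  have hd : HasFDerivAt (branchEquation κ) (fderiv ℂ (branchEquation κ) (0, fun _ => 1))
      (0, fun _ => 1) :=
    ((contDiff_branchEquation κ (n := 1)).differentiable (by simp)).differentiableAt.hasFDerivAt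
  have hval : ∀ η : ZMod p → ℂ, A η = fun l => complexSymbol κ 0 η l + ensembleMean η := by
    intro η
    have hline : HasDerivAt (fun s : ℂ => ((0 : ℂ), (fun _ => (1 : ℂ)) + s • η)) (0, η) 0 := by
      refine (hasDerivAt_const _ _).prodMk ?_
      simpa using ((hasDerivAt_id (0 : ℂ)).smul_const η).const_add (fun _ : ZMod p => (1 : ℂ))
    have h1 : HasDerivAt (fun s : ℂ => branchEquation κ (0, (fun _ => 1) + s • η)) (A η) 0 := by
      have := HasFDerivAt.comp_hasDerivAt_of_eq (0 : ℂ) hd hline (by simp)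
      simpa [hA, Function.comp_def] using this
    have h2 : (fun s : ℂ => branchEquation κ (0, (fun _ => 1) + s • η))
        = fun s => s • fun l => complexSymbol κ 0 η l + ensembleMean η := by
      funext s l
      have e1 : complexSymbol κ 0 ((fun _ => 1) + s • η) = s • complexSymbol κ 0 η := by
        rw [complexSymbol_add, complexSymbol_zero_const, complexSymbol_smul, zero_add]
      simp only [branchEquation, e1, ensembleMean_smul, ensembleMean_symbol_zero,
        ensembleMean_add, ensembleMean_const, Pi.smul_apply, smul_eq_mul]
      ring
    rw [h2] at h1
    have h3 := ((hasDerivAt_id (0 : ℂ)).smul_const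
      (fun l => complexSymbol κ 0 η l + ensembleMean η))
    simpa using h1.unique h3
  have hinj : Function.Injective A := by
    refine (injective_iff_map_eq_zero A).2 fun η hη => ?_
    rw [hval] at hη
    have hm : ensembleMean η = 0 := by
      have := congrArg ensembleMean hη
      rw [show (fun l => complexSymbol κ 0 η l + ensembleMean η)
        = complexSymbol κ 0 η + fun _ => ensembleMean η from rfl, ensembleMean_add,
        ensembleMean_symbol_zero, ensembleMean_const, zero_add] at this
      rw [this]; simp [ensembleMean]
    have hs : ∀ l, symbol κ 0 η l = (0 : ℂ) * η l := fun l => by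
      have := congrFun hη l
      rw [symbol_eq_complexSymbol]
      simpa [hm] using this
    have hd0 := eigenvalue_mul_sum_norm_sq hs
    have hd1 : dirichlet κ 0 η = 0 := by simpa using hd0
    have hc := const_of_dirichlet_eq_zero hκ hd1
    have hη' : η = fun _ => η 0 := funext hc
    rw [hη', ensembleMean_const] at hm
    rw [hη', hm]; rfl
  let e := LinearEquiv.ofInjectiveEndo (A : (ZMod p → ℂ) →ₗ[ℂ] (ZMod p → ℂ)) hinj
  refine ⟨e.toContinuousLinearEquiv, ?_⟩
  ext η l
  rfl

/-- The analytic branch of eigenvectors of the symbol through the constant vector at `k = 0`. -/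
theorem exists_eigenvector_branch {κ : ZMod p → ℝ} (hκ : ∀ l, 0 < κ l) :
    ∃ (W : ℂ → ZMod p → ℂ) (R : ℝ), 0 < R ∧ DifferentiableOn ℂ W (Metric.ball 0 R) ∧
      (W 0 = fun _ => 1) ∧ ∀ k ∈ Metric.ball (0 : ℂ) R, ensembleMean (W k) = 1 ∧
        ∀ l, complexSymbol κ k (W k) l = ensembleMean (complexSymbol κ k (W k)) * W k l := by
  have cdf : ContDiffAt ℂ ω (branchEquation κ) (0, fun _ => 1) :=
    (contDiff_branchEquation κ).contDiffAt
  have hinv := isInvertible_fderiv_branchEquation hκ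
  set W := cdf.implicitFunction (by simp) hinv with hW
  have hW0 : W 0 = fun _ => 1 := cdf.implicitFunction_apply_self (by simp) hinv
  have han : AnalyticAt ℂ W 0 := (cdf.contDiffAt_implicitFunction (by simp) hinv).analyticAt
  have hzero : ∀ᶠ k in 𝓝 (0 : ℂ), branchEquation κ (k, W k) = 0 := by
    have := cdf.eventually_apply_implicitFunction (by simp) hinv
    rwa [branchEquation_zero_one] at this
  have hcont : ContinuousAt (fun k => ensembleMean (complexSymbol κ k (W k))) 0 := by
    have h1 : Continuous fun x : ℂ × (ZMod p → ℂ) => ensembleMean (complexSymbol κ x.1 x.2) :=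
      (contDiff_ensembleMean_complexSymbol κ (n := 0)).continuous
    exact h1.continuousAt.comp (f := fun k => (k, W k)) (continuousAt_id.prodMk han.continuousAt)
  have hne : ∀ᶠ k in 𝓝 (0 : ℂ), ensembleMean (complexSymbol κ k (W k)) ≠ 1 := by
    refine hcont.eventually_ne ?_
    rw [ensembleMean_symbol_zero]; exact zero_ne_one
  obtain ⟨R, hR, hball⟩ := Metric.eventually_nhds_iff_ball.1
    ((han.eventually_analyticAt.and hzero).and hne)
  refine ⟨W, R, hR, fun k hk => (hball k hk).1.1.differentiableAt.differentiableWithinAt, hW0,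
    fun k hk => ?_⟩
  obtain ⟨⟨-, h0⟩, h1⟩ := hball k hk
  have hmean : ensembleMean (W k) = 1 := by
    have h2 : ensembleMean (branchEquation κ (k, W k)) = 0 := by rw [h0]; simp [ensembleMean]
    have h3 : branchEquation κ (k, W k) = complexSymbol κ k (W k)
        + ((-ensembleMean (complexSymbol κ k (W k))) • W k
          + fun _ => ensembleMean (W k) - 1) := by
      ext l; simp [branchEquation]; ring
    rw [h3, ensembleMean_add, ensembleMean_add, ensembleMean_smul, ensembleMean_const] at h2
    have h4 : (ensembleMean (W k) - 1) * (1 - ensembleMean (complexSymbol κ k (W k))) = 0 := by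
      linear_combination h2
    rcases mul_eq_zero.1 h4 with h | h
    · exact sub_eq_zero.1 h
    · exact absurd (sub_eq_zero.1 h).symm h1
  refine ⟨hmean, fun l => ?_⟩
  have := congrFun h0 l
  simp only [branchEquation, hmean, sub_self, add_zero, Pi.zero_apply] at this
  exact sub_eq_zero.1 this

end Branch

/-! ### Expansions of the slow eigenvalue -/

section Expansion

theorem HasSlowExpansion.lam_zero {k₀ : ℝ} {lam : ℝ → ℝ} {K : ℕ → ℝ} (hk₀ : 0 < k₀)
    (h : HasSlowExpansion k₀ lam K) : lam 0 = 0 := by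
  have := h 0 (by simpa using hk₀)
  exact this.unique (by simp [hasSum_zero])

theorem HasSlowExpansion.lam_neg {k₀ : ℝ} {lam : ℝ → ℝ} {K : ℕ → ℝ}
    (h : HasSlowExpansion k₀ lam K) {k : ℝ} (hk : |k| < k₀) : lam (-k) = lam k := by
  have h1 := h (-k) (by simpa using hk)
  have h2 := h k hk
  refine h1.unique ?_
  simpa only [show ∀ m : ℕ, (-k) ^ (2 * m + 2) = k ^ (2 * m + 2) from
    fun m => Even.neg_pow ⟨m + 1, by ring⟩ k] using h2

/-- A slow expansion presents the eigenvalue as `k² g(k²)` with `g` analytic at the origin. -/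
theorem HasSlowExpansion.exists_analytic {k₀ : ℝ} {lam : ℝ → ℝ} {K : ℕ → ℝ} (hk₀ : 0 < k₀)
    (h : HasSlowExpansion k₀ lam K) : ∃ g : ℝ → ℝ,
      HasFPowerSeriesAt g
        (FormalMultilinearSeries.ofScalars ℝ fun m => (-1) ^ (m + 1) * K m) 0 ∧
      g 0 = -K 0 ∧ ∀ k, |k| < k₀ → lam k = k ^ 2 * g (k ^ 2) := by
  set c : ℕ → ℝ := fun m => (-1) ^ (m + 1) * K m with hc
  set q := FormalMultilinearSeries.ofScalars ℝ c with hq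
  have hterm : ∀ k, |k| < k₀ → k ≠ 0 → HasSum (fun m => c m * (k ^ 2) ^ m) (lam k / k ^ 2) := by
    intro k hk hk0
    refine ((h k hk).div_const (k ^ 2)).congr_fun fun m => ?_
    rw [hc, ← pow_mul]; field_simp; ring
  have hrad : 0 < q.radius := by
    have hk2 : |k₀ / 2| < k₀ := by rw [abs_of_pos (by positivity)]; linarith
    have hs := (hterm (k₀ / 2) hk2 (by positivity)).summable.norm
    have := q.le_radius_of_summable (r := Real.toNNReal ((k₀ / 2) ^ 2)) (by
      refine hs.congr fun m => ?_
      rw [hq, FormalMultilinearSeries.ofScalars_norm, norm_mul, norm_pow]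
      congr 2
      rw [Real.norm_of_nonneg (by positivity), Real.coe_toNNReal _ (by positivity)])
    refine lt_of_lt_of_le ?_ this
    rw [ENNReal.coe_pos, Real.toNNReal_pos]
    positivity
  have hsum : ∀ x, q.sum x = ∑' m, c m * x ^ m := fun x => by
    have := FormalMultilinearSeries.ofScalars_sum_eq (E := ℝ) c x
    simpa [FormalMultilinearSeries.ofScalarsSum, ← hq] using this
  refine ⟨q.sum, (q.hasFPowerSeriesOnBall hrad).hasFPowerSeriesAt, ?_, fun k hk => ?_⟩
  · rw [hsum, tsum_eq_single 0 fun m hm => by simp [hm]]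
    simp [hc]
  · rcases eq_or_ne k 0 with rfl | hk0
    · simp [h.lam_zero hk₀]
    · rw [hsum, (hterm k hk hk0).tsum_eq]; field_simp

theorem HasSlowExpansion.tendsto_div_sq {k₀ : ℝ} {lam : ℝ → ℝ} {K : ℕ → ℝ} (hk₀ : 0 < k₀)
    (h : HasSlowExpansion k₀ lam K) :
    Tendsto (fun k => lam k / k ^ 2) (𝓝[≠] 0) (𝓝 (-K 0)) := by
  obtain ⟨g, hg, hg0, hlam⟩ := h.exists_analytic hk₀
  have h1 : Tendsto (fun k : ℝ => g (k ^ 2)) (𝓝[≠] 0) (𝓝 (-K 0)) := by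
    have h2 : ContinuousAt (fun k : ℝ => g (k ^ 2)) 0 :=
      ContinuousAt.comp_of_eq (f := fun k : ℝ => k ^ 2) hg.continuousAt (by fun_prop) (by simp)
    have := h2.tendsto.mono_left (nhdsWithin_le_nhds (s := {0}ᶜ))
    simpa [hg0] using this
  refine h1.congr' ?_
  have : ∀ᶠ k : ℝ in 𝓝[≠] 0, |k| < k₀ := by
    refine nhdsWithin_le_nhds ?_
    exact (continuous_abs.tendsto' 0 0 abs_zero).eventually (gt_mem_nhds hk₀)
  filter_upwards [this, self_mem_nhdsWithin] with k hk hk0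
  rw [hlam k hk]
  have : k ≠ 0 := hk0
  field_simp

theorem HasSlowExpansion.continuousAt_zero {k₀ : ℝ} {lam : ℝ → ℝ} {K : ℕ → ℝ} (hk₀ : 0 < k₀)
    (h : HasSlowExpansion k₀ lam K) : ContinuousAt lam 0 := by
  obtain ⟨g, hg, -, hlam⟩ := h.exists_analytic hk₀
  have h2 : ContinuousAt (fun k : ℝ => k ^ 2 * g (k ^ 2)) 0 :=
    ContinuousAt.mul (by fun_prop)
      (ContinuousAt.comp_of_eq (f := fun k : ℝ => k ^ 2) hg.continuousAt (by fun_prop) (by simp))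
  refine h2.congr ?_
  have : ∀ᶠ k : ℝ in 𝓝 0, |k| < k₀ :=
    (continuous_abs.tendsto' 0 0 abs_zero).eventually (gt_mem_nhds hk₀)
  filter_upwards [this] with k hk
  rw [hlam k hk]

/-- The eigenvalue is Lipschitz as a function of `k²` near `k = 0`. -/
theorem HasSlowExpansion.exists_lipschitz {k₀ : ℝ} {lam : ℝ → ℝ} {K : ℕ → ℝ} (hk₀ : 0 < k₀)
    (h : HasSlowExpansion k₀ lam K) : ∃ Λ δ : ℝ, 0 ≤ Λ ∧ 0 < δ ∧ δ ≤ k₀ ∧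
      ∀ k k', |k| < δ → |k'| < δ → |lam k' - lam k| ≤ Λ * |k' ^ 2 - k ^ 2| := by
  obtain ⟨g, hg, -, hlam⟩ := h.exists_analytic hk₀
  have han : AnalyticAt ℝ (fun x => x * g x) 0 := analyticAt_id.mul hg.analyticAt
  obtain ⟨Λ, s, hs, hL⟩ := (han.contDiffAt (n := 1)).exists_lipschitzOnWith
  have hev : ∀ᶠ k : ℝ in 𝓝 0, k ^ 2 ∈ s :=
    ((continuous_pow 2).tendsto' (0 : ℝ) 0 (by simp)).eventually hs
  obtain ⟨δ, hδ, hball⟩ := Metric.eventually_nhds_iff.1 hev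
  refine ⟨Λ, min δ k₀, Λ.2, lt_min hδ hk₀, min_le_right _ _, fun k k' hk hk' => ?_⟩
  have h1 := hball (y := k) (by simpa using hk.trans_le (min_le_left _ _))
  have h2 := hball (y := k') (by simpa using hk'.trans_le (min_le_left _ _))
  rw [hlam k (hk.trans_le (min_le_right _ _)), hlam k' (hk'.trans_le (min_le_right _ _))]
  have := hL.dist_le_mul _ h2 _ h1
  simpa [Real.dist_eq] using this

theorem HasSlowExpansion.coeff_unique {k₀ k₁ : ℝ} {lam lam₁ : ℝ → ℝ} {K K₁ : ℕ → ℝ}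
    (hk₀ : 0 < k₀) (hk₁ : 0 < k₁) (h : HasSlowExpansion k₀ lam K)
    (h₁ : HasSlowExpansion k₁ lam₁ K₁) (heq : lam₁ =ᶠ[𝓝 0] lam) : K₁ = K := by
  obtain ⟨g, hg, -, hlam⟩ := h.exists_analytic hk₀
  obtain ⟨g₁, hg₁, -, hlam₁⟩ := h₁.exists_analytic hk₁
  obtain ⟨δ, hδ, hball⟩ := Metric.eventually_nhds_iff.1 heq
  have hpos : ∀ᶠ x in 𝓝[>] (0 : ℝ), g₁ x = g x := by
    have hsqrt : ∀ᶠ x in 𝓝[>] (0 : ℝ), √x < min δ (min k₀ k₁) :=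
      nhdsWithin_le_nhds ((Real.continuous_sqrt.tendsto' 0 0 Real.sqrt_zero).eventually
        (gt_mem_nhds (lt_min hδ (lt_min hk₀ hk₁))))
    filter_upwards [hsqrt, self_mem_nhdsWithin] with x hx hx0
    have hx0 : 0 < x := hx0
    have habs : |√x| = √x := abs_of_nonneg (Real.sqrt_nonneg x)
    have e := hball (y := √x) (by
      rw [Real.dist_eq, sub_zero, habs]; exact hx.trans_le (min_le_left _ _))
    rw [hlam _ (by rw [habs]; exact hx.trans_le ((min_le_right _ _).trans (min_le_left _ _))),
      hlam₁ _ (by rw [habs]; exact hx.trans_le ((min_le_right _ _).trans (min_le_right _ _))),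
      Real.sq_sqrt hx0.le] at e
    exact mul_left_cancel₀ hx0.ne' e
  have hfreq : ∃ᶠ x in 𝓝[≠] (0 : ℝ), g₁ x = g x :=
    hpos.frequently.filter_mono (nhdsWithin_mono _ fun x hx => ne_of_gt hx)
  have hev := (hg₁.analyticAt.frequently_eq_iff_eventually_eq hg.analyticAt).1 hfreq
  have hser := (hg₁.congr hev).eq_formalMultilinearSeries hg
  rw [FormalMultilinearSeries.ofScalars_series_eq_iff] at hser
  funext m
  have := congrFun hser m
  exact mul_left_cancel₀ (pow_ne_zero _ (by norm_num)) this

/-- The Taylor series of a holomorphic function that vanishes at the origin and is even on the real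
axis contains only the powers `k², k⁴, …`. -/
theorem exists_hasSlowExpansion {f : ℂ → ℂ} {R k₀ : ℝ}
    (hf : DifferentiableOn ℂ f (Metric.ball 0 R)) (hk₀ : k₀ ≤ R) (hf0 : f 0 = 0)
    (heven : ∀ k : ℝ, |k| < k₀ → f (-k) = f k) :
    ∃ K : ℕ → ℝ, HasSlowExpansion k₀ (fun k => (f k).re) K := by
  set a : ℕ → ℂ := fun n => (n.factorial : ℂ)⁻¹ * iteratedDeriv n f 0 with ha
  refine ⟨fun m => (-1) ^ (m + 1) * (a (2 * m + 2)).re, fun k hk => ?_⟩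
  have hmem : ∀ z : ℂ, ‖z‖ = |k| → HasSum (fun n => a n * z ^ n) (f z) := fun z hz => by
    have := Complex.hasSum_taylorSeries_on_ball hf (z := z)
      (by rw [mem_ball_zero_iff, hz]; exact hk.trans_le hk₀)
    refine this.congr_fun fun n => ?_
    simp only [ha, sub_zero, smul_eq_mul]; ring
  have h1 := hmem k (by simp)
  have h2 := hmem (-k) (by simp)
  rw [heven k hk] at h2
  have h3 : HasSum (fun n => (a n * (k : ℂ) ^ n + a n * (-k : ℂ) ^ n) / 2) (f k) := by
    simpa using (h1.add h2).div_const 2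
  have hinj : Function.Injective fun m : ℕ => 2 * m + 2 := fun x y hxy => by
    simp only at hxy; omega
  have h4 := (hinj.hasSum_iff (f := fun n => (a n * (k : ℂ) ^ n + a n * (-k : ℂ) ^ n) / 2) (by
    intro n hn
    rcases Nat.even_or_odd n with he | ho
    · obtain ⟨m, rfl⟩ := he
      rcases m with _ | m
      · simp [ha, hf0]
      · exact absurd ⟨m, by simp only; ring⟩ hn
    · rw [ho.neg_pow]; ring)).2 h3
  have h5 := (Complex.hasSum_iff _ _).1 h4
  refine h5.1.congr_fun fun m => ?_
  have hev : Even (2 * m + 2) := ⟨m + 1, by ring⟩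
  simp only [Function.comp, hev.neg_pow]
  rw [← mul_assoc, ← pow_add, Even.neg_one_pow ⟨m + 1, by ring⟩, one_mul,
    ← two_mul, mul_div_cancel_left₀ _ two_ne_zero, ← Complex.ofReal_pow, Complex.re_mul_ofReal]

end Expansion

section LinearODE

theorem hasDerivAt_cexp_mul_ofReal (a : ℂ) (t : ℝ) :
    HasDerivAt (fun t : ℝ => Complex.exp (a * t)) (Complex.exp (a * t) * a) t := by
  have : HasDerivAt (fun t : ℝ => a * (t : ℂ)) a t := by
    simpa using (Complex.ofRealCLM.hasDerivAt (x := t)).const_mul a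
  exact this.cexp

/-- Uniqueness for a scalar linear equation on `[0, ∞)`. -/
theorem eq_mul_exp_of_hasDerivWithinAt {a : ℂ} {s : ℝ → ℂ}
    (h : ∀ t, 0 ≤ t → HasDerivWithinAt s (a * s t) (Ici 0) t) {t : ℝ} (ht : 0 ≤ t) :
    s t = s 0 * Complex.exp (a * t) := by
  have hd : ∀ x, 0 ≤ x → HasDerivWithinAt (fun t : ℝ => s t * Complex.exp (-a * t)) 0 (Ici 0) x := by
    intro x hx
    refine ((h x hx).mul (hasDerivAt_cexp_mul_ofReal (-a) x).hasDerivWithinAt).congr_deriv ?_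
    ring
  have hc := constant_of_has_deriv_right_zero (a := 0) (b := t)
    (fun x hx => (hd x hx.1).continuousWithinAt.mono Icc_subset_Ici_self)
    (fun x hx => (hd x hx.1).mono (Ici_subset_Ici.2 hx.1)) t ⟨ht, le_rfl⟩
  simp only [Complex.ofReal_zero, mul_zero, Complex.exp_zero, mul_one] at hc
  rw [← hc, mul_assoc, ← Complex.exp_add]
  simp

theorem le_mul_exp_of_hasDerivWithinAt {b : ℝ} {e e' : ℝ → ℝ}
    (h : ∀ t, 0 ≤ t → HasDerivWithinAt e (e' t) (Ici 0) t) (hle : ∀ t, 0 ≤ t → e' t ≤ -b * e t)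
    {t : ℝ} (ht : 0 ≤ t) : e t ≤ e 0 * Real.exp (-b * t) := by
  have hd : ∀ x, 0 ≤ x → HasDerivWithinAt (fun t => e t * Real.exp (b * t))
      (e' x * Real.exp (b * x) + e x * (Real.exp (b * x) * b)) (Ici 0) x := fun x hx => by
    have he : HasDerivAt (fun t => Real.exp (b * t)) (Real.exp (b * x) * b) x := by
      simpa using ((hasDerivAt_id x).const_mul b).exp
    exact (h x hx).mul he.hasDerivWithinAt
  have hanti : AntitoneOn (fun t => e t * Real.exp (b * t)) (Ici 0) := by
    refine antitoneOn_of_hasDerivWithinAt_nonpos (convex_Ici 0)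
      (f' := fun x => e' x * Real.exp (b * x) + e x * (Real.exp (b * x) * b))
      (fun x hx => (hd x hx).continuousWithinAt) (fun x hx => ?_) (fun x hx => ?_)
    · exact (hd x (interior_subset hx)).mono interior_subset
    · have := hle x (interior_subset hx)
      have hp := Real.exp_pos (b * x)
      nlinarith
  have := hanti (mem_Ici.2 le_rfl) (mem_Ici.2 ht) ht
  simp only [mul_zero, Real.exp_zero, mul_one] at this
  calc e t = e t * Real.exp (b * t) * Real.exp (-b * t) := by
        rw [mul_assoc, ← Real.exp_add]; simp
    _ ≤ _ := mul_le_mul_of_nonneg_right this (Real.exp_pos _).le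

end LinearODE

/-! ### The emergent slow manifold -/

section Manifold

variable {p : ℕ} [NeZero p]

/-- Below the spectral gap, every solution approaches the slow manifold: its component orthogonal to
the slow eigenvector stays orthogonal, and its energy decays at twice the rate of the gap. -/
theorem emergent_of_gap {κ : ZMod p → ℝ} {k β lam : ℝ} {w : ZMod p → ℂ} (hw0 : w ≠ 0)
    (hgap : ∀ z : ZMod p → ℂ, ∑ l, conj (w l) * z l = 0 → β * ∑ l, ‖z l‖ ^ 2 ≤ dirichlet κ k z)
    (hw : ∀ l, symbol κ k w l = lam * w l) {d : ℝ} {y : ℝ → ZMod p → ℂ}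
    (hy : IsFourierSolution κ d k y) :
    ∃ Y₀ : ℂ, ∀ t, 0 ≤ t → ‖y t - (Y₀ * (Real.exp (lam * t / d ^ 2) : ℂ)) • w‖
      ≤ p * ‖y 0‖ * Real.exp (-β * t / d ^ 2) := by
  have hS : ((∑ l, ‖w l‖ ^ 2 : ℝ) : ℂ) ≠ 0 := by exact_mod_cast (sum_norm_sq_pos hw0).ne'
  set c : ℂ := (∑ l, conj (w l) * y 0 l) / ((∑ l, ‖w l‖ ^ 2 : ℝ) : ℂ) with hc
  refine ⟨c, ?_⟩
  set z : ℝ → ZMod p → ℂ := fun t => y t - (c * (Real.exp (lam * t / d ^ 2) : ℂ)) • w with hz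
  have hzsol : ∀ t, 0 ≤ t → ∀ l,
      HasDerivWithinAt (fun s => z s l) (((d : ℂ) ^ 2)⁻¹ * symbol κ k (z t) l) (Ici 0) t := by
    intro t ht l
    have he : HasDerivAt (fun s : ℝ => ((Real.exp (lam * s / d ^ 2) : ℝ) : ℂ))
        ((Real.exp (lam * t / d ^ 2) * (lam / d ^ 2) : ℝ) : ℂ) t := by
      have : HasDerivAt (fun s : ℝ => lam * s / d ^ 2) (lam / d ^ 2) t := by
        simpa using ((hasDerivAt_id t).const_mul lam).div_const (d ^ 2)
      exact this.exp.ofReal_comp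
    refine ((hy t ht l).sub ((he.const_mul c).mul_const (w l)).hasDerivWithinAt).congr_deriv ?_
    simp only [hz]
    rw [symbol_sub, symbol_smul, hw]
    push_cast
    ring
  -- The component along `w` vanishes for all times.
  have horth : ∀ t, 0 ≤ t → ∑ l, conj (w l) * z t l = 0 := by
    have h0 : ∑ l, conj (w l) * z 0 l = 0 := by
      have : ∑ l, conj (w l) * z 0 l = ∑ l, conj (w l) * y 0 l - c * ∑ l, conj (w l) * w l := by
        rw [Finset.mul_sum, ← Finset.sum_sub_distrib]
        refine Finset.sum_congr rfl fun l _ => ?_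
        simp [hz]; ring
      rw [this, sum_conj_mul_self, hc, div_mul_cancel₀ _ hS, sub_self]
    intro t ht
    have := eq_mul_exp_of_hasDerivWithinAt (a := ((d : ℂ) ^ 2)⁻¹ * lam)
      (s := fun t => ∑ l, conj (w l) * z t l) (fun t ht => by
        refine (HasDerivWithinAt.fun_sum fun l _ =>
          (hzsol t ht l).const_mul (conj (w l))).congr_deriv ?_
        have h1 := sum_conj_mul_symbol_comm κ k w (z t)
        simp only [hw, map_mul, Complex.conj_ofReal] at h1
        calc ∑ l, conj (w l) * (((d : ℂ) ^ 2)⁻¹ * symbol κ k (z t) l)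
            = ((d : ℂ) ^ 2)⁻¹ * ∑ l, conj (w l) * symbol κ k (z t) l := by
              rw [Finset.mul_sum]; exact Finset.sum_congr rfl fun l _ => by ring
          _ = _ := by
              rw [h1, Finset.mul_sum, Finset.mul_sum]
              exact Finset.sum_congr rfl fun l _ => by ring) ht
    simp only [h0, zero_mul] at this
    exact this
  have henergy : ∀ t, 0 ≤ t → HasDerivWithinAt (fun s => ∑ l, ‖z s l‖ ^ 2)
      (-(2 * (d ^ 2)⁻¹ * dirichlet κ k (z t))) (Ici 0) t := by
    intro t ht
    refine (HasDerivWithinAt.fun_sum fun l _ => (hzsol t ht l).norm_sq).congr_deriv ?_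
    have h1 := congrArg Complex.re (sum_conj_mul_symbol_self κ k (z t))
    rw [Complex.re_sum, Complex.neg_re, Complex.ofReal_re] at h1
    calc _ = 2 * (d ^ 2)⁻¹ * ∑ l, (conj (z t l) * symbol κ k (z t) l).re := by
          rw [Finset.mul_sum]
          refine Finset.sum_congr rfl fun l _ => ?_
          rw [Complex.inner, show ((d : ℂ) ^ 2)⁻¹ * symbol κ k (z t) l * conj (z t l)
            = (((d ^ 2)⁻¹ : ℝ) : ℂ) * (conj (z t l) * symbol κ k (z t) l) by push_cast; ring,
            Complex.re_ofReal_mul]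
          ring
      _ = _ := by rw [h1]; ring
  intro t ht
  have hdecay := le_mul_exp_of_hasDerivWithinAt (b := 2 * β / d ^ 2) henergy (fun t ht => by
    have h1 := hgap (z t) (horth t ht)
    have h2 : 0 ≤ 2 * (d ^ 2)⁻¹ := by positivity
    have h3 := mul_le_mul_of_nonneg_left h1 h2
    calc _ ≤ -(2 * (d ^ 2)⁻¹ * (β * ∑ l, ‖z t l‖ ^ 2)) := neg_le_neg h3
      _ = _ := by ring) ht
  have hinit : ∑ l, ‖z 0 l‖ ^ 2 ≤ (p * ‖y 0‖) ^ 2 := by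
    have h1 : ∑ l, ‖z 0 l‖ ^ 2 ≤ ∑ l, ‖y 0 l‖ ^ 2 := by
      have hzw : ∑ l, conj (z 0 l) * (c * w l) = 0 := by
        have := congrArg (fun x => c * conj x) (horth 0 le_rfl)
        simp only [map_sum, map_mul, Complex.conj_conj, map_zero, mul_zero] at this
        rw [← this, Finset.mul_sum]; exact Finset.sum_congr rfl fun l _ => by ring
      have hre := congrArg Complex.re hzw
      rw [Complex.re_sum, Complex.zero_re] at hre
      have hpt : ∀ l, ‖z 0 l‖ ^ 2 ≤ ‖y 0 l‖ ^ 2 - 2 * (conj (z 0 l) * (c * w l)).re := fun l => by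
        have hyl : y 0 l = z 0 l + c * w l := by simp [hz]
        rw [hyl, ← Complex.normSq_eq_norm_sq, ← Complex.normSq_eq_norm_sq, Complex.normSq_add]
        have := Complex.normSq_nonneg (c * w l)
        have h2 : (z 0 l * conj (c * w l)).re = (conj (z 0 l) * (c * w l)).re := by
          rw [← Complex.conj_re, map_mul, Complex.conj_conj]
        rw [h2]; linarith
      calc _ ≤ ∑ l, (‖y 0 l‖ ^ 2 - 2 * (conj (z 0 l) * (c * w l)).re) :=
            Finset.sum_le_sum fun l _ => hpt l
        _ = _ := by rw [Finset.sum_sub_distrib, ← Finset.mul_sum, hre]; ring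
    have h2 : ∑ l, ‖y 0 l‖ ^ 2 ≤ p * ‖y 0‖ ^ 2 := by
      calc _ ≤ ∑ _l : ZMod p, ‖y 0‖ ^ 2 :=
            Finset.sum_le_sum fun l _ => pow_le_pow_left₀ (norm_nonneg _) (norm_le_pi_norm _ l) 2
        _ = _ := by simp [ZMod.card]
    have hp : (1 : ℝ) ≤ p := by exact_mod_cast Nat.one_le_iff_ne_zero.2 (NeZero.ne p)
    nlinarith [sq_nonneg ‖y 0‖, mul_nonneg (sub_nonneg.2 hp) (sq_nonneg ‖y 0‖)]
  have hbound : (0 : ℝ) ≤ p * ‖y 0‖ * Real.exp (-β * t / d ^ 2) := by positivity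
  refine (pi_norm_le_iff_of_nonneg hbound).2 fun l => ?_
  refine le_of_sq_le_sq ?_ hbound
  calc ‖z t l‖ ^ 2 ≤ ∑ l, ‖z t l‖ ^ 2 :=
        Finset.single_le_sum (f := fun l => ‖z t l‖ ^ 2) (fun _ _ => sq_nonneg _) (Finset.mem_univ l)
    _ ≤ _ := hdecay
    _ ≤ (p * ‖y 0‖) ^ 2 * Real.exp (-(2 * β / d ^ 2) * t) := by gcongr
    _ = _ := by
        rw [mul_pow _ (Real.exp _), ← Real.exp_nat_mul]
        congr 2; push_cast; ring

/-- The leading coefficient is the harmonic mean of the diffusivities: to first order in `k` the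
flux is the same across all bonds, and the bond differences sum to `(e^{ik} - 1) p`. -/
theorem leading_coefficient {κ : ZMod p → ℝ} (hκ : ∀ l, 0 < κ l) {k₀ : ℝ}
    {w : ℝ → ZMod p → ℂ} {lam : ℝ → ℝ} {K : ℕ → ℝ} (hk₀ : 0 < k₀) (hw : DifferentiableAt ℝ w 0)
    (hw0 : w 0 = fun _ => 1) (hmean : ∀ k, |k| < k₀ → ensembleMean (w k) = 1)
    (hinv : ∀ k, |k| < k₀ → ∀ l, symbol κ k (w k) l = lam k * w k l)
    (hK : HasSlowExpansion k₀ lam K) : K 0 = p / ∑ l, (κ l)⁻¹ := by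
  have hp : (p : ℂ) ≠ 0 := by exact_mod_cast NeZero.ne p
  have hev : ∀ᶠ k : ℝ in 𝓝 0, |k| < k₀ :=
    (continuous_abs.tendsto' 0 0 abs_zero).eventually (gt_mem_nhds hk₀)
  have hsum : ∀ k, |k| < k₀ → ∑ l, w k l = p := fun k hk => by
    have := hmean k hk
    rw [ensembleMean, Complex.real_smul] at this
    push_cast at this
    field_simp at this
    exact this
  have hI : HasDerivAt (fun k : ℝ => Complex.I * (k : ℂ)) Complex.I 0 := by
    simpa using (Complex.ofRealCLM.hasDerivAt (x := (0 : ℝ))).const_mul Complex.I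
  have hexp : HasDerivAt (fun k : ℝ => Complex.exp (Complex.I * k)) Complex.I 0 := by
    simpa using hI.cexp
  have hexp' : HasDerivAt (fun k : ℝ => Complex.exp (-(Complex.I * k))) (-Complex.I) 0 := by
    simpa using hI.neg.cexp
  obtain ⟨D, hD⟩ : ∃ D : ZMod p → ℂ, ∀ l, HasDerivAt (fun k => bondDiff k (w k) l) (D l) 0 := by
    have hwl := hasDerivAt_pi.1 hw.hasDerivAt
    exact ⟨_, fun l => (hexp.mul (hwl (l + 1))).sub (hwl l)⟩
  have hb0 : ∀ l, bondDiff 0 (w 0) l = 0 := fun l => by simp [bondDiff, hw0]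
  have hlam : HasDerivAt (fun k => (lam k : ℂ)) 0 0 := by
    have h1 : HasDerivAt lam 0 0 := by
      rw [hasDerivAt_iff_tendsto_slope]
      have h2 : Tendsto (fun k : ℝ => k * (lam k / k ^ 2)) (𝓝[≠] 0) (𝓝 (0 * -K 0)) :=
        (tendsto_id.mono_left nhdsWithin_le_nhds).mul (hK.tendsto_div_sq hk₀)
      rw [zero_mul] at h2
      refine h2.congr' ?_
      filter_upwards [self_mem_nhdsWithin] with k hk
      have : k ≠ 0 := hk
      rw [slope_def_field, hK.lam_zero hk₀]
      field_simp
      ring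
    simpa using h1.ofReal_comp
  have hflux : ∀ l, (κ l : ℂ) * D l = κ (l - 1) * D (l - 1) := fun l => by
    have h1 : HasDerivAt (fun k : ℝ => (κ l : ℂ) * bondDiff k (w k) l
        - Complex.exp (-(Complex.I * k)) * (κ (l - 1) * bondDiff k (w k) (l - 1)))
        (κ l * D l - κ (l - 1) * D (l - 1)) 0 := by
      refine (((hD l).const_mul _).sub (hexp'.mul ((hD (l - 1)).const_mul _))).congr_deriv ?_
      simp [hb0]
    have h2 : HasDerivAt (fun k => (lam k : ℂ) * w k l) 0 0 := by
      refine (hlam.mul (hasDerivAt_pi.1 hw.hasDerivAt l)).congr_deriv ?_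
      simp [hK.lam_zero hk₀]
    have h3 := h2.congr_of_eventuallyEq (f₁ := fun k : ℝ => (κ l : ℂ) * bondDiff k (w k) l
        - Complex.exp (-(Complex.I * k)) * (κ (l - 1) * bondDiff k (w k) (l - 1)))
      (hev.mono fun k hk => by
        simp only [← hinv k hk l, symbol_eq_flux])
    exact sub_eq_zero.1 (h1.unique h3)
  have hconst : ∀ l, (κ l : ℂ) * D l = κ 0 * D 0 :=
    const_of_shift_invariant fun l => by simpa using hflux (l + 1)
  have hκ0 : ∀ l, (κ l : ℂ) ≠ 0 := fun l => by exact_mod_cast (hκ l).ne'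
  have hDsum : ∑ l, D l = Complex.I * p := by
    have h1 : HasDerivAt (fun k => ∑ l, bondDiff k (w k) l) (∑ l, D l) 0 :=
      HasDerivAt.fun_sum fun l _ => hD l
    have h2 : HasDerivAt (fun k : ℝ => (Complex.exp (Complex.I * k) - 1) * p)
        (Complex.I * p) 0 := (hexp.sub_const 1).mul_const _
    refine h1.unique (h2.congr_of_eventuallyEq (hev.mono fun k hk => ?_))
    have hsh : ∑ l, w k (l + 1) = ∑ l, w k l := Equiv.sum_comp (Equiv.addRight (1 : ZMod p)) (w k)
    simp only [bondDiff, Finset.sum_sub_distrib, ← Finset.mul_sum, hsh, hsum k hk]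
    ring
  have hFsum : (κ 0 * D 0 : ℂ) * ∑ l, (κ l : ℂ)⁻¹ = Complex.I * p := by
    rw [← hDsum, Finset.mul_sum]
    exact Finset.sum_congr rfl fun l _ => by rw [← hconst l]; field_simp [hκ0 l]
  have hlim1 : Tendsto (fun k : ℝ => ((lam k / k ^ 2 : ℝ) : ℂ) * p) (𝓝[≠] 0)
      (𝓝 (((-K 0 : ℝ) : ℂ) * p)) :=
    ((Complex.continuous_ofReal.tendsto _).comp (hK.tendsto_div_sq hk₀)).mul_const _
  have hlim2 : Tendsto (fun k : ℝ => ((lam k / k ^ 2 : ℝ) : ℂ) * p) (𝓝[≠] 0)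
      (𝓝 (Complex.I * ∑ l, κ l * D l)) := by
    have h1 : Tendsto (slope (fun k : ℝ => 1 - Complex.exp (-(Complex.I * k))) 0) (𝓝[≠] 0)
        (𝓝 Complex.I) := by
      have : HasDerivAt (fun k : ℝ => 1 - Complex.exp (-(Complex.I * k))) Complex.I 0 := by
        simpa using hexp'.const_sub 1
      exact hasDerivAt_iff_tendsto_slope.1 this
    have h2 : Tendsto (slope (fun k => ∑ l, (κ l : ℂ) * bondDiff k (w k) l) 0) (𝓝[≠] 0)
        (𝓝 (∑ l, κ l * D l)) :=
      hasDerivAt_iff_tendsto_slope.1 (HasDerivAt.fun_sum fun l _ => (hD l).const_mul _)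
    refine (h1.mul h2).congr' ?_
    filter_upwards [nhdsWithin_le_nhds hev, self_mem_nhdsWithin] with k hk hk0
    have hk0' : (k : ℂ) ≠ 0 := by exact_mod_cast hk0
    have h3 : (lam k : ℂ) * p = (1 - Complex.exp (-(Complex.I * k)))
        * ∑ l, (κ l : ℂ) * bondDiff k (w k) l := by
      have hsh := sum_shift (fun l => (κ l : ℂ) * bondDiff k (w k) l)
      rw [← hsum k hk, Finset.mul_sum, Finset.sum_congr rfl fun l _ => (hinv k hk l).symm,
        Finset.sum_congr rfl fun l _ => symbol_eq_flux κ k (w k) l, Finset.sum_sub_distrib,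
        ← Finset.mul_sum, hsh]
      ring
    simp only [slope, vsub_eq_sub, sub_zero, hb0, mul_zero, Finset.sum_const_zero,
      Complex.ofReal_zero, neg_zero, Complex.exp_zero, sub_self, Complex.real_smul]
    push_cast
    rw [show ((lam k : ℂ) / k ^ 2) * p = (lam k * p) / k ^ 2 by ring, h3]
    field_simp
  have hK0 := tendsto_nhds_unique hlim1 hlim2
  rw [Finset.sum_congr rfl fun l _ => hconst l] at hK0
  simp only [Finset.sum_const, Finset.card_univ, ZMod.card, nsmul_eq_mul, Complex.ofReal_neg] at hK0
  have hSpos : 0 < ∑ l, (κ l)⁻¹ := Finset.sum_pos (fun l _ => inv_pos.2 (hκ l)) Finset.univ_nonempty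
  have hS : (∑ l, (κ l : ℂ)⁻¹) ≠ 0 := by exact_mod_cast hSpos.ne'
  have hK1 : (K 0 : ℂ) = -Complex.I * (κ 0 * D 0) := by
    apply mul_right_cancel₀ hp; linear_combination -hK0
  have : (K 0 : ℂ) * ∑ l, (κ l : ℂ)⁻¹ = p := by
    rw [hK1, mul_assoc, hFsum]
    linear_combination (-(p : ℂ)) * Complex.I_mul_I
  rw [eq_div_iff hSpos.ne']
  exact_mod_cast this

theorem analyticAt_comp_ofReal {E : Type*} [NormedAddCommGroup E] [NormedSpace ℂ E] {W : ℂ → E}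
    {k : ℝ} (h : AnalyticAt ℂ W k) : AnalyticAt ℝ (fun k : ℝ => W k) k := by
  have h1 : AnalyticAt ℝ W (Complex.ofRealCLM k) := h.restrictScalars
  exact h1.comp (Complex.ofRealCLM.analyticAt k)

/-- Existence of the slow manifold, together with the spectral gap that separates it from the
other modes. -/
theorem exists_slowManifold {κ : ZMod p → ℝ} (hκ : ∀ l, 0 < κ l) :
    ∃ (k₀ β : ℝ) (w : ℝ → ZMod p → ℂ) (lam : ℝ → ℝ) (K : ℕ → ℝ),
      IsSlowManifold κ k₀ w lam ∧ HasSlowExpansion k₀ lam K ∧ 0 < β ∧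
      (∀ k, |k| < k₀ → |lam k| < β) ∧
      (∀ k, |k| < k₀ → ∀ z : ZMod p → ℂ, ∑ l, conj (w k l) * z l = 0 →
        β * ∑ l, ‖z l‖ ^ 2 ≤ dirichlet κ k z) := by
  obtain ⟨W, R, hR, hWd, hW0, hW⟩ := exists_eigenvector_branch hκ
  have hWan : ∀ k : ℝ, |k| < R → AnalyticAt ℝ (fun k : ℝ => W k) k := fun k hk => by
    have h1 : AnalyticAt ℂ W k := hWd.analyticAt (Metric.isOpen_ball.mem_nhds (by simpa using hk))
    exact analyticAt_comp_ofReal h1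
  set f : ℂ → ℂ := fun k => ensembleMean (complexSymbol κ k (W k)) with hf
  have hfd : DifferentiableOn ℂ f (Metric.ball 0 R) := by
    have h1 := (contDiff_ensembleMean_complexSymbol κ (n := 1)).differentiable (by simp)
    have h2 : DifferentiableOn ℂ (fun k => (k, W k)) (Metric.ball 0 R) :=
      differentiableOn_id.prodMk hWd
    have h3 := h1.comp_differentiableOn h2
    simpa only [Function.comp_def] using h3
  have hf0 : f 0 = 0 := by
    simp only [hf]; exact ensembleMean_symbol_zero κ _
  have hinv : ∀ k : ℝ, |k| < R → ∀ l, symbol κ k (W k) l = ((f k).re : ℂ) * W k l := by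
    intro k hk l
    obtain ⟨h1, h2⟩ := hW k (by simpa using hk)
    have hne : W k ≠ 0 := by
      intro h0; rw [h0] at h1; simp [ensembleMean] at h1
    have := eigenvalue_eq_neg_div (μ := f k) hne fun l => by
      rw [symbol_eq_complexSymbol]; exact h2 l
    rw [symbol_eq_complexSymbol, h2 l]
    change f k * _ = _
    rw [this, Complex.ofReal_re]
  obtain ⟨β, hβ, hgap⟩ := exists_gap hκ (w := fun k : ℝ => W k)
    (hWan 0 (by simpa using hR)).continuousAt (by simpa using hW0)
  have hlamc : ContinuousAt (fun k : ℝ => (f k).re) 0 := by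
    have h1 : ContinuousAt f ((0 : ℝ) : ℂ) :=
      (hfd.differentiableAt (Metric.isOpen_ball.mem_nhds (by simpa using hR))).continuousAt
    exact Complex.continuous_re.continuousAt.comp
      (ContinuousAt.comp (f := fun k : ℝ => (k : ℂ)) (g := f) h1 (by fun_prop))
  have hsmall : ∀ᶠ k : ℝ in 𝓝 0, |(f k).re| < β := by
    refine hlamc.abs.eventually (gt_mem_nhds ?_)
    simpa [hf0] using hβ
  obtain ⟨δ, hδ, hball⟩ := Metric.eventually_nhds_iff.1 (hgap.and hsmall)
  have hball' : ∀ k : ℝ, |k| < δ → _ := fun k hk => hball (y := k) (by simpa using hk)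
  set k₀ := min δ R with hk₀
  have hpos : 0 < k₀ := lt_min hδ hR
  have hkδ : ∀ {k : ℝ}, |k| < k₀ → |k| < δ := fun h => h.trans_le (min_le_left _ _)
  have hkR : ∀ {k : ℝ}, |k| < k₀ → |k| < R := fun h => h.trans_le (min_le_right _ _)
  have hreal : ∀ k : ℝ, |k| < k₀ → f k = ((f k).re : ℂ) := fun k hk => by
    have h1 := congrArg ensembleMean (funext (hinv k (hkR hk)))
    rw [symbol_eq_complexSymbol, show (fun l => ((f k).re : ℂ) * W k l) = ((f k).re : ℂ) • W k
      from rfl, ensembleMean_smul, (hW k (by simpa using hkR hk)).1, mul_one] at h1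
    exact h1
  -- The complex conjugate of the eigenvector at `-k` is an eigenvector at `k`.
  have heven : ∀ k : ℝ, |k| < k₀ → f (-k) = f k := fun k hk => by
    have hk' : |-k| < k₀ := by rwa [abs_neg]
    have h1 := eigenvector_unique (μ := (f (-k : ℝ)).re) (u := fun l => conj (W (-k : ℝ) l))
      (hball' k (hkδ hk)).1 (hinv k (hkR hk)) (hW k (by simpa using hkR hk)).1
      (fun l => by
        have := congrArg conj (hinv (-k) (hkR hk') l)
        rw [conj_symbol, neg_neg] at this
        simpa using this)
      (by
        have := congrArg conj (hW (-k : ℝ) (by simpa using hkR hk)).1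
        simpa [ensembleMean] using this)
      (hball' (-k) (hkδ hk')).2
    rw [hreal k hk, ← h1.2, ← hreal (-k) hk', Complex.ofReal_neg]
  obtain ⟨K, hK⟩ := exists_hasSlowExpansion hfd (min_le_right δ R) hf0 heven
  refine ⟨k₀, β, fun k => W k, fun k => (f k).re, K, ?_, hK, hβ, fun k hk => (hball' k (hkδ hk)).2,
    fun k hk => (hball' k (hkδ hk)).1⟩
  refine ⟨hpos, fun k hk => hWan k (hkR (abs_lt.2 hk)), by simpa using hW0,
    fun k hk => (hW k (by simpa using hkR hk)).1, fun k hk => hinv k (hkR hk),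
    β, p, hβ, fun k hk => ⟨(hball' k (hkδ hk)).2, fun d y _ hy => ?_⟩⟩
  refine emergent_of_gap (fun h0 => ?_) (hball' k (hkδ hk)).1 (hinv k (hkR hk)) hy
  have := (hW k (by simpa using hkR hk)).1
  rw [h0] at this
  simp [ensembleMean] at this

theorem IsSlowManifold.leading_coefficient {κ : ZMod p → ℝ} (hκ : ∀ l, 0 < κ l) {k₀ : ℝ}
    {w : ℝ → ZMod p → ℂ} {lam : ℝ → ℝ} {K : ℕ → ℝ} (h : IsSlowManifold κ k₀ w lam)
    (hK : HasSlowExpansion k₀ lam K) : K 0 = p / ∑ l, (κ l)⁻¹ :=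
  PatchEnsemble.leading_coefficient hκ h.pos
    (h.analytic 0 ⟨by linarith [h.pos], h.pos⟩).differentiableAt h.equilibria h.mean h.invariant hK

theorem IsSlowManifold.lam_nonpos {κ : ZMod p → ℝ} (hκ : ∀ l, 0 < κ l) {k₀ : ℝ}
    {w : ℝ → ZMod p → ℂ} {lam : ℝ → ℝ} (h : IsSlowManifold κ k₀ w lam) {k : ℝ} (hk : |k| < k₀) :
    lam k ≤ 0 := by
  have hne : w k ≠ 0 := by
    intro h0; have h1 := h.mean k hk; rw [h0] at h1; simp [ensembleMean] at h1
  have h1 : lam k = _ := Complex.ofReal_injective (eigenvalue_eq_neg_div hne (h.invariant k hk))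
  rw [h1, neg_nonpos]
  exact div_nonneg (dirichlet_nonneg hκ _ _) (sum_norm_sq_pos hne).le

/-- For small `k`, the eigenvalue on any other slow manifold lies below the spectral gap, so that
both manifolds agree. -/
theorem coefficients_unique {κ : ZMod p → ℝ} {k₀ β : ℝ}
    {w : ℝ → ZMod p → ℂ} {lam : ℝ → ℝ} {K : ℕ → ℝ} (h : IsSlowManifold κ k₀ w lam)
    (hK : HasSlowExpansion k₀ lam K) (hβ : 0 < β)
    (hgap : ∀ k, |k| < k₀ → ∀ z : ZMod p → ℂ, ∑ l, conj (w k l) * z l = 0 →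
        β * ∑ l, ‖z l‖ ^ 2 ≤ dirichlet κ k z)
    {k₁ : ℝ} {w₁ : ℝ → ZMod p → ℂ} {lam₁ : ℝ → ℝ} {K₁ : ℕ → ℝ}
    (h₁ : IsSlowManifold κ k₁ w₁ lam₁) (hK₁ : HasSlowExpansion k₁ lam₁ K₁) : K₁ = K := by
  refine hK.coeff_unique h.pos h₁.pos hK₁ ?_
  have hev : ∀ {b : ℝ}, 0 < b → ∀ᶠ k : ℝ in 𝓝 0, |k| < b := fun hb =>
    (continuous_abs.tendsto' 0 0 abs_zero).eventually (gt_mem_nhds hb)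
  have hsmall : ∀ᶠ k : ℝ in 𝓝 0, |lam₁ k| < β := by
    refine (hK₁.continuousAt_zero h₁.pos).abs.eventually (gt_mem_nhds ?_)
    simpa [hK₁.lam_zero h₁.pos] using hβ
  filter_upwards [hev h.pos, hev h₁.pos, hsmall] with k hk hk1 hs
  exact (eigenvector_unique (hgap k hk) (h.invariant k hk) (h.mean k hk) (h₁.invariant k hk1)
    (h₁.mean k hk1) hs).2

/-- The slow eigenvectors at `k` and `-k` are complex conjugate. -/
theorem conj_eigenvector {κ : ZMod p → ℝ} {k₀ β : ℝ}
    {w : ℝ → ZMod p → ℂ} {lam : ℝ → ℝ} (h : IsSlowManifold κ k₀ w lam)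
    (hlam : ∀ k, |k| < k₀ → |lam k| < β)
    (hgap : ∀ k, |k| < k₀ → ∀ z : ZMod p → ℂ, ∑ l, conj (w k l) * z l = 0 →
        β * ∑ l, ‖z l‖ ^ 2 ≤ dirichlet κ k z) {k : ℝ} (hk : |k| < k₀) (l : ZMod p) :
    conj (w k l) = w (-k) l := by
  have hk' : |-k| < k₀ := by rwa [abs_neg]
  have h1 := eigenvector_unique (μ := lam k) (u := fun l => conj (w k l))
    (hgap (-k) hk') (h.invariant (-k) hk') (h.mean (-k) hk')
    (fun l => by
      have := congrArg conj (h.invariant k hk l)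
      rw [conj_symbol] at this
      simpa using this)
    (by
      have := congrArg conj (h.mean k hk)
      simpa [ensembleMean] using this)
    (hlam k hk)
  exact congrFun h1.1 l

end Manifold

/-! ### Superpositions on the slow manifold -/

section Superposition

open MeasureTheory
open scoped Interval

theorem hasDerivAt_integral_cexp {a b : ℝ} {z g : ℝ → ℂ} (hz : ContinuousOn z (uIcc a b))
    (hg : ContinuousOn g (uIcc a b)) (x : ℝ) :
    HasDerivAt (fun x : ℝ => ∫ k in a..b, Complex.exp (z k * x) * g k)
      (∫ k in a..b, Complex.exp (z k * x) * (z k * g k)) x := by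
  have hF : ∀ x : ℝ, ContinuousOn (fun k => Complex.exp (z k * x) * g k) (uIcc a b) := fun x =>
    ((hz.mul continuousOn_const).cexp).mul hg
  have hF' : ContinuousOn (fun k => Complex.exp (z k * x) * (z k * g k)) (uIcc a b) :=
    ((hz.mul continuousOn_const).cexp).mul (hz.mul hg)
  have hmeas : ∀ {f : ℝ → ℂ}, ContinuousOn f (uIcc a b) →
      AEStronglyMeasurable f (volume.restrict (Ι a b)) := fun hf =>
    (hf.mono uIoc_subset_uIcc).aestronglyMeasurable measurableSet_uIoc
  have hbc : ContinuousOn (fun k => Real.exp (‖z k‖ * (|x| + 1)) * (‖z k‖ * ‖g k‖)) (uIcc a b) :=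
    (Real.continuous_exp.comp_continuousOn (hz.norm.mul continuousOn_const)).mul
      (hz.norm.mul hg.norm)
  refine (intervalIntegral.hasDerivAt_integral_of_dominated_loc_of_deriv_le
    (F := fun x k => Complex.exp (z k * (x : ℝ)) * g k)
    (F' := fun x k => Complex.exp (z k * (x : ℝ)) * (z k * g k))
    (bound := fun k => Real.exp (‖z k‖ * (|x| + 1)) * (‖z k‖ * ‖g k‖))
    (Metric.ball_mem_nhds x one_pos) (Eventually.of_forall fun x => hmeas (hF x))
    (hF x).intervalIntegrable (hmeas hF') (Eventually.of_forall fun k _ y hy => ?_)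
    hbc.intervalIntegrable (Eventually.of_forall fun k _ y _ => ?_)).2
  · have hy' : |y| ≤ |x| + 1 := by
      have h1 : |y - x| < 1 := by simpa [Real.dist_eq] using hy
      have h2 := abs_sub_abs_le_abs_sub y x
      linarith
    rw [norm_mul, norm_mul, Complex.norm_exp]
    gcongr
    calc (z k * y).re ≤ ‖z k * y‖ := Complex.re_le_norm _
      _ = ‖z k‖ * |y| := by rw [norm_mul, Complex.norm_real, Real.norm_eq_abs]
      _ ≤ _ := by gcongr
  · have h1 : HasDerivAt (fun x : ℝ => z k * (x : ℂ)) (z k) y := by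
      simpa using (Complex.ofRealCLM.hasDerivAt (x := y)).const_mul (z k)
    refine (h1.cexp.mul_const (g k)).congr_deriv ?_
    ring

theorem iteratedDeriv_integral_cexp {a b : ℝ} {z g : ℝ → ℂ} (hz : ContinuousOn z (uIcc a b))
    (hg : ContinuousOn g (uIcc a b)) (n : ℕ) :
    iteratedDeriv n (fun x : ℝ => ∫ k in a..b, Complex.exp (z k * x) * g k)
      = fun x : ℝ => ∫ k in a..b, Complex.exp (z k * x) * (z k ^ n * g k) := by
  induction n with
  | zero => simp
  | succ n ih =>
    rw [iteratedDeriv_succ, ih]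
    funext x
    have hgn : ContinuousOn (fun k => z k ^ n * g k) (uIcc a b) := (hz.pow n).mul hg
    rw [(hasDerivAt_integral_cexp hz hgn x).deriv]
    simp only [pow_succ']
    refine intervalIntegral.integral_congr fun k _ => ?_
    simp only [mul_assoc]

theorem contDiff_integral_cexp {a b : ℝ} {z g : ℝ → ℂ} (hz : ContinuousOn z (uIcc a b))
    (hg : ContinuousOn g (uIcc a b)) :
    ContDiff ℝ ∞ (fun x : ℝ => ∫ k in a..b, Complex.exp (z k * x) * g k) := by
  refine contDiff_of_differentiable_iteratedDeriv fun n _ => ?_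
  rw [iteratedDeriv_integral_cexp hz hg]
  have hgn : ContinuousOn (fun k => z k ^ n * g k) (uIcc a b) := (hz.pow n).mul hg
  exact fun x => (hasDerivAt_integral_cexp hz hgn x).differentiableAt

variable {p : ℕ}

/-- Along a diagonal of the wrapped arrangement one follows a single member of the ensemble. -/
theorem IsEnsembleSolution.isDiffusionSolution {E : Type*} [NormedAddCommGroup E]
    [NormedSpace ℝ E] {κ : ZMod p → ℝ} {d : ℝ} {v : ℝ → ℤ → ZMod p → E}
    (h : IsEnsembleSolution .wrapped κ d v) (φ : ZMod p) :
    IsDiffusionSolution κ d φ fun t i => v t i ((i : ZMod p) + φ) := by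
  intro t ht i
  refine (h t ht i ((i : ZMod p) + φ)).congr_deriv ?_
  simp only [ensembleRate, diffusionRate]
  push_cast
  rw [show (i : ZMod p) + 1 + φ = i + φ + 1 by ring, show (i : ZMod p) - 1 + φ = i + φ - 1 by ring]

variable [NeZero p]

theorem IsSlowManifold.continuousOn_lam {κ : ZMod p → ℝ} {k₀ : ℝ}
    {w : ℝ → ZMod p → ℂ} {lam : ℝ → ℝ} (h : IsSlowManifold κ k₀ w lam) :
    ContinuousOn lam (Ioo (-k₀) k₀) := by
  have hw := h.analytic.continuousOn
  have h1 : Continuous fun x : ℂ × (ZMod p → ℂ) => ensembleMean (complexSymbol κ x.1 x.2) :=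
    (contDiff_ensembleMean_complexSymbol κ (n := 0)).continuous
  have h2 : ContinuousOn (fun k : ℝ => ((k : ℂ), w k)) (Ioo (-k₀) k₀) :=
    Complex.continuous_ofReal.continuousOn.prodMk hw
  have h3 := Complex.continuous_re.comp_continuousOn (h1.comp_continuousOn h2)
  refine h3.congr fun k hk => ?_
  have hk' : |k| < k₀ := abs_lt.2 hk
  have h4 : complexSymbol κ k (w k) = (lam k : ℂ) • w k := funext fun l => by
    rw [← symbol_eq_complexSymbol, h.invariant k hk']; rfl
  simp only [Function.comp_apply, h4, ensembleMean_smul, h.mean k hk', mul_one, Complex.ofReal_re]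

/-- Superpositions over the slow manifold solve the ensemble system. -/
theorem IsSlowManifold.superposition_isEnsembleSolution {κ : ZMod p → ℝ} {k₀ : ℝ}
    {w : ℝ → ZMod p → ℂ} {lam : ℝ → ℝ} (h : IsSlowManifold κ k₀ w lam) {d kc : ℝ} {Y : ℝ → ℂ}
    (hkc : 0 < kc) (hkc' : kc < k₀) (hY : Continuous Y) :
    IsEnsembleSolution .wrapped κ d fun t i l =>
      ∫ k in (-kc)..kc, Complex.exp (Complex.I * k * i)
        * (Y k * (Real.exp (lam k * t / d ^ 2) : ℂ) * w k l) := by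
  have hsub : uIcc (-kc) kc ⊆ Ioo (-k₀) k₀ := by
    rw [uIcc_of_le (by linarith)]
    exact fun k hk => ⟨by linarith [hk.1], by linarith [hk.2]⟩
  have hlam : ContinuousOn lam (uIcc (-kc) kc) := h.continuousOn_lam.mono hsub
  have hw : ∀ l, ContinuousOn (fun k => w k l) (uIcc (-kc) kc) := fun l =>
    (continuous_apply l).comp_continuousOn (h.analytic.continuousOn.mono hsub)
  have hYc : ContinuousOn Y (uIcc (-kc) kc) := hY.continuousOn
  intro t _ i l
  have hz : ContinuousOn (fun k => ((lam k / d ^ 2 : ℝ) : ℂ)) (uIcc (-kc) kc) :=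
    Complex.continuous_ofReal.comp_continuousOn (hlam.div_const _)
  have hg : ContinuousOn (fun k : ℝ => Complex.exp (Complex.I * k * i) * (Y k * w k l))
      (uIcc (-kc) kc) :=
    (Continuous.continuousOn (by fun_prop)).mul (hYc.mul (hw l))
  have hd := (hasDerivAt_integral_cexp hz hg t).hasDerivWithinAt (s := Ici 0)
  have hint : ∀ (i : ℤ) (l : ZMod p), IntervalIntegrable (fun k : ℝ =>
      Complex.exp (Complex.I * k * i) * (Y k * (Real.exp (lam k * t / d ^ 2) : ℂ) * w k l))
      volume (-kc) kc := fun i l => by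
    refine ContinuousOn.intervalIntegrable ?_
    refine (Continuous.continuousOn (by fun_prop)).mul ((hYc.mul ?_).mul (hw l))
    exact Complex.continuous_ofReal.comp_continuousOn (Real.continuous_exp.comp_continuousOn
      ((hlam.mul continuousOn_const).div_const _))
  have hint' : ∀ (c : ℝ) (i j : ℤ) (l m : ZMod p), IntervalIntegrable (fun k : ℝ => c •
      (Complex.exp (Complex.I * k * i) * (Y k * (Real.exp (lam k * t / d ^ 2) : ℂ) * w k l)
      - Complex.exp (Complex.I * k * j) * (Y k * (Real.exp (lam k * t / d ^ 2) : ℂ) * w k m)))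
      volume (-kc) kc := fun c i j l m => ((hint i l).sub (hint j m)).smul c
  refine (hd.congr_of_mem (fun s _ => ?_) (mem_Ici.2 ‹0 ≤ t›)).congr_deriv ?_
  · refine intervalIntegral.integral_congr fun k _ => ?_
    have : lam k * s / d ^ 2 = lam k / d ^ 2 * s := by ring
    simp only [this, Complex.ofReal_exp, Complex.ofReal_mul]; ring
  · simp only [ensembleRate]
    rw [← intervalIntegral.integral_sub (hint _ _) (hint _ _),
      ← intervalIntegral.integral_sub (hint _ _) (hint _ _), ← intervalIntegral.integral_smul,
      ← intervalIntegral.integral_smul,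
      ← intervalIntegral.integral_add (hint' _ _ _ _ _) (hint' _ _ _ _ _),
      ← intervalIntegral.integral_smul]
    refine intervalIntegral.integral_congr fun k hk => ?_
    have hinv := h.invariant k (abs_lt.2 (hsub hk)) l
    have h1 : lam k * t / d ^ 2 = lam k / d ^ 2 * t := by ring
    have e1 : Complex.exp (Complex.I * k * ((i + 1 : ℤ) : ℂ))
        = Complex.exp (Complex.I * k * i) * Complex.exp (Complex.I * k) := by
      rw [← Complex.exp_add]; push_cast; ring_nf
    have e2 : Complex.exp (Complex.I * k * ((i - 1 : ℤ) : ℂ))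
        = Complex.exp (Complex.I * k * i) * Complex.exp (-(Complex.I * k)) := by
      rw [← Complex.exp_add]; push_cast; ring_nf
    simp only [e1, e2, h1, Complex.ofReal_exp, Complex.ofReal_mul, Complex.real_smul]
    rw [symbol] at hinv
    push_cast
    linear_combination (-Complex.exp (Complex.I * k * i) * Y k * ((d : ℂ) ^ 2)⁻¹
      * Complex.exp ((lam k : ℂ) / d ^ 2 * t)) * hinv

theorem IsSlowManifold.ensembleMean_superposition {κ : ZMod p → ℝ} {k₀ : ℝ}
    {w : ℝ → ZMod p → ℂ} {lam : ℝ → ℝ} (h : IsSlowManifold κ k₀ w lam) {d kc : ℝ} {Y : ℝ → ℂ}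
    (hd : 0 < d) (hkc : 0 < kc) (hkc' : kc < k₀) (hY : Continuous Y) (t : ℝ) (i : ℤ) :
    ensembleMean (fun l => ∫ k in (-kc)..kc, Complex.exp (Complex.I * k * i)
        * (Y k * (Real.exp (lam k * t / d ^ 2) : ℂ) * w k l))
      = ∫ k in (-kc)..kc, Complex.exp (Complex.I * k * (i * d : ℝ) / d)
            * (Y k * (Real.exp (lam k * t / d ^ 2) : ℂ)) := by
  have hsub : uIcc (-kc) kc ⊆ Ioo (-k₀) k₀ := by
    rw [uIcc_of_le (by linarith)]
    exact fun k hk => ⟨by linarith [hk.1], by linarith [hk.2]⟩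
  have hlam : ContinuousOn lam (uIcc (-kc) kc) := h.continuousOn_lam.mono hsub
  have hw : ∀ l, ContinuousOn (fun k => w k l) (uIcc (-kc) kc) := fun l =>
    (continuous_apply l).comp_continuousOn (h.analytic.continuousOn.mono hsub)
  have hint : ∀ l : ZMod p, IntervalIntegrable (fun k : ℝ =>
      Complex.exp (Complex.I * k * i) * (Y k * (Real.exp (lam k * t / d ^ 2) : ℂ) * w k l))
      volume (-kc) kc := fun l => by
    refine ContinuousOn.intervalIntegrable ?_
    refine (Continuous.continuousOn (by fun_prop)).mul ((hY.continuousOn.mul ?_).mul (hw l))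
    exact Complex.continuous_ofReal.comp_continuousOn (Real.continuous_exp.comp_continuousOn
      ((hlam.mul continuousOn_const).div_const _))
  rw [ensembleMean, ← intervalIntegral.integral_finsetSum fun l _ => hint l,
    ← intervalIntegral.integral_smul]
  refine intervalIntegral.integral_congr fun k hk => ?_
  have hm := h.mean k (abs_lt.2 (hsub hk))
  rw [ensembleMean] at hm
  have hd' : (d : ℂ) ≠ 0 := by exact_mod_cast hd.ne'
  have e1 : Complex.I * k * ((i * d : ℝ) : ℂ) / d = Complex.I * k * i := by
    push_cast; field_simp
  simp only [← Finset.mul_sum, e1, Complex.real_smul] at hm ⊢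
  linear_combination (Complex.exp (Complex.I * k * i) * (Y k * (Real.exp (lam k * t / d ^ 2) : ℂ)))
    * hm

/-- The mean fields of superpositions over the slow manifold solve the homogenised equation: its
right-hand side applied to a Fourier mode is the slow expansion of the eigenvalue. -/
theorem IsSlowManifold.superposition_isHomogenisedSolution {κ : ZMod p → ℝ} {k₀ : ℝ}
    {w : ℝ → ZMod p → ℂ} {lam : ℝ → ℝ} {K : ℕ → ℝ} (h : IsSlowManifold κ k₀ w lam)
    (hK : HasSlowExpansion k₀ lam K) {d kc : ℝ} {Y : ℝ → ℂ}
    (hd : 0 < d) (hkc : 0 < kc) (hkc' : kc < k₀) (hY : Continuous Y) :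
    IsHomogenisedSolution K d fun t x =>
      ∫ k in (-kc)..kc, Complex.exp (Complex.I * k * (x : ℝ) / d)
            * (Y k * (Real.exp (lam k * t / d ^ 2) : ℂ)) := by
  have hd' : (d : ℂ) ≠ 0 := by exact_mod_cast hd.ne'
  have hIcc : uIcc (-kc) kc = Icc (-kc) kc := uIcc_of_le (by linarith)
  have hsub : uIcc (-kc) kc ⊆ Ioo (-k₀) k₀ := by
    rw [hIcc]
    exact fun k hk => ⟨by linarith [hk.1], by linarith [hk.2]⟩
  have hlam : ContinuousOn lam (uIcc (-kc) kc) := h.continuousOn_lam.mono hsub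
  intro t ht
  set z : ℝ → ℂ := fun k => Complex.I * k / d with hz
  have hzc : ContinuousOn z (uIcc (-kc) kc) := Continuous.continuousOn (by fun_prop)
  set g : ℝ → ℂ := fun k => Y k * (Real.exp (lam k * t / d ^ 2) : ℂ) with hg
  have hgc : ContinuousOn g (uIcc (-kc) kc) := hY.continuousOn.mul
    (Complex.continuous_ofReal.comp_continuousOn (Real.continuous_exp.comp_continuousOn
      ((hlam.mul continuousOn_const).div_const _)))
  have hVeq : (fun x : ℝ => ∫ k in (-kc)..kc, Complex.exp (Complex.I * k * x / d) * g k)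
      = fun x : ℝ => ∫ k in (-kc)..kc, Complex.exp (z k * x) * g k := by
    funext x
    refine intervalIntegral.integral_congr fun k _ => ?_
    have : Complex.I * k * x / d = z k * x := by simp only [hz]; ring
    simp only [this]
  change ContDiff ℝ ∞ (fun x : ℝ => ∫ k in (-kc)..kc,
    Complex.exp (Complex.I * k * x / d) * g k) ∧ ∀ x, ∃ F, HasSum (fun m : ℕ =>
      (K m * d ^ (2 * m)) • iteratedDeriv (2 * m + 2) (fun x : ℝ => ∫ k in (-kc)..kc,
        Complex.exp (Complex.I * k * x / d) * g k) x) F ∧ _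
  refine ⟨?_, fun x => ⟨∫ k in (-kc)..kc, ((lam k / d ^ 2 : ℝ) : ℂ)
    * (Complex.exp (z k * x) * g k), ?_, ?_⟩⟩
  · rw [hVeq]; exact contDiff_integral_cexp hzc hgc
  · rw [hVeq]
    simp only [iteratedDeriv_integral_cexp hzc hgc]
    obtain ⟨B, hB⟩ := (isCompact_uIcc (a := -kc) (b := kc)).exists_bound_of_continuousOn
      (((hzc.mul (continuousOn_const (c := (x : ℂ)))).cexp).mul hgc)
    have hB0 : 0 ≤ B := (norm_nonneg _).trans (hB (-kc) left_mem_uIcc)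
    have hsum : Summable fun m : ℕ => |K m| * kc ^ (2 * m + 2) := by
      have := (hK kc (by rwa [abs_of_pos hkc])).summable.norm
      refine this.congr fun m => ?_
      rw [norm_mul, norm_mul, norm_pow, norm_pow, norm_neg, norm_one, one_pow, one_mul,
        Real.norm_eq_abs, Real.norm_of_nonneg hkc.le]
    have key := intervalIntegral.hasSum_integral_of_dominated_convergence
      (μ := volume) (a := -kc) (b := kc)
      (F := fun (m : ℕ) (k : ℝ) => (((-1) ^ (m + 1) * K m * k ^ (2 * m + 2) / d ^ 2 : ℝ) : ℂ)
        * (Complex.exp (z k * x) * g k))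
      (f := fun k => ((lam k / d ^ 2 : ℝ) : ℂ) * (Complex.exp (z k * x) * g k))
      (fun m _ => |K m| * kc ^ (2 * m + 2) * (B / d ^ 2)) (fun m => ?_) (fun m => ?_) ?_ ?_ ?_
    · refine key.congr_fun fun m => ?_
      rw [← intervalIntegral.integral_smul]
      refine intervalIntegral.integral_congr fun k _ => ?_
      have h1 : z k ^ (2 * m + 2) = (-1) ^ (m + 1) * k ^ (2 * m + 2) / (d : ℂ) ^ (2 * m + 2) := by
        simp only [hz]
        rw [div_pow, mul_pow, show 2 * m + 2 = 2 * (m + 1) by ring, pow_mul Complex.I, Complex.I_sq]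
      simp only [h1, Complex.real_smul]
      push_cast
      rw [pow_add (d : ℂ) (2 * m) 2]
      field_simp
    · refine ContinuousOn.aestronglyMeasurable (s := Ι (-kc) kc) ?_ measurableSet_uIoc
      refine ContinuousOn.mono ?_ uIoc_subset_uIcc
      refine ContinuousOn.mul (Continuous.continuousOn (by fun_prop)) ?_
      exact ((hzc.mul (continuousOn_const (c := (x : ℂ)))).cexp).mul hgc
    · refine Eventually.of_forall fun k hk => ?_
      have hk1 := uIoc_subset_uIcc hk
      have hk2 : |k| ≤ kc := by rw [hIcc] at hk1; exact abs_le.2 hk1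
      rw [norm_mul, Complex.norm_real, norm_div, norm_mul, norm_mul, norm_pow, norm_pow, norm_pow,
        norm_neg, norm_one, one_pow, one_mul, Real.norm_eq_abs, Real.norm_eq_abs, Real.norm_eq_abs,
        abs_of_pos hd]
      calc |K m| * |k| ^ (2 * m + 2) / d ^ 2 * ‖Complex.exp (z k * x) * g k‖
          ≤ |K m| * kc ^ (2 * m + 2) / d ^ 2 * B := by
            gcongr
            exact hB k hk1
        _ = _ := by ring
    · exact Eventually.of_forall fun k _ => hsum.mul_right _
    · exact intervalIntegrable_const
    · refine Eventually.of_forall fun k hk => ?_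
      have h1 := hK k (abs_lt.2 (hsub (uIoc_subset_uIcc hk)))
      have h2 := (Complex.hasSum_ofReal.2 (h1.div_const (d ^ 2))).mul_right
        (Complex.exp (z k * x) * g k)
      exact h2
  · have hz' : ContinuousOn (fun k => ((lam k / d ^ 2 : ℝ) : ℂ)) (uIcc (-kc) kc) :=
      Complex.continuous_ofReal.comp_continuousOn (hlam.div_const _)
    have hg' : ContinuousOn (fun k : ℝ => Complex.exp (z k * x) * Y k) (uIcc (-kc) kc) :=
      ((hzc.mul (continuousOn_const (c := (x : ℂ)))).cexp).mul hY.continuousOn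
    have hder := (hasDerivAt_integral_cexp hz' hg' t).hasDerivWithinAt (s := Ici 0)
    refine (hder.congr_of_mem (fun s _ => ?_) (mem_Ici.2 ht)).congr_deriv ?_
    · refine intervalIntegral.integral_congr fun k _ => ?_
      have h1 : lam k * s / d ^ 2 = lam k / d ^ 2 * s := by ring
      have h2 : Complex.I * k * x / d = z k * x := by simp only [hz]; ring
      simp only [h1, h2, Complex.ofReal_exp, Complex.ofReal_mul]; ring
    · refine intervalIntegral.integral_congr fun k _ => ?_
      have h1 : lam k * t / d ^ 2 = lam k / d ^ 2 * t := by ring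
      simp only [hg, h1, Complex.ofReal_exp, Complex.ofReal_mul]; ring

end Superposition

/-! ### Fourier modes of band-limited solutions of the homogenised equation -/

section Modes

theorem sum_exp_two_pi_int (N : ℕ) (hN : 1 ≤ N) (a : ℤ) :
    ∑ J ∈ Finset.Icc (1 : ℤ) N, Complex.exp (2 * Real.pi * Complex.I * a * J / N)
      = if (N : ℤ) ∣ a then (N : ℂ) else 0 := by
  have hN0 : (N : ℂ) ≠ 0 := by exact_mod_cast (by omega : N ≠ 0)
  set ζ : ℂ := Complex.exp (2 * Real.pi * Complex.I * a / N) with hζ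
  have hreindex : ∑ J ∈ Finset.Icc (1 : ℤ) N, Complex.exp (2 * Real.pi * Complex.I * a * J / N)
      = ∑ m ∈ Finset.range N, ζ * ζ ^ m := by
    symm
    refine Finset.sum_bij (fun m _ => (m : ℤ) + 1) (fun m hm => ?_) (fun m _ m' _ h => by omega)
      (fun J hJ => ?_) (fun m _ => ?_)
    · rw [Finset.mem_range] at hm; rw [Finset.mem_Icc]; omega
    · rw [Finset.mem_Icc] at hJ
      exact ⟨(J - 1).toNat, by rw [Finset.mem_range]; omega, by omega⟩
    · rw [← pow_succ', hζ, ← Complex.exp_nat_mul]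
      congr 1; push_cast; ring
  have hpi : (2 * Real.pi * Complex.I : ℂ) ≠ 0 := Complex.two_pi_I_ne_zero
  have hone : ζ = 1 ↔ (N : ℤ) ∣ a := by
    rw [hζ, Complex.exp_eq_one_iff]
    constructor
    · rintro ⟨m, hm⟩
      refine ⟨m, ?_⟩
      field_simp at hm
      have : (a : ℂ) = ((N * m : ℤ) : ℂ) := by push_cast; linear_combination hm
      exact_mod_cast this
    · rintro ⟨m, rfl⟩
      exact ⟨m, by push_cast; field_simp⟩
  rw [hreindex, ← Finset.mul_sum]
  split_ifs with h
  · rw [hone.2 h]; simp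
  · have h1 : ζ ≠ 1 := fun h' => h (hone.1 h')
    have hpow : ζ ^ N = 1 := by
      rw [hζ, ← Complex.exp_nat_mul, Complex.exp_eq_one_iff]
      exact ⟨a, by field_simp⟩
    rw [geom_sum_eq h1, hpow, sub_self, zero_div, mul_zero]

/-- The discrete Fourier transform recovers the coefficients of a trigonometric sum, provided that
no two wavenumbers involved are aliased. -/
theorem dft_trigonometric_sum {N : ℕ} (hN : 1 ≤ N) {B : Finset ℤ} (g : ℤ → ℂ) {s : ℤ}
    (hs : ∀ j ∈ B, (N : ℤ) ∣ j - s → j = s) :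
    (N : ℂ)⁻¹ * ∑ J ∈ Finset.Icc (1 : ℤ) N,
      (∑ j ∈ B, g j * Complex.exp (2 * Real.pi * Complex.I * j * J / N))
        * Complex.exp (-(2 * Real.pi * Complex.I * s * J / N)) = if s ∈ B then g s else 0 := by
  have hN0 : (N : ℂ) ≠ 0 := by exact_mod_cast (by omega : N ≠ 0)
  have h1 : ∀ J : ℤ, (∑ j ∈ B, g j * Complex.exp (2 * Real.pi * Complex.I * j * J / N))
        * Complex.exp (-(2 * Real.pi * Complex.I * s * J / N))
      = ∑ j ∈ B, g j * Complex.exp (2 * Real.pi * Complex.I * ((j - s : ℤ) : ℂ) * J / N) :=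
    fun J => by
      rw [Finset.sum_mul]
      refine Finset.sum_congr rfl fun j _ => ?_
      rw [mul_assoc, ← Complex.exp_add]
      congr 2; push_cast; ring
  simp only [h1]
  rw [Finset.sum_comm]
  simp only [← Finset.mul_sum, sum_exp_two_pi_int N hN]
  have h2 : ∀ j ∈ B, g j * (if (N : ℤ) ∣ j - s then (N : ℂ) else 0)
      = if s = j then g s * N else 0 := fun j hj => by
    by_cases hjs : s = j
    · subst hjs; simp
    · rw [if_neg hjs, if_neg fun hd => hjs (hs j hj hd).symm, mul_zero]
  rw [Finset.sum_congr rfl h2, Finset.sum_ite_eq]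
  split_ifs <;> field_simp
  simp

theorem iteratedDeriv_trigonometric_sum {L : ℝ} {B : Finset ℤ} {f : ℝ → ℝ} {c : ℤ → ℂ}
    (hf : ∀ x : ℝ, (f x : ℂ) = ∑ j ∈ B, c j * Complex.exp (2 * Real.pi * Complex.I * j * x / L))
    (n : ℕ) (x : ℝ) : ((iteratedDeriv n f x : ℝ) : ℂ)
      = ∑ j ∈ B, (2 * Real.pi * Complex.I * j / L) ^ n
          * (c j * Complex.exp (2 * Real.pi * Complex.I * j * x / L)) := by
  induction n generalizing x with
  | zero => simpa using hf x
  | succ n ih =>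
    have h1 : HasDerivAt (fun x : ℝ => ∑ j ∈ B, (2 * Real.pi * Complex.I * j / L) ^ n
          * (c j * Complex.exp (2 * Real.pi * Complex.I * j * x / L)))
        (∑ j ∈ B, (2 * Real.pi * Complex.I * j / L) ^ (n + 1)
          * (c j * Complex.exp (2 * Real.pi * Complex.I * j * x / L))) x := by
      refine HasDerivAt.fun_sum fun j _ => ?_
      have h2 : HasDerivAt (fun x : ℝ => 2 * Real.pi * Complex.I * j * (x : ℂ) / L)
          (2 * Real.pi * Complex.I * j / L) x := by
        simpa using ((Complex.ofRealCLM.hasDerivAt (x := x)).const_mul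
          (2 * Real.pi * Complex.I * j : ℂ)).div_const (L : ℂ)
      refine ((h2.cexp.const_mul (c j)).const_mul _).congr_deriv ?_
      ring
    simp only [← ih] at h1
    have key : ∀ S : ℂ, HasDerivAt (fun x => ((iteratedDeriv n f x : ℝ) : ℂ)) S x →
        ((iteratedDeriv (n + 1) f x : ℝ) : ℂ) = S := fun S hS => by
      have h3 : HasDerivAt (iteratedDeriv n f) S.re x := by
        simpa [Function.comp_def] using Complex.reCLM.hasFDerivAt.comp_hasDerivAt x hS
      rw [iteratedDeriv_succ, h3.deriv]
      exact h3.ofReal_comp.unique hS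
    exact key _ h1

/-- A band-limited solution of the homogenised equation is a superposition of exponentially
evolving Fourier modes. -/
theorem exists_modes {k₀ : ℝ} {lam : ℝ → ℝ} {K : ℕ → ℝ} (hK : HasSlowExpansion k₀ lam K)
    {L d : ℝ} (hL : 0 < L) (hd : 0 < d) {B : Finset ℤ} {V : ℝ → ℝ → ℝ}
    (hB : ∀ j ∈ B, |2 * Real.pi * j / L * d| < k₀) (hV : IsHomogenisedSolution K d V)
    (hVB : ∀ t, 0 ≤ t → IsBandLimited L B (V t)) :
    ∃ c : ℤ → ℂ, (∀ j, j ∉ B → c j = 0) ∧ (∀ j, conj (c j) = c (-j)) ∧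
      (∀ t, 0 ≤ t → ∀ x, (V t x : ℂ) = ∑ j ∈ B, c j
        * Complex.exp ((lam (2 * Real.pi * j / L * d) / d ^ 2 : ℝ) * t)
        * Complex.exp (2 * Real.pi * Complex.I * j * x / L)) ∧
      ∀ M, (∀ x, |V 0 x| ≤ M) → ∀ j, ‖c j‖ ≤ M := by
  have hLc : (L : ℂ) ≠ 0 := by exact_mod_cast hL.ne'
  have hdc : (d : ℂ) ≠ 0 := by exact_mod_cast hd.ne'
  set J : ℕ := ∑ j ∈ B, j.natAbs with hJ
  have hBJ : ∀ j ∈ B, j.natAbs ≤ J := fun j hj =>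
    Finset.single_le_sum (f := fun j : ℤ => j.natAbs) (fun _ _ => Nat.zero_le _) hj
  -- With `2 J + 1` sampling points the wavenumbers in `[-J, J]` are not aliased.
  set D : ℕ := 2 * J + 1 with hD
  have hD1 : 1 ≤ D := by omega
  have hDc : (D : ℂ) ≠ 0 := by exact_mod_cast (by omega : D ≠ 0)
  have halias : ∀ s : ℤ, s.natAbs ≤ J → ∀ j ∈ B, (D : ℤ) ∣ j - s → j = s := fun s hs j hj hdvd => by
    have h1 := hBJ j hj
    have h2 : j - s = 0 := by
      refine Int.eq_zero_of_abs_lt_dvd hdvd ?_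
      rw [abs_lt]; omega
    omega
  let coeff : (ℝ → ℝ) → ℤ → ℂ := fun f j => if j.natAbs ≤ J then
    (D : ℂ)⁻¹ * ∑ m ∈ Finset.Icc (1 : ℤ) D, (f (m * L / D) : ℂ)
      * Complex.exp (-(2 * Real.pi * Complex.I * j * m / D)) else 0
  have hcoeff : ∀ (f : ℝ → ℝ) (g : ℤ → ℂ), (∀ x : ℝ, (f x : ℂ) = ∑ j ∈ B, g j
      * Complex.exp (2 * Real.pi * Complex.I * j * x / L)) →
      ∀ j, coeff f j = if j ∈ B then g j else 0 := by
    intro f g hf j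
    by_cases hj : j.natAbs ≤ J
    · simp only [coeff, if_pos hj]
      rw [← dft_trigonometric_sum hD1 g (halias j hj)]
      congr 1
      refine Finset.sum_congr rfl fun m _ => ?_
      rw [hf]
      congr 1
      refine Finset.sum_congr rfl fun i _ => ?_
      congr 2
      push_cast
      field_simp
    · simp only [coeff, if_neg hj]
      rw [if_neg fun h => hj (hBJ j h)]
  have hexpand : ∀ t, 0 ≤ t → ∀ x : ℝ, (V t x : ℂ) = ∑ j ∈ B, coeff (V t) j
      * Complex.exp (2 * Real.pi * Complex.I * j * x / L) := by
    intro t ht x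
    obtain ⟨g, hg⟩ := hVB t ht
    rw [hg x]
    exact Finset.sum_congr rfl fun j hj => by rw [hcoeff _ g hg j, if_pos hj]
  have hzero : ∀ t, 0 ≤ t → ∀ j ∉ B, coeff (V t) j = 0 := by
    intro t ht j hj
    obtain ⟨g, hg⟩ := hVB t ht
    rw [hcoeff _ g hg j, if_neg hj]
  -- The homogenised equation, mode by mode.
  have hmode : ∀ j ∈ B, ∀ t, 0 ≤ t → HasDerivWithinAt (fun s => coeff (V s) j)
      (((lam (2 * Real.pi * j / L * d) / d ^ 2 : ℝ) : ℂ) * coeff (V t) j) (Ici 0) t := by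
    intro j hj t ht
    choose F hFsum hFder using (hV t ht).2
    have hF : ∀ x : ℝ, (F x : ℂ) = ∑ j ∈ B,
        (((lam (2 * Real.pi * j / L * d) / d ^ 2 : ℝ) : ℂ) * coeff (V t) j)
          * Complex.exp (2 * Real.pi * Complex.I * j * x / L) := by
      intro x
      have h1 := Complex.hasSum_ofReal.2 (hFsum x)
      refine h1.unique ?_
      have h2 : ∀ i ∈ B, HasSum (fun m : ℕ =>
          (((-1) ^ (m + 1) * K m * (2 * Real.pi * i / L * d) ^ (2 * m + 2) / d ^ 2 : ℝ) : ℂ)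
            * (coeff (V t) i * Complex.exp (2 * Real.pi * Complex.I * i * x / L)))
          (((lam (2 * Real.pi * i / L * d) / d ^ 2 : ℝ) : ℂ)
            * (coeff (V t) i * Complex.exp (2 * Real.pi * Complex.I * i * x / L))) := fun i hi =>
        (Complex.hasSum_ofReal.2 ((hK _ (hB i hi)).div_const (d ^ 2))).mul_right _
      have h3 := hasSum_sum h2
      simp only [← mul_assoc] at h3 ⊢
      refine h3.congr_fun fun m => ?_
      rw [smul_eq_mul, Complex.ofReal_mul, iteratedDeriv_trigonometric_sum (hexpand t ht),
        Finset.mul_sum]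
      refine Finset.sum_congr rfl fun i _ => ?_
      have h4 : (2 * Real.pi * Complex.I * i / L : ℂ) ^ (2 * m + 2)
          = (-1) ^ (m + 1) * (2 * Real.pi * i / L) ^ (2 * m + 2) := by
        rw [show (2 * Real.pi * Complex.I * i / L : ℂ) = Complex.I * (2 * Real.pi * i / L) by ring,
          mul_pow, show 2 * m + 2 = 2 * (m + 1) by ring, pow_mul Complex.I, Complex.I_sq]
      rw [h4]
      push_cast
      rw [mul_pow _ (d : ℂ), pow_add (d : ℂ) (2 * m) 2]
      field_simp
    have h5 := hcoeff F _ hF j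
    rw [if_pos hj] at h5
    rw [← h5]
    simp only [coeff, if_pos (hBJ j hj)]
    refine HasDerivWithinAt.const_mul _ (HasDerivWithinAt.fun_sum fun m _ => ?_)
    exact (hFder _).ofReal_comp.mul_const _
  refine ⟨coeff (V 0), hzero 0 le_rfl, fun j => ?_, fun t ht x => ?_, fun M hM j => ?_⟩
  · simp only [coeff, Int.natAbs_neg]
    split_ifs
    · simp only [map_mul, map_inv₀, map_sum, Complex.conj_natCast, Complex.conj_ofReal]
      congr 1
      refine Finset.sum_congr rfl fun m _ => ?_
      rw [← Complex.exp_conj]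
      congr 2
      simp [map_ofNat]
    · simp
  · rw [hexpand t ht x]
    refine Finset.sum_congr rfl fun j hj => ?_
    rw [eq_mul_exp_of_hasDerivWithinAt (s := fun s => coeff (V s) j) (hmode j hj) ht]
  · have hM0 : 0 ≤ M := (abs_nonneg _).trans (hM 0)
    simp only [coeff]
    split_ifs
    · rw [norm_mul, norm_inv, Complex.norm_natCast]
      have h1 : ‖∑ m ∈ Finset.Icc (1 : ℤ) D, (V 0 (m * L / D) : ℂ)
          * Complex.exp (-(2 * Real.pi * Complex.I * j * m / D))‖ ≤ D * M := by
        refine (norm_sum_le_of_le (Finset.Icc (1 : ℤ) D) (f := fun m : ℤ => (V 0 (m * L / D) : ℂ)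
          * Complex.exp (-(2 * Real.pi * Complex.I * j * m / D))) (n := fun _ => M)
          fun m _ => ?_).trans ?_
        · rw [norm_mul, Complex.norm_real, Real.norm_eq_abs, Complex.norm_exp]
          have : (-(2 * Real.pi * Complex.I * j * m / D : ℂ)).re = 0 := by
            rw [show (-(2 * Real.pi * Complex.I * j * m / D) : ℂ)
              = ((-(2 * Real.pi * j * m / D) : ℝ) : ℂ) * Complex.I by push_cast; ring,
              Complex.re_ofReal_mul, Complex.I_re, mul_zero]
          rw [this, Real.exp_zero, mul_one]
          exact hM _
        · simp
      have hDpos : (0 : ℝ) < D := by exact_mod_cast (by omega : 0 < D)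
      calc (D : ℝ)⁻¹ * _ ≤ (D : ℝ)⁻¹ * (D * M) := by gcongr
        _ = M := by field_simp
    · simpa using hM0

end Modes

/-! ### The patch scheme: rearrangement, superposition of modes, spectral coupling -/

section Patch

variable {p : ℕ}

/-- Rearranging the components turns solutions of the wrapped scheme into solutions of the
stacked scheme. -/
theorem IsPatchSolution.stacked {κ : ZMod p → ℝ} {d : ℝ} {n N : ℕ} {r : ℝ}
    {shift : ℝ → (ℤ → ℂ) → ℤ → ℂ} {v : ℝ → ℤ → ℤ → ZMod p → ℝ}
    (h : IsPatchSolution .wrapped κ d n N r shift v) :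
    IsPatchSolution .stacked κ d n N r shift fun t I i l => v t I i (l + i) where
  interior t ht I i h1 hn l := by
    refine (h.interior t ht I i h1 hn (l + i)).congr_deriv ?_
    simp only [ensembleRate, diffusionRate]
    push_cast
    rw [show l + ((i : ZMod p) + 1) = l + i + 1 by ring,
      show l + ((i : ZMod p) - 1) = l + i - 1 by ring, add_comm (i : ZMod p) l]
  rightEdge t ht I l := by
    have := h.rightEdge t ht I (l + (n + 1 : ℤ))
    simp only [memberShift, add_zero] at this ⊢
    rw [this]
    push_cast
    simp only [add_assoc]
  leftEdge t ht I l := by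
    have := h.leftEdge t ht I l
    simp only [memberShift, sub_zero] at this ⊢
    simpa using this
  periodic t ht I i l := h.periodic t ht I i _

/-- Eigenvectors of the symbol give lattice modes that are eigenvectors of the ensemble system. -/
theorem symbol_mode {κ : ZMod p → ℝ} {d k μ : ℝ} {w : ZMod p → ℂ}
    (hw : ∀ l, symbol κ k w l = μ * w l) (b : ℂ) (i : ℤ) (l : ZMod p) :
    ensembleRate .wrapped κ d (fun i l => b * Complex.exp (Complex.I * k * i) * w l) i l
      = ((μ / d ^ 2 : ℝ) : ℂ) * (b * Complex.exp (Complex.I * k * i) * w l) := by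
  have e1 : Complex.exp (Complex.I * k * ((i + 1 : ℤ) : ℂ))
      = Complex.exp (Complex.I * k * i) * Complex.exp (Complex.I * k) := by
    rw [← Complex.exp_add]; push_cast; ring_nf
  have e2 : Complex.exp (Complex.I * k * ((i - 1 : ℤ) : ℂ))
      = Complex.exp (Complex.I * k * i) * Complex.exp (-(Complex.I * k)) := by
    rw [← Complex.exp_add]; push_cast; ring_nf
  have hinv := hw l
  rw [symbol] at hinv
  simp only [ensembleRate, e1, e2, Complex.real_smul]
  push_cast
  linear_combination (b * Complex.exp (Complex.I * k * i) * ((d : ℂ) ^ 2)⁻¹) * hinv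

/-- A superposition of lattice fields with macroscale wavenumbers `2 π j / L` over the patches. -/
noncomputable def modeSum (N : ℕ) (B : Finset ℤ) (b : ℤ → ℂ) (φ : ℤ → ℤ → ZMod p → ℂ)
    (I i : ℤ) (l : ZMod p) : ℂ :=
  ∑ j ∈ B, b j * φ j i l * Complex.exp (2 * Real.pi * Complex.I * j * I / N)

theorem ensembleRate_re_modeSum (κ : ZMod p → ℝ) (d : ℝ) (N : ℕ) (B : Finset ℤ) (b : ℤ → ℂ)
    (φ : ℤ → ℤ → ZMod p → ℂ) (I i : ℤ) (l : ZMod p) :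
    ensembleRate .wrapped κ d (fun i l => (modeSum N B b φ I i l).re) i l
      = (modeSum N B b (fun j => ensembleRate .wrapped κ d (φ j)) I i l).re := by
  have h : modeSum N B b (fun j => ensembleRate .wrapped κ d (φ j)) I i l
      = ensembleRate .wrapped κ d (modeSum N B b φ I) i l := by
    simp only [modeSum, ensembleRate, Complex.real_smul, ← Finset.sum_sub_distrib, Finset.mul_sum,
      ← Finset.sum_add_distrib]
    exact Finset.sum_congr rfl fun j _ => by ring
  rw [h]
  simp only [ensembleRate, Complex.smul_re, Complex.add_re, Complex.sub_re]

theorem hasDerivAt_re_modeSum {N : ℕ} {B : Finset ℤ} {b : ℤ → ℂ}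
    {φ : ℤ → ℝ → ℤ → ZMod p → ℂ} {φ' : ℤ → ℤ → ZMod p → ℂ} {t : ℝ} {i : ℤ} {l : ZMod p}
    (h : ∀ j ∈ B, HasDerivAt (fun s => φ j s i l) (φ' j i l) t) (I : ℤ) :
    HasDerivAt (fun s => (modeSum N B b (fun j => φ j s) I i l).re)
      (modeSum N B b φ' I i l).re t := by
  have h1 : HasDerivAt (fun s => modeSum N B b (fun j => φ j s) I i l)
      (modeSum N B b φ' I i l) t :=
    HasDerivAt.fun_sum fun j hj => ((h j hj).const_mul (b j)).mul_const _
  simpa [Function.comp_def] using Complex.reCLM.hasFDerivAt.comp_hasDerivAt t h1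

theorem modeSum_periodic {N : ℕ} (hN : 1 ≤ N) (B : Finset ℤ) (b : ℤ → ℂ)
    (φ : ℤ → ℤ → ZMod p → ℂ) (I i : ℤ) (l : ZMod p) :
    modeSum N B b φ (I + N) i l = modeSum N B b φ I i l := by
  have hN0 : (N : ℂ) ≠ 0 := by exact_mod_cast (by omega : N ≠ 0)
  refine Finset.sum_congr rfl fun j _ => ?_
  congr 1
  have : (2 * Real.pi * Complex.I * j * ((I + N : ℤ) : ℂ) / N : ℂ)
      = 2 * Real.pi * Complex.I * j * I / N + j * (2 * Real.pi * Complex.I) := by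
    push_cast; field_simp
  rw [this, Complex.exp_add, Complex.exp_int_mul_two_pi_mul_I, mul_one]

variable [NeZero p]

theorem ensembleMean_re (y : ZMod p → ℂ) :
    ensembleMean (fun l => (y l).re) = (ensembleMean y).re := by
  simp [ensembleMean]

theorem ensembleMean_modeSum (N : ℕ) (B : Finset ℤ) (b : ℤ → ℂ)
    (φ : ℤ → ℤ → ZMod p → ℂ) (I i : ℤ) : ensembleMean (modeSum N B b φ I i)
      = ∑ j ∈ B, b j * ensembleMean (φ j i)
          * Complex.exp (2 * Real.pi * Complex.I * j * I / N) := by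
  simp only [ensembleMean, modeSum, Complex.real_smul]
  rw [Finset.sum_comm, Finset.mul_sum]
  refine Finset.sum_congr rfl fun j _ => ?_
  rw [← Finset.sum_mul, ← Finset.mul_sum]
  ring

theorem ensembleMean_add_right {E : Type*} [NormedAddCommGroup E] [NormedSpace ℝ E]
    (y : ZMod p → E) (m : ZMod p) : ensembleMean (fun l => y (l + m)) = ensembleMean y := by
  exact congrArg ((p : ℝ)⁻¹ • ·) (Equiv.sum_comp (Equiv.addRight m) y)

/-- Spectral interpolation is exact for trigonometric sums over the retained wavenumbers. -/
theorem spectralShift_trigonometric_sum {N : ℕ} (hN : 1 ≤ N) {S B : Finset ℤ}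
    (hS : ∀ j : ℤ, ∃! k : ℤ, k ∈ S ∧ k ≡ j [ZMOD N]) (hBS : B ⊆ S) (g : ℤ → ℂ) (ρ : ℝ) (I : ℤ) :
    spectralShift N S ρ (fun J => ∑ j ∈ B, g j * Complex.exp (2 * Real.pi * Complex.I * j * J / N)) I
      = ∑ j ∈ B, g j * Complex.exp (2 * Real.pi * Complex.I * j * (I + ρ) / N) := by
  have h1 : ∀ s ∈ S, (N : ℂ)⁻¹ * ∑ J ∈ Finset.Icc (1 : ℤ) N,
      (∑ j ∈ B, g j * Complex.exp (2 * Real.pi * Complex.I * j * J / N))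
        * Complex.exp (-(2 * Real.pi * Complex.I * s * J / N)) = if s ∈ B then g s else 0 :=
    fun s hs => dft_trigonometric_sum hN g fun j hj hdvd =>
      (hS s).unique ⟨hBS hj, (Int.modEq_iff_dvd.2 hdvd).symm⟩ ⟨hs, rfl⟩
  rw [spectralShift, Finset.sum_congr rfl fun s hs => by rw [h1 s hs]]
  simp only [ite_mul, zero_mul]
  rw [Finset.sum_ite_mem, Finset.inter_eq_right.2 hBS]

theorem conj_sum_eq_self {B : Finset ℤ} {T : ℤ → ℂ} (h0 : ∀ j, j ∉ B → T j = 0)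
    (hc : ∀ j, conj (T j) = T (-j)) : conj (∑ j ∈ B, T j) = ∑ j ∈ B, T j := by
  have hsum : ∑' j, T j = ∑ j ∈ B, T j := tsum_eq_sum fun j hj => h0 j hj
  rw [← hsum, Complex.conj_tsum]
  simp only [hc]
  exact (Equiv.neg ℤ).tsum_eq T

theorem exp_patchPoint {L H d x₀ : ℝ} {N : ℕ} (hL : 0 < L) (hN : 1 ≤ N) (hH : H = L / N)
    (j I i : ℤ) :
    Complex.exp (2 * Real.pi * Complex.I * j * (patchPoint x₀ H d I i : ℝ) / L)
      = Complex.exp (2 * Real.pi * Complex.I * j * x₀ / L)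
        * Complex.exp (Complex.I * (2 * Real.pi * j / L * d : ℝ) * i)
        * Complex.exp (2 * Real.pi * Complex.I * j * I / N) := by
  have hLc : (L : ℂ) ≠ 0 := by exact_mod_cast hL.ne'
  have hN0 : (N : ℂ) ≠ 0 := by exact_mod_cast (by omega : N ≠ 0)
  rw [← Complex.exp_add, ← Complex.exp_add, hH, patchPoint]
  congr 1
  push_cast
  field_simp
  ring

/-- With spectral coupling, band-limited solutions of the homogenised equation lift exactly to the
patch scheme: lift every Fourier mode to the slow manifold. -/
theorem exists_spectral_patchSolution {κ : ZMod p → ℝ} {k₀ : ℝ} {w : ℝ → ZMod p → ℂ}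
    {lam : ℝ → ℝ} {K : ℕ → ℝ} (h : IsSlowManifold κ k₀ w lam) (hK : HasSlowExpansion k₀ lam K)
    (hconj : ∀ k, |k| < k₀ → ∀ l, conj (w k l) = w (-k) l)
    {n N : ℕ} {r L H d x₀ : ℝ} (hn : 1 ≤ n) (hr : 0 < r) (hL : 0 < L) (hN : 1 ≤ N)
    {S B : Finset ℤ} {V : ℝ → ℝ → ℝ}
    (hS : ∀ j : ℤ, ∃! k : ℤ, k ∈ S ∧ k ≡ j [ZMOD N]) (hBS : B ⊆ S)
    (hH : H = L / N) (hd : d = r * H / n) (hB : ∀ j ∈ B, |2 * Real.pi * j / L * d| < k₀)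
    (hV : IsHomogenisedSolution K d V) (hVB : ∀ t, 0 ≤ t → IsBandLimited L B (V t)) :
    ∃ v : ℝ → ℤ → ℤ → ZMod p → ℝ,
      IsPatchSolution .wrapped κ d n N r (spectralShift N S) v ∧
      ∀ t, 0 ≤ t → ∀ I i : ℤ, ensembleMean (v t I i) = V t (patchPoint x₀ H d I i) := by
  have hNpos : (0 : ℝ) < N := by exact_mod_cast hN
  have hnpos : (0 : ℝ) < n := by exact_mod_cast hn
  have hdpos : 0 < d := by rw [hd, hH]; positivity
  have hLc : (L : ℂ) ≠ 0 := by exact_mod_cast hL.ne'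
  have hnc : (n : ℂ) ≠ 0 := by exact_mod_cast hnpos.ne'
  have hNc : (N : ℂ) ≠ 0 := by exact_mod_cast hNpos.ne'
  obtain ⟨c, hc0, hcc, hcV, -⟩ := exists_modes hK hL hdpos hB hV hVB
  set q : ℤ → ℝ := fun j => 2 * Real.pi * j / L * d with hq
  set b : ℤ → ℂ := fun j => c j * Complex.exp (2 * Real.pi * Complex.I * j * x₀ / L) with hb
  set φ : ℤ → ℝ → ℤ → ZMod p → ℂ := fun j t i l =>
    Complex.exp ((lam (q j) / d ^ 2 : ℝ) * t) * Complex.exp (Complex.I * q j * i) * w (q j) l with hφ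
  have hqneg : ∀ j, q (-j) = -q j := fun j => by simp only [hq]; push_cast; ring
  -- The superposition is real, since its modes occur in complex conjugate pairs.
  have hreal : ∀ t I i l, (((modeSum N B b (fun j => φ j t) I i l).re : ℝ) : ℂ)
      = modeSum N B b (fun j => φ j t) I i l := by
    intro t I i l
    refine Complex.conj_eq_iff_re.1 (conj_sum_eq_self (fun j hj => ?_) fun j => ?_)
    · simp [hb, hc0 j hj]
    · by_cases hj : j ∈ B
      · have e1 : lam (-q j) = lam (q j) := hK.lam_neg (hB j hj)
        have e2 : conj (Complex.exp (2 * Real.pi * Complex.I * j * x₀ / L))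
            = Complex.exp (2 * Real.pi * Complex.I * (-j : ℤ) * x₀ / L) := by
          rw [← Complex.exp_conj]; congr 1; simp [map_ofNat]
        have e3 : conj (Complex.exp ((lam (q j) / d ^ 2 : ℝ) * (t : ℂ)))
            = Complex.exp ((lam (q j) / d ^ 2 : ℝ) * (t : ℂ)) := by
          rw [← Complex.exp_conj, map_mul, Complex.conj_ofReal, Complex.conj_ofReal]
        have e4 : conj (Complex.exp (Complex.I * q j * i))
            = Complex.exp (Complex.I * (-q j : ℝ) * i) := by
          rw [← Complex.exp_conj]; congr 1; simp
        have e5 : conj (Complex.exp (2 * Real.pi * Complex.I * j * I / N))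
            = Complex.exp (2 * Real.pi * Complex.I * (-j : ℤ) * I / N) := by
          rw [← Complex.exp_conj]; congr 1; simp [map_ofNat]
        simp only [hb, hφ, map_mul, hcc, hqneg, e1]
        rw [e2, e3, e4, e5, hconj _ (hB j hj)]
      · have : c (-j) = 0 := by rw [← hcc, hc0 j hj, map_zero]
        simp [hb, hc0 j hj, this]
  have hshift : ∀ (j : ℤ) (m : ℤ), Complex.exp (Complex.I * q j * ((m + n : ℤ) : ℂ))
      = Complex.exp (Complex.I * q j * m)
        * Complex.exp (2 * Real.pi * Complex.I * j * r / N) := by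
    intro j m
    rw [← Complex.exp_add]
    congr 1
    simp only [hq, hd, hH]
    push_cast
    field_simp
  refine ⟨fun t I i l => (modeSum N B b (fun j => φ j t) I i l).re, ⟨?_, ?_, ?_, ?_⟩, ?_⟩
  · intro t _ I i _ _ l
    rw [ensembleRate_re_modeSum]
    refine (hasDerivAt_re_modeSum (fun j hj => ?_) I).hasDerivWithinAt
    simp only [hφ]
    rw [symbol_mode (h.invariant _ (hB j hj))]
    refine (((hasDerivAt_cexp_mul_ofReal _ t).mul_const _).mul_const _).congr_deriv ?_
    ring
  · intro t _ I l
    simp only [hreal, memberShift, add_zero]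
    rw [show (fun J => modeSum N B b (fun j => φ j t) J 1 l) = fun J : ℤ => ∑ j ∈ B,
      (b j * φ j t 1 l) * Complex.exp (2 * Real.pi * Complex.I * j * J / N) from rfl,
      spectralShift_trigonometric_sum hN hS hBS]
    refine Finset.sum_congr rfl fun j _ => ?_
    have h1 := hshift j 1
    rw [add_comm (1 : ℤ)] at h1
    simp only [hφ]
    rw [h1, mul_add, add_div, Complex.exp_add]
    ring
  · intro t _ I l
    simp only [hreal, memberShift, sub_zero]
    rw [show (fun J => modeSum N B b (fun j => φ j t) J n l) = fun J : ℤ => ∑ j ∈ B,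
      (b j * φ j t n l) * Complex.exp (2 * Real.pi * Complex.I * j * J / N) from rfl,
      spectralShift_trigonometric_sum hN hS hBS]
    refine Finset.sum_congr rfl fun j _ => ?_
    have h1 := hshift j 0
    rw [zero_add] at h1
    simp only [hφ]
    have h2 : Complex.exp (2 * Real.pi * Complex.I * j * r / N)
        * Complex.exp (2 * Real.pi * Complex.I * j * ((-r : ℝ) : ℂ) / N) = 1 := by
      rw [← Complex.exp_add, ← Complex.exp_zero]; congr 1; push_cast; ring
    rw [h1, mul_add, add_div, Complex.exp_add]
    linear_combination (-(b j * (Complex.exp ((lam (q j) / d ^ 2 : ℝ) * t)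
      * Complex.exp (Complex.I * q j * (0 : ℤ)) * w (q j) l)
      * Complex.exp (2 * Real.pi * Complex.I * j * I / N))) * h2
  · intro t _ I i l
    rw [modeSum_periodic hN]
  · intro t ht I i
    rw [ensembleMean_re, ensembleMean_modeSum, ← Complex.ofReal_re (V t _), hcV t ht]
    congr 1
    refine Finset.sum_congr rfl fun j hj => ?_
    have h1 : ensembleMean (φ j t i)
        = Complex.exp ((lam (q j) / d ^ 2 : ℝ) * t) * Complex.exp (Complex.I * q j * i) := by
      rw [show φ j t i = (Complex.exp ((lam (q j) / d ^ 2 : ℝ) * t)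
        * Complex.exp (Complex.I * q j * i)) • w (q j) from rfl, ensembleMean_smul,
        h.mean _ (hB j hj), mul_one]
    rw [h1, exp_patchPoint hL hN hH]
    simp only [hb, hq]
    ring

end Patch

/-! ### The Fourier multiplier of Lagrangian interpolation -/

section Multiplier

/-- The factor by which the Lagrangian shift of order `P` multiplies the field `e^{i θ J}`. -/
noncomputable def lagrangeMultiplier (P : ℕ) (ρ θ : ℝ) : ℂ :=
  1 + ∑ k ∈ Finset.Icc 1 P, (∏ l ∈ Finset.range k, ((ρ : ℂ) ^ 2 - (l : ℂ) ^ 2))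
    * ((2 * k / ρ) * (Complex.I * Real.sin θ * ((2 * Real.cos θ - 2 : ℝ) : ℂ) ^ (k - 1))
      + ((2 * Real.cos θ - 2 : ℝ) : ℂ) ^ k) / (2 * k).factorial

theorem exp_I_mul_succ (θ : ℝ) (J : ℤ) :
    Complex.exp (Complex.I * θ * ((J + 1 : ℤ) : ℂ)) = Complex.exp (Complex.I * θ * J)
      * (Real.cos θ + Real.sin θ * Complex.I) := by
  rw [Complex.ofReal_cos, Complex.ofReal_sin, ← Complex.exp_mul_I, ← Complex.exp_add]
  congr 1; push_cast; ring

theorem exp_I_mul_pred (θ : ℝ) (J : ℤ) :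
    Complex.exp (Complex.I * θ * ((J - 1 : ℤ) : ℂ)) = Complex.exp (Complex.I * θ * J)
      * (Real.cos θ - Real.sin θ * Complex.I) := by
  rw [show (Real.cos θ : ℂ) - Real.sin θ * Complex.I
    = Real.cos (-θ) + Real.sin (-θ) * Complex.I by
      rw [Real.cos_neg, Real.sin_neg]; push_cast; ring, Complex.ofReal_cos, Complex.ofReal_sin,
    ← Complex.exp_mul_I, ← Complex.exp_add]
  congr 1; push_cast; ring

theorem iterate_deltaSq_exp_sum (B : Finset ℤ) (g : ℤ → ℂ) (θ : ℤ → ℝ) (k : ℕ) :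
    deltaSq^[k] (fun J => ∑ j ∈ B, g j * Complex.exp (Complex.I * θ j * J))
      = fun J : ℤ => ∑ j ∈ B, g j * ((2 * Real.cos (θ j) - 2 : ℝ) : ℂ) ^ k
          * Complex.exp (Complex.I * θ j * J) := by
  induction k with
  | zero => simp
  | succ k ih =>
    rw [Function.iterate_succ_apply', ih]
    funext J
    simp only [deltaSq]
    rw [Finset.mul_sum, ← Finset.sum_sub_distrib, ← Finset.sum_add_distrib]
    refine Finset.sum_congr rfl fun j _ => ?_
    rw [exp_I_mul_succ, exp_I_mul_pred]
    push_cast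
    ring

theorem lagrangeShift_exp_sum (P : ℕ) (ρ : ℝ) (B : Finset ℤ) (g : ℤ → ℂ) (θ : ℤ → ℝ) (I : ℤ) :
    lagrangeShift P ρ (fun J => ∑ j ∈ B, g j * Complex.exp (Complex.I * θ j * J)) I
      = ∑ j ∈ B, g j * lagrangeMultiplier P ρ (θ j) * Complex.exp (Complex.I * θ j * I) := by
  have hmu : ∀ k, muDelta (deltaSq^[k] (fun J => ∑ j ∈ B, g j * Complex.exp (Complex.I * θ j * J))) I
      = ∑ j ∈ B, g j * (Complex.I * Real.sin (θ j) * ((2 * Real.cos (θ j) - 2 : ℝ) : ℂ) ^ k)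
          * Complex.exp (Complex.I * θ j * I) := by
    intro k
    rw [iterate_deltaSq_exp_sum, muDelta, ← Finset.sum_sub_distrib, Finset.sum_div]
    refine Finset.sum_congr rfl fun j _ => ?_
    rw [exp_I_mul_succ, exp_I_mul_pred]
    ring
  simp only [lagrangeShift, hmu]
  simp only [iterate_deltaSq_exp_sum, lagrangeMultiplier, mul_add, add_mul, mul_one,
    Finset.sum_add_distrib]
  congr 1
  simp only [Finset.mul_sum, Finset.sum_mul, ← Finset.sum_add_distrib, Finset.sum_div]
  rw [Finset.sum_comm]
  refine Finset.sum_congr rfl fun j _ => Finset.sum_congr rfl fun k _ => ?_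
  ring

theorem iterate_deltaSq_re (F : ℤ → ℂ) (k : ℕ) :
    deltaSq^[k] (fun J => ((F J).re : ℂ)) = fun J => ((deltaSq^[k] F J).re : ℂ) := by
  induction k with
  | zero => rfl
  | succ k ih =>
    rw [Function.iterate_succ_apply', Function.iterate_succ_apply', ih]
    funext J
    simp [deltaSq]

theorem lagrangeShift_re (P : ℕ) (ρ : ℝ) (F : ℤ → ℂ) (I : ℤ) :
    lagrangeShift P ρ (fun J => ((F J).re : ℂ)) I = ((lagrangeShift P ρ F I).re : ℂ) := by
  simp only [lagrangeShift, iterate_deltaSq_re, Complex.add_re, Complex.re_sum, Complex.ofReal_add,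
    Complex.ofReal_sum]
  congr 1
  refine Finset.sum_congr rfl fun k _ => ?_
  have hmu : muDelta (fun J => ((deltaSq^[k - 1] F J).re : ℂ)) I
      = ((muDelta (deltaSq^[k - 1] F) I).re : ℂ) := by
    simp [muDelta]
  have h1 : ∀ x y : ℂ, (∏ l ∈ Finset.range k, ((ρ : ℂ) ^ 2 - (l : ℂ) ^ 2))
      * ((2 * k / ρ) * x + y) / (2 * k).factorial
      = (((∏ l ∈ Finset.range k, (ρ ^ 2 - (l : ℝ) ^ 2)) * (2 * k / ρ) / (2 * k).factorial : ℝ) : ℂ)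
        * x + (((∏ l ∈ Finset.range k, (ρ ^ 2 - (l : ℝ) ^ 2)) / (2 * k).factorial : ℝ) : ℂ) * y := by
    intro x y; push_cast; ring
  rw [hmu, h1, h1, Complex.add_re, Complex.re_ofReal_mul, Complex.re_ofReal_mul]
  push_cast
  ring

theorem lagrangeMultiplier_neg (P : ℕ) (ρ θ : ℝ) :
    lagrangeMultiplier P (-ρ) θ = conj (lagrangeMultiplier P ρ θ) := by
  simp only [lagrangeMultiplier, map_add, map_one, map_sum, map_div₀, map_mul, map_prod, map_sub,
    map_pow, Complex.conj_ofReal, Complex.conj_natCast, Complex.conj_I, map_ofNat]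
  congr 1
  refine Finset.sum_congr rfl fun k _ => ?_
  push_cast
  rw [neg_sq]
  ring

/-- The coefficient of `δ^{2k}` in the Lagrangian shift. -/
noncomputable def lagrangeCoeff (ρ : ℝ) (k : ℕ) : ℝ :=
  (∏ l ∈ Finset.range k, (ρ ^ 2 - (l : ℝ) ^ 2)) / (2 * k).factorial

theorem lagrangeCoeff_succ (ρ : ℝ) (k : ℕ) :
    lagrangeCoeff ρ (k + 1) * ((2 * k + 1) * (2 * k + 2)) = lagrangeCoeff ρ k * (ρ ^ 2 - k ^ 2) := by
  have h : (2 * (k + 1)).factorial = (2 * k + 2) * ((2 * k + 1) * (2 * k).factorial) := by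
    rw [show 2 * (k + 1) = 2 * k + 1 + 1 by ring, Nat.factorial_succ, Nat.factorial_succ]
  have h0 : ((2 * k).factorial : ℝ) ≠ 0 := by exact_mod_cast Nat.factorial_ne_zero _
  rw [lagrangeCoeff, lagrangeCoeff, Finset.prod_range_succ, h]
  push_cast
  field_simp

theorem lagrangeMultiplier_succ (P : ℕ) (ρ θ : ℝ) :
    lagrangeMultiplier (P + 1) ρ θ = lagrangeMultiplier P ρ θ + lagrangeCoeff ρ (P + 1)
      * ((2 * (P + 1) / ρ) * (Complex.I * Real.sin θ * ((2 * Real.cos θ - 2 : ℝ) : ℂ) ^ P)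
        + ((2 * Real.cos θ - 2 : ℝ) : ℂ) ^ (P + 1)) := by
  rw [lagrangeMultiplier, lagrangeMultiplier, Finset.sum_Icc_succ_top (by omega), lagrangeCoeff,
    ← add_assoc]
  congr 1
  push_cast
  ring

/-- The multiplier solves `a' = i ρ a`, the equation of the exact shift `e^{i ρ θ}`, up to a residual
of order `2 P` in `θ`: the contributions of successive differences telescope. -/
theorem hasDerivAt_lagrangeMultiplier {ρ : ℝ} (hρ : ρ ≠ 0) (P : ℕ) (θ : ℝ) :
    HasDerivAt (lagrangeMultiplier P ρ)
      (Complex.I * ρ * lagrangeMultiplier P ρ θ - Complex.I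
        * ((lagrangeCoeff ρ P * (ρ ^ 2 - P ^ 2) / ρ * (2 * Real.cos θ - 2) ^ P : ℝ) : ℂ)) θ := by
  have hρc : (ρ : ℂ) ≠ 0 := by exact_mod_cast hρ
  induction P with
  | zero =>
    have h1 : lagrangeMultiplier 0 ρ = fun _ => 1 := by funext θ; simp [lagrangeMultiplier]
    rw [h1]
    refine (hasDerivAt_const θ (1 : ℂ)).congr_deriv ?_
    simp [lagrangeCoeff]
    field_simp
    simp
  | succ P ih =>
    have hX : HasDerivAt (fun θ : ℝ => ((2 * Real.cos θ - 2 : ℝ) : ℂ))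
        ((-(2 * Real.sin θ) : ℝ) : ℂ) θ := by
      refine HasDerivAt.ofReal_comp ?_
      simpa using ((Real.hasDerivAt_cos θ).const_mul 2).sub_const 2
    have hS : HasDerivAt (fun θ : ℝ => ((Real.sin θ : ℝ) : ℂ)) (Real.cos θ : ℂ) θ :=
      (Real.hasDerivAt_sin θ).ofReal_comp
    have h1 := ih.add ((((((hS.const_mul Complex.I).mul (hX.pow P)).const_mul
      (2 * (P + 1) / ρ : ℂ))).add (hX.pow (P + 1))).const_mul (lagrangeCoeff ρ (P + 1) : ℂ))
    have h2 : lagrangeMultiplier (P + 1) ρ = fun θ => lagrangeMultiplier P ρ θ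
      + lagrangeCoeff ρ (P + 1)
      * ((2 * (P + 1) / ρ) * (Complex.I * Real.sin θ * ((2 * Real.cos θ - 2 : ℝ) : ℂ) ^ P)
        + ((2 * Real.cos θ - 2 : ℝ) : ℂ) ^ (P + 1)) := funext fun θ => lagrangeMultiplier_succ P ρ θ
    rw [h2]
    refine h1.congr_deriv ?_
    have hc : (lagrangeCoeff ρ (P + 1) : ℂ) * ((2 * P + 1) * (2 * P + 2))
        = lagrangeCoeff ρ P * (ρ ^ 2 - P ^ 2) := by exact_mod_cast lagrangeCoeff_succ ρ P
    have hsc : (Real.sin θ : ℂ) ^ 2 = 1 - (Real.cos θ : ℂ) ^ 2 := by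
      exact_mod_cast Real.sin_sq θ
    -- The truncated power `X ^ (P - 1)` only occurs with the factor `P`.
    have hP : (P : ℂ) * ((2 * Real.cos θ - 2 : ℝ) : ℂ) ^ (P - 1) * ((2 * Real.cos θ - 2 : ℝ) : ℂ)
        = P * ((2 * Real.cos θ - 2 : ℝ) : ℂ) ^ P := by
      rcases P with _ | P
      · simp
      · simp only [Nat.add_sub_cancel]; ring
    have hcos : (Real.cos θ : ℂ) = 1 + ((2 * Real.cos θ - 2 : ℝ) : ℂ) / 2 := by push_cast; ring
    simp only [Nat.add_sub_cancel, Pi.pow_apply, Complex.ofReal_mul, Complex.ofReal_neg,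
      Complex.ofReal_div, Complex.ofReal_sub, Complex.ofReal_pow, Complex.ofReal_natCast,
      Complex.ofReal_ofNat] at *
    rw [hcos] at hsc ⊢
    have hr : (ρ : ℂ) * (ρ : ℂ)⁻¹ = 1 := mul_inv_cancel₀ hρc
    generalize (2 * (Real.cos θ : ℂ) - 2) = X at *
    generalize (Real.sin θ : ℂ) = s at *
    generalize (lagrangeCoeff ρ (P + 1) : ℂ) = γ' at *
    generalize (lagrangeCoeff ρ P : ℂ) = γ at *
    push_cast
    simp only [div_eq_mul_inv]
    linear_combination (Complex.I * (ρ : ℂ)⁻¹ * X ^ P) * hc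
      + (-4 * (P + 1) * γ' * Complex.I * (ρ : ℂ)⁻¹ * P * X ^ (P - 1)) * hsc
      + (Complex.I * (ρ : ℂ)⁻¹ * γ' * 4 * (P + 1) * (1 + X / 4)) * hP
      + (-2 * (P + 1) * γ' * s * X ^ P) * Complex.I_mul_I
      + (-Complex.I * Complex.I * 2 * (P + 1) * γ' * s * X ^ P
        + Complex.I * γ' * ρ * X ^ (P + 1)) * hr

end Multiplier

/-! ### Accuracy of the multiplier -/

section Accuracy

theorem two_sub_two_cos_le (θ : ℝ) : |2 * Real.cos θ - 2| ≤ θ ^ 2 := by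
  have h1 := Real.one_sub_sq_div_two_le_cos (x := θ)
  have h2 := Real.cos_le_one θ
  rw [abs_le]; constructor <;> nlinarith [sq_nonneg θ]

theorem abs_sub_le_of_hasDerivAt_pow {E : Type*} [NormedAddCommGroup E] [NormedSpace ℝ E]
    {f f' : ℝ → E} {G : ℝ} {m : ℕ} (hf : ∀ x, HasDerivAt f (f' x) x)
    (hG : ∀ x, ‖f' x‖ ≤ G * |x| ^ m) (hG0 : 0 ≤ G) (x : ℝ) : ‖f x - f 0‖ ≤ G * |x| ^ (m + 1) := by
  have h := Convex.norm_image_sub_le_of_norm_hasDerivWithin_le (f := f) (f' := f')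
    (s := Icc (-|x|) |x|) (C := G * |x| ^ m) (x := 0) (y := x)
    (fun y _ => (hf y).hasDerivWithinAt) (fun y hy => (hG y).trans (by
      have : |y| ≤ |x| := abs_le.2 hy
      gcongr)) (convex_Icc _ _) (by simp) ⟨neg_abs_le x, le_abs_self x⟩
  calc _ ≤ _ := h
    _ = _ := by rw [sub_zero, Real.norm_eq_abs]; ring

/-- The Lagrangian multiplier agrees with that of the exact shift to order `2 P + 1`; the relative
error is imaginary to leading order, so that modulus errors are of order `2 P + 2`. -/
theorem exists_lagrangeMultiplier_bound {ρ : ℝ} (hρ : 0 < ρ) (P : ℕ) :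
    ∃ G : ℝ, 0 ≤ G ∧ ∀ θ : ℝ,
      ‖lagrangeMultiplier P ρ θ * Complex.exp (-(Complex.I * ρ * θ)) - 1‖ ≤ G * |θ| ^ (2 * P + 1) ∧
      |(lagrangeMultiplier P ρ θ * Complex.exp (-(Complex.I * ρ * θ))).re - 1|
        ≤ G * |θ| ^ (2 * P + 2) := by
  set g : ℝ := lagrangeCoeff ρ P * (ρ ^ 2 - P ^ 2) / ρ with hg
  set f : ℝ → ℂ := fun θ => lagrangeMultiplier P ρ θ * Complex.exp (-(Complex.I * ρ * θ)) with hf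
  set f' : ℝ → ℂ := fun θ => ((g * (2 * Real.cos θ - 2) ^ P : ℝ) : ℂ)
    * (-Complex.I * Complex.exp (-(Complex.I * ρ * θ))) with hf'
  have hder : ∀ θ, HasDerivAt f (f' θ) θ := by
    intro θ
    have h1 := hasDerivAt_cexp_mul_ofReal (-(Complex.I * ρ)) θ
    simp only [neg_mul] at h1
    refine ((hasDerivAt_lagrangeMultiplier hρ.ne' P θ).mul h1).congr_deriv ?_
    simp only [hf', hg]
    ring
  have hexp : ∀ θ : ℝ, Complex.exp (-(Complex.I * ρ * θ))
      = Real.cos (ρ * θ) - Real.sin (ρ * θ) * Complex.I := by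
    intro θ
    rw [show -(Complex.I * ρ * θ) = ((-(ρ * θ) : ℝ) : ℂ) * Complex.I by push_cast; ring,
      Complex.exp_mul_I, ← Complex.ofReal_cos, ← Complex.ofReal_sin, Real.cos_neg, Real.sin_neg]
    push_cast; ring
  have hX : ∀ θ : ℝ, |g * (2 * Real.cos θ - 2) ^ P| ≤ |g| * |θ| ^ (2 * P) := fun θ => by
    rw [abs_mul, abs_pow, pow_mul, sq_abs]
    gcongr
    exact two_sub_two_cos_le θ
  have hf0 : f 0 = 1 := by
    simp only [hf, lagrangeMultiplier]
    rw [Finset.sum_eq_zero fun k hk => ?_]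
    · simp
    · have : k ≠ 0 := by have := (Finset.mem_Icc.1 hk).1; omega
      simp [this]
  have hnorm : ∀ θ : ℝ, ‖Complex.exp (-(Complex.I * ρ * θ))‖ = 1 := fun θ => by
    rw [show -(Complex.I * ρ * θ) = ((-(ρ * θ) : ℝ) : ℂ) * Complex.I by push_cast; ring,
      Complex.norm_exp_ofReal_mul_I]
  have hf'n : ∀ θ, ‖f' θ‖ ≤ |g| * |θ| ^ (2 * P) := fun θ => by
    simp only [hf']
    rw [norm_mul, norm_mul, norm_neg, Complex.norm_I, hnorm, Complex.norm_real, mul_one, mul_one]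
    exact hX θ
  have hf're : ∀ θ, ‖(f' θ).re‖ ≤ |g| * ρ * |θ| ^ (2 * P + 1) := fun θ => by
    have h1 : (f' θ).re = -(g * (2 * Real.cos θ - 2) ^ P * Real.sin (ρ * θ)) := by
      simp only [hf', hexp]
      rw [Complex.re_ofReal_mul]
      generalize Real.cos (ρ * θ) = C
      generalize Real.sin (ρ * θ) = s
      simp
    rw [h1, norm_neg, Real.norm_eq_abs, abs_mul]
    calc _ ≤ |g| * |θ| ^ (2 * P) * |ρ * θ| :=
          mul_le_mul (hX θ) Real.abs_sin_le_abs (abs_nonneg _) (by positivity)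
      _ = _ := by rw [abs_mul, abs_of_pos hρ]; ring
  refine ⟨|g| * (1 + ρ), by positivity, fun θ => ⟨?_, ?_⟩⟩
  · have h1 := abs_sub_le_of_hasDerivAt_pow hder hf'n (abs_nonneg g) θ
    rw [hf0] at h1
    refine h1.trans ?_
    gcongr
    nlinarith [abs_nonneg g]
  · have hre : ∀ θ, HasDerivAt (fun θ => (f θ).re) (f' θ).re θ := fun θ => by
      simpa [Function.comp_def] using Complex.reCLM.hasFDerivAt.comp_hasDerivAt θ (hder θ)
    have h1 := abs_sub_le_of_hasDerivAt_pow hre hf're (by positivity) θ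
    rw [hf0, Complex.one_re, Real.norm_eq_abs] at h1
    refine h1.trans ?_
    gcongr
    nlinarith [abs_nonneg g]

/-- Polar form of the multiplier: the phase is accurate to order `2 P + 1`, the modulus to order
`2 P + 2`. -/
theorem exists_polar_lagrangeMultiplier {ρ : ℝ} (hρ : 0 < ρ) (P : ℕ) :
    ∃ G δ : ℝ, 0 ≤ G ∧ 0 < δ ∧ δ ≤ 1 ∧ ∀ θ : ℝ, |θ| < δ → ∃ α : ℝ,
      lagrangeMultiplier P ρ θ
        = ‖lagrangeMultiplier P ρ θ‖ * Complex.exp (Complex.I * ((ρ * θ + α : ℝ) : ℂ)) ∧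
      |α| ≤ G * |θ| ^ (2 * P + 1) ∧ |‖lagrangeMultiplier P ρ θ‖ - 1| ≤ G * |θ| ^ (2 * P + 2) := by
  obtain ⟨G, hG0, hG⟩ := exists_lagrangeMultiplier_bound hρ P
  refine ⟨2 * G + G ^ 2, min 1 (1 / (2 * (G + 1))), by positivity, by positivity, min_le_left _ _,
    fun θ hθ => ?_⟩
  have hθ1 : |θ| ≤ 1 := hθ.le.trans (min_le_left _ _)
  have hθG : |θ| ≤ 1 / (2 * (G + 1)) := hθ.le.trans (min_le_right _ _)
  obtain ⟨h1, h2⟩ := hG θ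
  set a := lagrangeMultiplier P ρ θ with ha
  set b := a * Complex.exp (-(Complex.I * ρ * θ)) with hb
  have hab : a = b * Complex.exp (Complex.I * ρ * θ) := by
    rw [hb, mul_assoc, ← Complex.exp_add]; simp
  have hnorm : ‖a‖ = ‖b‖ := by
    rw [hab, norm_mul, show Complex.I * ρ * θ = ((ρ * θ : ℝ) : ℂ) * Complex.I by push_cast; ring,
      Complex.norm_exp_ofReal_mul_I, mul_one]
  have hhalf : ‖b - 1‖ ≤ 1 / 2 := by
    have h3 : |θ| ^ (2 * P + 1) ≤ |θ| := by
      calc |θ| ^ (2 * P + 1) ≤ |θ| ^ 1 := pow_le_pow_of_le_one (abs_nonneg _) hθ1 (by omega)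
        _ = |θ| := pow_one _
    calc ‖b - 1‖ ≤ G * |θ| ^ (2 * P + 1) := h1
      _ ≤ G * (1 / (2 * (G + 1))) := by gcongr; exact h3.trans hθG
      _ ≤ 1 / 2 := by rw [mul_one_div, div_le_div_iff₀ (by positivity) two_pos]; linarith
  refine ⟨b.arg, ?_, ?_, ?_⟩
  · rw [hnorm]
    conv_lhs => rw [hab, ← Complex.norm_mul_exp_arg_mul_I b]
    rw [mul_assoc, ← Complex.exp_add]
    congr 2
    push_cast; ring
  · have h3 := Complex.norm_log_one_add_half_le_self (z := b - 1) hhalf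
    rw [add_sub_cancel] at h3
    calc |b.arg| = |(Complex.log b).im| := by rw [Complex.log_im]
      _ ≤ ‖Complex.log b‖ := Complex.abs_im_le_norm _
      _ ≤ 3 / 2 * ‖b - 1‖ := h3
      _ ≤ 3 / 2 * (G * |θ| ^ (2 * P + 1)) := by gcongr
      _ ≤ (2 * G + G ^ 2) * |θ| ^ (2 * P + 1) := by
        have : 0 ≤ |θ| ^ (2 * P + 1) := by positivity
        nlinarith [mul_nonneg hG0 this, mul_nonneg (sq_nonneg G) this]
  · rw [hnorm]
    have hsq : ‖b‖ ^ 2 - 1 = 2 * (b.re - 1) + ‖b - 1‖ ^ 2 := by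
      rw [← Complex.normSq_eq_norm_sq, ← Complex.normSq_eq_norm_sq, Complex.normSq_apply,
        Complex.normSq_apply]
      simp; ring
    have h3 : |‖b‖ - 1| ≤ |‖b‖ ^ 2 - 1| := by
      rw [show ‖b‖ ^ 2 - 1 = (‖b‖ - 1) * (‖b‖ + 1) by ring, abs_mul]
      refine le_mul_of_one_le_right (abs_nonneg _) ?_
      rw [abs_of_nonneg (by positivity)]
      linarith [norm_nonneg b]
    have h4 : ‖b - 1‖ ^ 2 ≤ G ^ 2 * |θ| ^ (2 * P + 2) := by
      calc ‖b - 1‖ ^ 2 ≤ (G * |θ| ^ (2 * P + 1)) ^ 2 := by gcongr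
        _ = G ^ 2 * |θ| ^ (4 * P + 2) := by rw [mul_pow, ← pow_mul]; ring_nf
        _ ≤ _ := by
          gcongr G ^ 2 * ?_
          exact pow_le_pow_of_le_one (abs_nonneg _) hθ1 (by omega)
    calc |‖b‖ - 1| ≤ |2 * (b.re - 1) + ‖b - 1‖ ^ 2| := by rw [← hsq]; exact h3
      _ ≤ 2 * |b.re - 1| + ‖b - 1‖ ^ 2 := by
        refine (abs_add_le _ _).trans ?_
        rw [abs_mul, abs_two, abs_of_nonneg (sq_nonneg ‖b - 1‖)]
      _ ≤ 2 * (G * |θ| ^ (2 * P + 2)) + G ^ 2 * |θ| ^ (2 * P + 2) := by gcongr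
      _ = _ := by ring

theorem norm_exp_sub_exp_le {x y : ℂ} (hx : x.re ≤ 0) (hy : y.re ≤ 0) :
    ‖Complex.exp x - Complex.exp y‖ ≤ ‖x - y‖ := by
  have := Convex.norm_image_sub_le_of_norm_hasDerivWithin_le (f := Complex.exp)
    (f' := Complex.exp) (s := {z : ℂ | z.re ≤ 0}) (C := 1) (x := y) (y := x)
    (fun z _ => (Complex.hasDerivAt_exp z).hasDerivWithinAt) (fun z hz => by
      rw [Complex.norm_exp]; exact Real.exp_le_one_iff.2 hz) (convex_halfSpace_re_le 0) hy hx
  simpa using this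

end Accuracy

/-! ### The patch scheme for a single macroscale mode -/

section NearEigenvector

variable {E : Type*} [NormedAddCommGroup E] [NormedSpace ℝ E] [CompleteSpace E]

theorem hasDerivAt_exp_smul_apply (G : E →L[ℝ] E) (x : E) (t : ℝ) :
    HasDerivAt (fun t : ℝ => NormedSpace.exp (t • G) x) (NormedSpace.exp (t • G) (G x)) t :=
  (ContinuousLinearMap.apply ℝ E x).hasFDerivAt.comp_hasDerivAt t (hasDerivAt_exp_smul_const G t)

theorem exp_smul_apply_comm (G : E →L[ℝ] E) (x : E) (t : ℝ) :
    NormedSpace.exp (t • G) (G x) = G (NormedSpace.exp (t • G) x) := by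
  have h := (ContinuousLinearMap.apply ℝ E x).hasFDerivAt.comp_hasDerivAt t
    (hasDerivAt_exp_smul_const' G t)
  exact (hasDerivAt_exp_smul_apply G x t).unique h

/-- A one-sided bound on the generator, uniform after a shift by a large multiple of the identity,
bounds the growth of solutions. -/
theorem norm_exp_smul_apply_le {G : E →L[ℝ] E} {c γ : ℝ}
    (hG : ∀ φ, ‖G φ + c • φ‖ ≤ (c + γ) * ‖φ‖) (x : E) {t : ℝ} (ht : 0 ≤ t) :
    ‖NormedSpace.exp (t • G) x‖ ≤ Real.exp (γ * t) * ‖x‖ := by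
  have hd : ∀ s : ℝ, HasDerivAt (fun s : ℝ => Real.exp (c * s) • NormedSpace.exp (s • G) x)
      (Real.exp (c * s) • (G (NormedSpace.exp (s • G) x) + c • NormedSpace.exp (s • G) x)) s := by
    intro s
    have h1 : HasDerivAt (fun s => Real.exp (c * s)) (Real.exp (c * s) * c) s := by
      simpa using ((hasDerivAt_id s).const_mul c).exp
    refine (h1.smul (hasDerivAt_exp_smul_apply G x s)).congr_deriv ?_
    rw [exp_smul_apply_comm, smul_add, smul_smul]
  have hb := norm_le_gronwallBound_of_norm_deriv_right_le (δ := ‖x‖) (K := c + γ) (ε := 0)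
    (a := 0) (b := t) (fun s _ => (hd s).continuousAt.continuousWithinAt)
    (fun s _ => (hd s).hasDerivWithinAt) (by simp) (fun s _ => by
      rw [norm_smul, norm_smul, add_zero]
      have := mul_le_mul_of_nonneg_left (hG (NormedSpace.exp (s • G) x))
        (norm_nonneg (Real.exp (c * s)))
      calc _ ≤ _ := this
        _ = _ := by ring) t ⟨ht, le_rfl⟩
  rw [gronwallBound_ε0, sub_zero, norm_smul, Real.norm_of_nonneg (Real.exp_pos _).le] at hb
  calc ‖NormedSpace.exp (t • G) x‖
      = Real.exp (-(c * t)) * (Real.exp (c * t) * ‖NormedSpace.exp (t • G) x‖) := by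
        rw [← mul_assoc, ← Real.exp_add]; simp
    _ ≤ Real.exp (-(c * t)) * (‖x‖ * Real.exp ((c + γ) * t)) := by gcongr
    _ = Real.exp (-(c * t)) * Real.exp ((c + γ) * t) * ‖x‖ := by ring
    _ = _ := by rw [← Real.exp_add]; congr 2; ring

/-- The solution that starts at an approximate eigenvector stays close to the exponential with the
approximate eigenvalue, and so does its time derivative. -/
theorem exp_smul_apply_near {G : E →L[ℝ] E} {c γ μ ε : ℝ}
    (hG : ∀ φ, ‖G φ + c • φ‖ ≤ (c + γ) * ‖φ‖) (hγ : 0 ≤ γ) (hμ : μ ≤ 0) {x : E}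
    (hx : ‖G x - μ • x‖ ≤ ε) {t T : ℝ} (ht : 0 ≤ t) (htT : t ≤ T) :
    ‖NormedSpace.exp (t • G) x - Real.exp (μ * t) • x‖ ≤ T * Real.exp (γ * T) * ε ∧
    ‖G (NormedSpace.exp (t • G) x) - (μ * Real.exp (μ * t)) • x‖
      ≤ Real.exp (γ * T) * ε + |μ| * (T * Real.exp (γ * T) * ε) := by
  have hε : 0 ≤ ε := (norm_nonneg _).trans hx
  have hT : 0 ≤ T := ht.trans htT
  have hd : ∀ s : ℝ, HasDerivAt (fun s : ℝ => Real.exp (-μ * s) • NormedSpace.exp (s • G) x)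
      (Real.exp (-μ * s) • NormedSpace.exp (s • G) (G x - μ • x)) s := by
    intro s
    have h1 : HasDerivAt (fun s => Real.exp (-μ * s)) (Real.exp (-μ * s) * (-μ)) s := by
      simpa using ((hasDerivAt_id s).const_mul (-μ)).exp
    refine (h1.smul (hasDerivAt_exp_smul_apply G x s)).congr_deriv ?_
    rw [map_sub, map_smul, smul_sub, smul_smul, mul_neg, neg_smul, sub_eq_add_neg]
  have hres : ∀ s, 0 ≤ s → s ≤ t → ‖NormedSpace.exp (s • G) (G x - μ • x)‖
      ≤ Real.exp (γ * T) * ε := fun s hs hst => by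
    refine (norm_exp_smul_apply_le hG _ hs).trans ?_
    gcongr
    exact hst.trans htT
  have hmv := Convex.norm_image_sub_le_of_norm_hasDerivWithin_le
    (f := fun s : ℝ => Real.exp (-μ * s) • NormedSpace.exp (s • G) x)
    (f' := fun s => Real.exp (-μ * s) • NormedSpace.exp (s • G) (G x - μ • x))
    (s := Icc 0 t) (C := Real.exp (-μ * t) * (Real.exp (γ * T) * ε)) (x := 0) (y := t)
    (fun s _ => (hd s).hasDerivWithinAt) (fun s hs => by
      rw [norm_smul, Real.norm_of_nonneg (Real.exp_pos _).le]
      have : Real.exp (-μ * s) ≤ Real.exp (-μ * t) :=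
        Real.exp_le_exp.2 (mul_le_mul_of_nonneg_left hs.2 (by linarith))
      gcongr
      exact hres s hs.1 hs.2) (convex_Icc _ _) ⟨le_rfl, ht⟩ ⟨ht, le_rfl⟩
  have hz : NormedSpace.exp (t • G) x - Real.exp (μ * t) • x = Real.exp (μ * t) •
      (Real.exp (-μ * t) • NormedSpace.exp (t • G) x - x) := by
    rw [smul_sub, smul_smul, ← Real.exp_add]; simp
  have h1 : ‖NormedSpace.exp (t • G) x - Real.exp (μ * t) • x‖ ≤ T * Real.exp (γ * T) * ε := by
    simp only [mul_zero, Real.exp_zero, zero_smul, NormedSpace.exp_zero,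
      one_apply_eq_self, one_smul, sub_zero, Real.norm_of_nonneg ht] at hmv
    rw [hz, norm_smul, Real.norm_of_nonneg (Real.exp_pos _).le]
    calc _ ≤ Real.exp (μ * t) * (Real.exp (-μ * t) * (Real.exp (γ * T) * ε) * t) := by gcongr
      _ = (Real.exp (μ * t) * Real.exp (-μ * t)) * (t * Real.exp (γ * T) * ε) := by ring
      _ = t * Real.exp (γ * T) * ε := by rw [← Real.exp_add]; simp
      _ ≤ _ := by gcongr
  refine ⟨h1, ?_⟩
  have h2 : G (NormedSpace.exp (t • G) x) - (μ * Real.exp (μ * t)) • x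
      = NormedSpace.exp (t • G) (G x - μ • x)
        + μ • (NormedSpace.exp (t • G) x - Real.exp (μ * t) • x) := by
    rw [map_sub, map_smul, exp_smul_apply_comm, smul_sub, smul_smul]; abel
  rw [h2]
  refine (norm_add_le _ _).trans (add_le_add (hres t ht le_rfl) ?_)
  rw [norm_smul, Real.norm_eq_abs]
  gcongr

end NearEigenvector

section Generator

variable {p : ℕ} [NeZero p]

/-- The values of one macroscale mode at the interior points of a patch. -/
abbrev PatchState (p n : ℕ) : Type := Set.Icc (1 : ℤ) n → ZMod p → ℂ

/-- Extension of the interior values of a mode to the edge points, where the macroscale shift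
multiplies by `a` at the right edge and by the conjugate of `a` at the left edge.  The values
beyond the edges are irrelevant. -/
noncomputable def patchExtend {n : ℕ} (hn : 1 ≤ n) (a : ℂ) (φ : PatchState p n) (i : ℤ)
    (l : ZMod p) : ℂ :=
  if h : 1 ≤ i ∧ i ≤ n then φ ⟨i, h⟩ l
  else if i = n + 1 then a * φ ⟨1, le_rfl, by exact_mod_cast hn⟩ l
  else if i = 0 then conj a * φ ⟨n, by exact_mod_cast hn, le_rfl⟩ l
  else 0

variable {n : ℕ} {hn : 1 ≤ n} {a : ℂ}

omit [NeZero p] in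
theorem patchExtend_of_mem (φ : PatchState p n) {i : ℤ} (h : 1 ≤ i ∧ i ≤ n) (l : ZMod p) :
    patchExtend hn a φ i l = φ ⟨i, h⟩ l := dif_pos h

omit [NeZero p] in
theorem patchExtend_right (φ : PatchState p n) (l : ZMod p) :
    patchExtend hn a φ (n + 1) l = a * φ ⟨1, le_rfl, by exact_mod_cast hn⟩ l := by
  rw [patchExtend, dif_neg (by omega), if_pos rfl]

omit [NeZero p] in
theorem patchExtend_left (φ : PatchState p n) (l : ZMod p) :
    patchExtend hn a φ 0 l = conj a * φ ⟨n, by exact_mod_cast hn, le_rfl⟩ l := by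
  rw [patchExtend, dif_neg (by omega), if_neg (by omega), if_pos rfl]

omit [NeZero p] in
theorem patchExtend_add (φ ψ : PatchState p n) (i : ℤ) (l : ZMod p) :
    patchExtend hn a (φ + ψ) i l = patchExtend hn a φ i l + patchExtend hn a ψ i l := by
  unfold patchExtend
  split_ifs <;> simp [mul_add]

omit [NeZero p] in
theorem patchExtend_smul (c : ℝ) (φ : PatchState p n) (i : ℤ) (l : ZMod p) :
    patchExtend hn a (c • φ) i l = c • patchExtend hn a φ i l := by
  unfold patchExtend
  split_ifs <;> simp [mul_left_comm]

theorem norm_apply_le (φ : PatchState p n) (i : Set.Icc (1 : ℤ) n) (l : ZMod p) :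
    ‖φ i l‖ ≤ ‖φ‖ :=
  (norm_le_pi_norm (φ i) l).trans (norm_le_pi_norm φ i)

theorem norm_patchExtend_le {η : ℝ} (hη : |‖a‖ - 1| ≤ η) (φ : PatchState p n) (i : ℤ)
    (l : ZMod p) : ‖patchExtend hn a φ i l‖ ≤ (1 + η) * ‖φ‖ := by
  have hη0 : 0 ≤ η := (abs_nonneg _).trans hη
  have ha : ‖a‖ ≤ 1 + η := by linarith [(abs_le.1 hη).2]
  unfold patchExtend
  split_ifs
  · refine (norm_apply_le φ _ l).trans ?_
    nlinarith [norm_nonneg φ]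
  · rw [norm_mul]
    gcongr
    exact norm_apply_le φ _ l
  · rw [norm_mul, RCLike.norm_conj]
    gcongr
    exact norm_apply_le φ _ l
  · rw [norm_zero]; positivity

/-- The evolution operator of one macroscale mode on the interior of a patch. -/
noncomputable def patchGenerator (κ : ZMod p → ℝ) (d : ℝ) (hn : 1 ≤ n) (a : ℂ) :
    PatchState p n →L[ℝ] PatchState p n :=
  LinearMap.toContinuousLinearMap
    { toFun := fun φ i l => ensembleRate .wrapped κ d (patchExtend hn a φ) i l
      map_add' := fun φ ψ => by
        funext i l
        simp only [ensembleRate, patchExtend_add, Pi.add_apply, Complex.real_smul]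
        ring
      map_smul' := fun c φ => by
        funext i l
        simp only [ensembleRate, patchExtend_smul, Pi.smul_apply, Complex.real_smul,
          RingHom.id_apply]
        ring }

theorem patchGenerator_apply (κ : ZMod p → ℝ) (d : ℝ) (φ : PatchState p n)
    (i : Set.Icc (1 : ℤ) n) (l : ZMod p) : patchGenerator κ d hn a φ i l
      = ensembleRate .wrapped κ d (patchExtend hn a φ) i l := rfl

/-- Diffusion is dissipative in the maximum norm, up to the gain of the coupling at the edges. -/
theorem norm_patchGenerator_add_le {κ : ZMod p → ℝ} (hκ : ∀ l, 0 < κ l) (d : ℝ) {η : ℝ}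
    (hη : |‖a‖ - 1| ≤ η) (φ : PatchState p n) :
    ‖patchGenerator κ d hn a φ + (2 * (∑ l, κ l) / d ^ 2) • φ‖
      ≤ (2 * (∑ l, κ l) / d ^ 2 + 2 * (∑ l, κ l) / d ^ 2 * η) * ‖φ‖ := by
  have hη0 : 0 ≤ η := (abs_nonneg _).trans hη
  have hs : ∀ l, κ l ≤ ∑ l, κ l := fun l =>
    Finset.single_le_sum (fun l _ => (hκ l).le) (Finset.mem_univ l)
  set s := ∑ l, κ l with hsd
  have hs0 : 0 ≤ s := (hκ 0).le.trans (hs 0)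
  have hR : 0 ≤ (2 * s / d ^ 2 + 2 * s / d ^ 2 * η) * ‖φ‖ := by positivity
  refine (pi_norm_le_iff_of_nonneg hR).2 fun i => (pi_norm_le_iff_of_nonneg hR).2 fun l => ?_
  have hx := patchExtend_of_mem (hn := hn) (a := a) φ i.2 l
  have h1 : (patchGenerator κ d hn a φ + (2 * s / d ^ 2) • φ) i l
      = ((d ^ 2)⁻¹ : ℝ) • (κ l • patchExtend hn a φ (i + 1) (l + 1)
        + κ (l - 1) • patchExtend hn a φ (i - 1) (l - 1) + (2 * s - κ l - κ (l - 1)) • φ i l) := by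
    simp only [Pi.add_apply, Pi.smul_apply, patchGenerator_apply, ensembleRate, hx,
      Complex.real_smul]
    push_cast
    ring
  rw [h1, norm_smul, Real.norm_of_nonneg (by positivity)]
  have e : ∀ i l, ‖patchExtend hn a φ i l‖ ≤ (1 + η) * ‖φ‖ := norm_patchExtend_le hη φ
  have h2 : ‖φ i l‖ ≤ (1 + η) * ‖φ‖ := (norm_apply_le φ i l).trans (by
    nlinarith [norm_nonneg φ])
  have h3 : 0 ≤ 2 * s - κ l - κ (l - 1) := by linarith [hs l, hs (l - 1)]
  calc _ ≤ (d ^ 2)⁻¹ * (κ l * ((1 + η) * ‖φ‖) + κ (l - 1) * ((1 + η) * ‖φ‖)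
        + (2 * s - κ l - κ (l - 1)) * ((1 + η) * ‖φ‖)) := by
        gcongr
        refine (norm_add₃_le).trans ?_
        rw [norm_smul, norm_smul, norm_smul, Real.norm_of_nonneg (hκ _).le,
          Real.norm_of_nonneg (hκ _).le, Real.norm_of_nonneg h3]
        have hl := (hκ l).le
        have hl' := (hκ (l - 1)).le
        gcongr
        · exact e _ _
        · exact e _ _
    _ = _ := by ring

/-- If the edge multiplier is that of a shift of a lattice mode on the slow manifold, but for its
modulus, then the mode is a correspondingly approximate eigenvector on the patch. -/
theorem norm_patchGenerator_sub_le {κ : ZMod p → ℝ} (hκ : ∀ l, 0 < κ l) {d η k μ : ℝ}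
    (hη : |‖a‖ - 1| ≤ η) (ha : a = ‖a‖ * Complex.exp (Complex.I * ((n * k : ℝ) : ℂ)))
    {w : ZMod p → ℂ} (hw : ∀ l, symbol κ k w l = μ * w l) :
    ‖patchGenerator κ d hn a (fun i l => Complex.exp (Complex.I * k * (i : ℤ)) * w l)
      - (μ / d ^ 2) • fun (i : Set.Icc (1 : ℤ) n) l => Complex.exp (Complex.I * k * (i : ℤ)) * w l‖
      ≤ 2 * (∑ l, κ l) / d ^ 2 * η * ‖w‖ := by
  have hη0 : 0 ≤ η := (abs_nonneg _).trans hη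
  have hs : ∀ l, κ l ≤ ∑ l, κ l := fun l =>
    Finset.single_le_sum (fun l _ => (hκ l).le) (Finset.mem_univ l)
  set s := ∑ l, κ l with hsd
  have hs0 : 0 ≤ s := (hκ 0).le.trans (hs 0)
  have hR : 0 ≤ 2 * s / d ^ 2 * η * ‖w‖ := by positivity
  set x : PatchState p n := fun i l => Complex.exp (Complex.I * k * (i : ℤ)) * w l with hx
  set y : ℤ → ZMod p → ℂ := fun i l => Complex.exp (Complex.I * k * i) * w l with hy
  have hyn : ∀ i l, ‖y i l‖ ≤ ‖w‖ := fun i l => by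
    rw [hy, norm_mul, show Complex.I * k * i = ((k * i : ℝ) : ℂ) * Complex.I by push_cast; ring,
      Complex.norm_exp_ofReal_mul_I, one_mul]
    exact norm_le_pi_norm w l
  have hstep : ∀ (m : ℤ) l, Complex.exp (Complex.I * ((n * k : ℝ) : ℂ)) * y m l = y (m + n) l := by
    intro m l
    simp only [hy]
    rw [← mul_assoc, ← Complex.exp_add]
    congr 2; push_cast; ring
  have hsub : ∀ z : ℂ, ‖(‖a‖ : ℂ) * z - z‖ = |‖a‖ - 1| * ‖z‖ := fun z => by
    rw [← sub_one_mul, norm_mul, ← Complex.ofReal_one, ← Complex.ofReal_sub, Complex.norm_real,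
      Real.norm_eq_abs]
  have hedge : ∀ (i : ℤ) l, 0 ≤ i → i ≤ n + 1 → ‖patchExtend hn a x i l - y i l‖ ≤ η * ‖w‖ := by
    intro i l h0 h1
    rcases h0.eq_or_lt with rfl | h0
    · have hc : conj a = ‖a‖ * Complex.exp (-(Complex.I * ((n * k : ℝ) : ℂ))) := by
        conv_lhs => rw [ha]
        rw [map_mul, Complex.conj_ofReal, ← Complex.exp_conj, map_mul, Complex.conj_I,
          Complex.conj_ofReal, neg_mul]
      have h2 : patchExtend hn a x 0 l = ‖a‖ * y 0 l := by
        rw [patchExtend_left, hc]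
        have := hstep 0 l
        rw [zero_add] at this
        rw [show x ⟨n, by exact_mod_cast hn, le_rfl⟩ l = y n l from rfl, ← this, mul_assoc,
          ← mul_assoc (Complex.exp _) (Complex.exp _), ← Complex.exp_add]
        simp
      rw [h2, hsub]
      gcongr
      exact hyn _ _
    · rcases h1.eq_or_lt with rfl | h1
      · have h2 : patchExtend hn a x (n + 1) l = ‖a‖ * y (n + 1) l := by
          rw [patchExtend_right, add_comm, ← hstep 1 l]
          calc a * y 1 l = ‖a‖ * Complex.exp (Complex.I * ((n * k : ℝ) : ℂ)) * y 1 l := by rw [← ha]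
            _ = _ := mul_assoc _ _ _
        rw [h2, hsub]
        gcongr
        exact hyn _ _
      · have hi : 1 ≤ i ∧ i ≤ n := ⟨h0, by omega⟩
        rw [patchExtend_of_mem x hi, show x ⟨i, hi⟩ l = y i l from rfl, sub_self, norm_zero]
        positivity
  refine (pi_norm_le_iff_of_nonneg hR).2 fun i => (pi_norm_le_iff_of_nonneg hR).2 fun l => ?_
  have hmode := symbol_mode (d := d) hw 1 i l
  simp only [one_mul] at hmode
  have hxi := patchExtend_of_mem (hn := hn) (a := a) x i.2 l
  have h1 : (patchGenerator κ d hn a x - (μ / d ^ 2) • x) i l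
      = ((d ^ 2)⁻¹ : ℝ) • (κ l • (patchExtend hn a x (i + 1) (l + 1) - y (i + 1) (l + 1))
        + κ (l - 1) • (patchExtend hn a x (i - 1) (l - 1) - y (i - 1) (l - 1))) := by
    have h2 : (patchGenerator κ d hn a x - (μ / d ^ 2) • x) i l
        = ensembleRate .wrapped κ d (patchExtend hn a x) i l
          - ensembleRate .wrapped κ d y i l := by
      rw [hmode]
      simp only [Pi.sub_apply, Pi.smul_apply, patchGenerator_apply, Complex.real_smul, hx]
    rw [h2]
    simp only [ensembleRate, hxi, Complex.real_smul]
    simp only [hx, hy]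
    ring
  rw [h1, norm_smul, Real.norm_of_nonneg (by positivity)]
  have hi := i.2
  calc _ ≤ (d ^ 2)⁻¹ * (s * (η * ‖w‖) + s * (η * ‖w‖)) := by
        gcongr
        refine (norm_add_le _ _).trans ?_
        rw [norm_smul, norm_smul, Real.norm_of_nonneg (hκ _).le, Real.norm_of_nonneg (hκ _).le]
        gcongr
        · exact hs l
        · exact hedge _ _ (by have := hi.1; omega) (by have := hi.2; omega)
        · exact hs _
        · exact hedge _ _ (by have := hi.1; omega) (by have := hi.2; omega)
    _ = _ := by ring

/-- A solution of the patch scheme for one macroscale mode that stays close to a lattice mode on the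
slow manifold, when the edge multiplier is that of the lattice mode but for its modulus. -/
theorem exists_patch_mode_of_twist {κ : ZMod p → ℝ} (hκ : ∀ l, 0 < κ l) (hn : 1 ≤ n)
    {d η k μ : ℝ} (hη : |‖a‖ - 1| ≤ η)
    (ha : a = ‖a‖ * Complex.exp (Complex.I * ((n * k : ℝ) : ℂ)))
    {w : ZMod p → ℂ} (hw : ∀ l, symbol κ k w l = μ * w l) (hμ : μ ≤ 0) {γ : ℝ}
    (hγ : γ = 2 * (∑ l, κ l) / d ^ 2 * η) :
    ∃ φ : ℝ → ℤ → ZMod p → ℂ,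
      (∀ t (i : ℤ) l, 1 ≤ i → i ≤ n →
        HasDerivAt (fun s => φ s i l) (ensembleRate .wrapped κ d (φ t) i l) t) ∧
      (∀ t l, φ t (n + 1) l = a * φ t 1 l) ∧
      (∀ t l, φ t 0 l = conj a * φ t n l) ∧
      ∀ t T (i : ℤ) l, 0 ≤ t → t ≤ T → 1 ≤ i → i ≤ n →
        ‖φ t i l - Real.exp (μ / d ^ 2 * t) • (Complex.exp (Complex.I * k * i) * w l)‖
          ≤ T * Real.exp (γ * T) * (γ * ‖w‖) ∧
        ‖ensembleRate .wrapped κ d (φ t) i l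
          - (μ / d ^ 2 * Real.exp (μ / d ^ 2 * t)) • (Complex.exp (Complex.I * k * i) * w l)‖
          ≤ Real.exp (γ * T) * (γ * ‖w‖)
            + |μ / d ^ 2| * (T * Real.exp (γ * T) * (γ * ‖w‖)) := by
  set x : PatchState p n := fun i l => Complex.exp (Complex.I * k * (i : ℤ)) * w l with hx
  set G := patchGenerator κ d hn a with hG
  have hn' : (1 : ℤ) ≤ n := by exact_mod_cast hn
  have hγ0 : 0 ≤ γ := by
    have : 0 ≤ ∑ l, κ l := Finset.sum_nonneg fun l _ => (hκ l).le
    have := (abs_nonneg _).trans hη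
    rw [hγ]; positivity
  refine ⟨fun t => patchExtend hn a (NormedSpace.exp (t • G) x), ?_, ?_, ?_, ?_⟩
  · intro t i l h1 h2
    have h3 := hasDerivAt_exp_smul_apply G x t
    rw [exp_smul_apply_comm] at h3
    have h4 := hasDerivAt_pi.1 (hasDerivAt_pi.1 h3 ⟨i, h1, h2⟩) l
    simp only [patchExtend_of_mem _ ⟨h1, h2⟩]
    exact h4
  · intro t l
    beta_reduce
    rw [patchExtend_right, patchExtend_of_mem _ ⟨le_rfl, hn'⟩]
  · intro t l
    beta_reduce
    rw [patchExtend_left, patchExtend_of_mem _ ⟨hn', le_rfl⟩]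
  · intro t T i l ht htT h1 h2
    have hres := norm_patchGenerator_sub_le (hn := hn) hκ (d := d) hη ha hw
    rw [← hγ] at hres
    obtain ⟨h3, h4⟩ := exp_smul_apply_near (G := G)
      (fun φ => by rw [hγ]; exact norm_patchGenerator_add_le hκ d hη φ) hγ0
      (div_nonpos_of_nonpos_of_nonneg hμ (sq_nonneg d)) hres ht htT
    refine ⟨?_, ?_⟩
    · beta_reduce
      rw [patchExtend_of_mem _ ⟨h1, h2⟩]
      exact (norm_apply_le _ ⟨i, h1, h2⟩ l).trans h3
    · exact (norm_apply_le _ ⟨i, h1, h2⟩ l).trans h4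

end Generator

/-! ### Lagrangian coupling -/

section Lagrange

variable {p : ℕ} [NeZero p]

theorem norm_ensembleMean_sub_le {y z : ZMod p → ℂ} {b : ℂ} {ε : ℝ} (hz : ensembleMean z = 1)
    (h : ∀ l, ‖y l - b * z l‖ ≤ ε) : ‖ensembleMean y - b‖ ≤ ε := by
  have hp : (0 : ℝ) < p := by exact_mod_cast Nat.pos_of_ne_zero (NeZero.ne p)
  have h1 : ensembleMean y - b = (p : ℝ)⁻¹ • ∑ l, (y l - b * z l) := by
    rw [Finset.sum_sub_distrib, ← Finset.mul_sum, smul_sub]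
    conv_lhs => rw [← mul_one b, ← hz]
    simp only [ensembleMean, Complex.real_smul]
    ring
  rw [h1, norm_smul, Real.norm_of_nonneg (by positivity), inv_mul_le_iff₀ hp]
  refine (norm_sum_le_of_le _ fun l _ => h l).trans ?_
  simp [ZMod.card]

set_option maxHeartbeats 1000000 in
/-- A patch solution for the macroscale wavenumber `σ` under Lagrangian coupling of order `P` that
stays within `O(H ^ (2 P))`, in mean and in mean rate, of the mode on the slow manifold.

The phase error of the coupling multiplier is exactly that of a shift of a lattice mode with a
slightly different wavenumber `k'`.  The phase error has order `2 P + 1`, so that the decay rate on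
the slow manifold at `k'` is accurate to order `2 P`; the modulus error has order `2 P + 2`, hence
perturbs the evolution, whose rates are of order `H ^ (-2)`, only to order `2 P`. -/
theorem exists_lagrange_patch_mode {κ : ZMod p → ℝ} (hκ : ∀ l, 0 < κ l) {k₀ : ℝ}
    {w : ℝ → ZMod p → ℂ} {lam : ℝ → ℝ} {K : ℕ → ℝ} (h : IsSlowManifold κ k₀ w lam)
    (hK : HasSlowExpansion k₀ lam K) {n : ℕ} {r : ℝ} (hn : 1 ≤ n) (hr : 0 < r) (P : ℕ) {T : ℝ}
    (hT : 0 ≤ T) (σ : ℝ) :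
    ∃ C : ℝ, 0 ≤ C ∧ ∀ᶠ H in 𝓝[>] (0 : ℝ), ∀ d k a, d = r * H / n → k = σ * d →
      a = lagrangeMultiplier P r (σ * H) → |k| < k₀ ∧ ∃ φ : ℝ → ℤ → ZMod p → ℂ,
      (∀ t (i : ℤ) l, 1 ≤ i → i ≤ n →
        HasDerivAt (fun s => φ s i l) (ensembleRate .wrapped κ d (φ t) i l) t) ∧
      (∀ t l, φ t (n + 1) l = a * φ t 1 l) ∧
      (∀ t l, φ t 0 l = conj a * φ t n l) ∧
      ∀ t (i : ℤ), 0 ≤ t → t ≤ T → 1 ≤ i → i ≤ n →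
        ‖ensembleMean (φ t i)
          - Complex.exp ((lam k / d ^ 2 : ℝ) * t) * Complex.exp (Complex.I * k * i)‖
          ≤ C * H ^ (2 * P) ∧
        ‖ensembleMean (ensembleRate .wrapped κ d (φ t) i) - (lam k / d ^ 2 : ℝ)
            * (Complex.exp ((lam k / d ^ 2 : ℝ) * t) * Complex.exp (Complex.I * k * i))‖
          ≤ C * H ^ (2 * P) := by
  have hn0 : (0 : ℝ) < n := by exact_mod_cast hn
  obtain ⟨G, δ₁, hG, hδ₁, -, hpol⟩ := exists_polar_lagrangeMultiplier hr P
  obtain ⟨Λ, δ₂, hΛ, hδ₂, hδ₂k, hlip⟩ := hK.exists_lipschitz h.pos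
  -- Near wavenumber zero, the eigenvectors are close to constant.
  obtain ⟨δ₃, hδ₃, hw2⟩ : ∃ δ > 0, ∀ k, |k| < δ → ‖w k‖ ≤ 2 := by
    have hc : ContinuousAt w 0 := (h.analytic 0 ⟨by linarith [h.pos], h.pos⟩).continuousAt
    have h1 : ‖w 0‖ < 2 := by
      rw [h.equilibria]
      exact lt_of_le_of_lt ((pi_norm_le_iff_of_nonneg zero_le_one).2 fun _ => by simp) one_lt_two
    obtain ⟨δ, hδ, hb⟩ := Metric.eventually_nhds_iff.1 (hc.norm.eventually (gt_mem_nhds h1))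
    exact ⟨δ, hδ, fun k hk => (hb (by simpa using hk)).le⟩
  set s := ∑ l, κ l with hs
  have hs0 : 0 ≤ s := Finset.sum_nonneg fun l _ => (hκ l).le
  set q := |σ| with hq
  have hq0 : 0 ≤ q := abs_nonneg σ
  -- With `k' = (σ + β) d`, the wavenumber is perturbed by `|β| ≤ A H ^ (2 P)`.
  set A := G * q ^ (2 * P + 1) / r with hA
  have hA0 : 0 ≤ A := by positivity
  -- For `H ≤ 1`, `M₁ H ^ (2 P)` bounds the change of the rate, `M₂ H ^ (2 P)` the growth rate caused
  -- by the modulus of the edge multiplier, and `M₃` the rates themselves.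
  set M₁ := Λ * (A * (2 * q + A)) with hM₁
  set M₂ := 2 * s * n ^ 2 / r ^ 2 * (G * q ^ (2 * P + 2)) with hM₂
  set M₃ := Λ * (q + A) ^ 2 with hM₃
  have hM₁0 : 0 ≤ M₁ := by positivity
  have hM₂0 : 0 ≤ M₂ := by positivity
  have hM₃0 : 0 ≤ M₃ := by positivity
  -- `D` and `D'` stem from the distance to the mode with wavenumber `k'`, and `R` from the distance
  -- of that mode to the mode with wavenumber `k`.
  set D := T * Real.exp (M₂ * T) * (M₂ * 2) with hD
  set D' := Real.exp (M₂ * T) * (M₂ * 2) with hD'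
  set R := M₁ * T + r * A with hR
  have hD0 : 0 ≤ D := by positivity
  have hD'0 : 0 ≤ D' := by positivity
  have hR0 : 0 ≤ R := by positivity
  refine ⟨(D + R) + (D' + M₃ * D + (M₁ + M₃ * R)), by positivity, ?_⟩
  have hsmall : ∀ (c ε : ℝ), 0 < ε → ∀ᶠ H in 𝓝[>] (0 : ℝ), c * H < ε := fun c ε hε =>
    (((continuous_const_mul c).tendsto' 0 0 (mul_zero c)).mono_left
      nhdsWithin_le_nhds).eventually (gt_mem_nhds hε)
  filter_upwards [self_mem_nhdsWithin, hsmall 1 1 one_pos, hsmall q δ₁ hδ₁,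
    hsmall ((q + A) * r / n) (min δ₂ δ₃) (lt_min hδ₂ hδ₃)] with H hH0 hH1 hHq hHk d k a hd hk ha
  replace hH0 : 0 < H := hH0
  rw [one_mul] at hH1
  have hd0 : 0 < d := by rw [hd]; positivity
  have hHP : H ^ (2 * P) ≤ 1 := pow_le_one₀ hH0.le hH1.le
  have hθ : |σ * H| = q * H := by rw [abs_mul, abs_of_pos hH0]
  obtain ⟨α, hpa, hα, hη⟩ := hpol (σ * H) (by rw [hθ]; exact hHq)
  rw [← ha] at hpa hη
  rw [hθ] at hα hη
  set β := α / (r * H) with hβ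
  have hαβ : α = n * (β * d) := by rw [hβ, hd]; field_simp
  have hβA : |β| ≤ A * H ^ (2 * P) := by
    rw [hβ, abs_div, abs_of_pos (by positivity : 0 < r * H), div_le_iff₀ (by positivity)]
    refine hα.trans (le_of_eq ?_)
    rw [hA, mul_pow]; field_simp; ring
  have hβA' : |β| ≤ A := hβA.trans (mul_le_of_le_one_right hA0 hHP)
  set k' := (σ + β) * d with hk'
  have hqA : ∀ x, |x| ≤ q + A → |x * d| < δ₂ ∧ |x * d| < δ₃ := fun x hx => by
    have h1 : |x * d| < min δ₂ δ₃ := by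
      refine lt_of_le_of_lt ?_ hHk
      rw [abs_mul, abs_of_pos hd0]
      calc |x| * d ≤ (q + A) * d := by gcongr
        _ = _ := by rw [hd]; ring
    exact ⟨h1.trans_le (min_le_left _ _), h1.trans_le (min_le_right _ _)⟩
  have hk2 : |k| < δ₂ := by rw [hk]; exact (hqA σ (by linarith)).1
  have hσβ : |σ + β| ≤ q + A := (abs_add_le _ _).trans (by gcongr)
  have hk'2 : |k'| < δ₂ := (hqA _ hσβ).1
  have hw' : ‖w k'‖ ≤ 2 := hw2 k' (hqA _ hσβ).2
  have hk'0 : |k'| < k₀ := hk'2.trans_le hδ₂k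
  have hpa' : a = ‖a‖ * Complex.exp (Complex.I * ((n * k' : ℝ) : ℂ)) := by
    have h1 : r * (σ * H) + α = n * k' := by rw [hαβ, hk', hd]; field_simp
    rw [← h1]; exact hpa
  set γ := 2 * s / d ^ 2 * (G * (q * H) ^ (2 * P + 2)) with hγ
  have hγM : γ = M₂ * H ^ (2 * P) := by
    rw [hγ, hM₂, hd, mul_pow]; field_simp; ring
  have hγ0 : 0 ≤ γ := by rw [hγM]; positivity
  have hγM' : γ ≤ M₂ := by rw [hγM]; exact mul_le_of_le_one_right hM₂0 hHP
  refine ⟨hk2.trans_le hδ₂k, ?_⟩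
  obtain ⟨φ, hode, hright, hleft, hφ⟩ := exists_patch_mode_of_twist hκ hn (d := d) hη hpa'
    (h.invariant k' hk'0) (h.lam_nonpos hκ hk'0) hγ
  refine ⟨φ, hode, hright, hleft, fun t i ht htT h1 hin => ?_⟩
  set μ := lam k / d ^ 2 with hμ
  set μ' := lam k' / d ^ 2 with hμ'
  have hμ0 : μ ≤ 0 :=
    div_nonpos_of_nonpos_of_nonneg (h.lam_nonpos hκ (hk2.trans_le hδ₂k)) (sq_nonneg d)
  have hμ'0 : μ' ≤ 0 := div_nonpos_of_nonpos_of_nonneg (h.lam_nonpos hκ hk'0) (sq_nonneg d)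
  have hμM : |μ' - μ| ≤ M₁ * H ^ (2 * P) := by
    rw [hμ, hμ', ← sub_div, abs_div, abs_of_pos (by positivity : 0 < d ^ 2),
      div_le_iff₀ (by positivity)]
    have e1 : |2 * σ + β| ≤ 2 * q + A := (abs_add_le _ _).trans (by
      rw [abs_mul, abs_two]; gcongr)
    calc |lam k' - lam k| ≤ Λ * |k' ^ 2 - k ^ 2| := hlip k k' hk2 hk'2
      _ = Λ * (|β| * |2 * σ + β|) * d ^ 2 := by
        rw [hk', hk, show ((σ + β) * d) ^ 2 - (σ * d) ^ 2 = β * (2 * σ + β) * d ^ 2 by ring,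
          abs_mul, abs_mul, abs_of_pos (by positivity : 0 < d ^ 2)]
        ring
      _ ≤ Λ * (A * H ^ (2 * P) * (2 * q + A)) * d ^ 2 := by gcongr
      _ = _ := by rw [hM₁]; ring
  have hlam0 : ∀ x, |x| ≤ q + A → |lam (x * d) / d ^ 2| ≤ M₃ := fun x hx => by
    rw [abs_div, abs_of_pos (by positivity : 0 < d ^ 2), div_le_iff₀ (by positivity)]
    have e1 := hlip 0 (x * d) (by simpa using hδ₂) (hqA x hx).1
    rw [hK.lam_zero h.pos, sub_zero] at e1
    calc _ ≤ _ := e1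
      _ = Λ * |x| ^ 2 * d ^ 2 := by
        rw [sq_abs, show (x * d) ^ 2 - 0 ^ 2 = x ^ 2 * d ^ 2 by ring,
          abs_of_nonneg (by positivity)]
        ring
      _ ≤ _ := by rw [hM₃]; gcongr
  have hμ3 : |μ| ≤ M₃ := by rw [hμ, hk]; exact hlam0 σ (by linarith)
  have hμ'3 : |μ'| ≤ M₃ := hlam0 _ hσβ
  set E := Complex.exp ((μ : ℝ) * t) * Complex.exp (Complex.I * k * i) with hE
  set E' := Complex.exp ((μ' : ℝ) * t) * Complex.exp (Complex.I * k' * i) with hE'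
  have hexp : ∀ m x : ℝ, Complex.exp ((m : ℝ) * t) * Complex.exp (Complex.I * x * i)
      = Complex.exp (((m * t : ℝ) : ℂ) + ((x * i : ℝ) : ℂ) * Complex.I) := fun m x => by
    rw [← Complex.exp_add]; congr 1; push_cast; ring
  have hi0 : |(i : ℝ)| ≤ n := by
    rw [abs_of_pos (by exact_mod_cast h1)]; exact_mod_cast hin
  have hEE : ‖E' - E‖ ≤ R * H ^ (2 * P) := by
    rw [hE, hE', hexp, hexp]
    refine (norm_exp_sub_exp_le ?_ ?_).trans ?_
    · simpa using mul_nonpos_of_nonpos_of_nonneg hμ'0 ht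
    · simpa using mul_nonpos_of_nonpos_of_nonneg hμ0 ht
    · have e1 : ((μ' * t : ℝ) : ℂ) + ((k' * i : ℝ) : ℂ) * Complex.I
          - (((μ * t : ℝ) : ℂ) + ((k * i : ℝ) : ℂ) * Complex.I)
          = (((μ' - μ) * t : ℝ) : ℂ) + ((β * d * i : ℝ) : ℂ) * Complex.I := by
        rw [hk', hk]; push_cast; ring
      rw [e1]
      refine (norm_add_le _ _).trans ?_
      rw [norm_mul, Complex.norm_I, mul_one, Complex.norm_real, Complex.norm_real,
        Real.norm_eq_abs, Real.norm_eq_abs, abs_mul, abs_mul, abs_of_nonneg ht, abs_mul,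
        abs_of_pos hd0]
      have e2 : |β| * d * |(i : ℝ)| ≤ r * A * H ^ (2 * P) := by
        calc |β| * d * |(i : ℝ)| ≤ A * H ^ (2 * P) * d * n := by gcongr
          _ = r * A * H ^ (2 * P) * H := by rw [hd]; field_simp
          _ ≤ _ := mul_le_of_le_one_right (by positivity) hH1.le
      calc _ ≤ M₁ * H ^ (2 * P) * T + r * A * H ^ (2 * P) := by gcongr
        _ = _ := by rw [hR]; ring
  have hE'1 : ‖E'‖ ≤ 1 := by
    rw [hE', hexp, Complex.norm_exp]
    refine Real.exp_le_one_iff.2 ?_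
    simpa using mul_nonpos_of_nonpos_of_nonneg hμ'0 ht
  have hg : γ * ‖w k'‖ ≤ M₂ * 2 * H ^ (2 * P) := by
    calc γ * ‖w k'‖ ≤ γ * 2 := by gcongr
      _ = _ := by rw [hγM]; ring
  have hmean := h.mean k' hk'0
  have hval : ‖ensembleMean (φ t i) - E'‖ ≤ D * H ^ (2 * P) := by
    refine norm_ensembleMean_sub_le hmean fun l => ?_
    have e1 := (hφ t T i l ht htT h1 hin).1
    have e2 : E' * w k' l = Real.exp (μ' * t) • (Complex.exp (Complex.I * k' * i) * w k' l) := by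
      rw [hE', Complex.real_smul]; push_cast; ring
    rw [e2]
    calc _ ≤ _ := e1
      _ ≤ T * Real.exp (M₂ * T) * (M₂ * 2 * H ^ (2 * P)) := by gcongr
      _ = _ := by rw [hD]; ring
  have hrate : ‖ensembleMean (ensembleRate .wrapped κ d (φ t) i) - μ' * E'‖
      ≤ (D' + M₃ * D) * H ^ (2 * P) := by
    refine norm_ensembleMean_sub_le hmean fun l => ?_
    have e1 := (hφ t T i l ht htT h1 hin).2
    have e2 : μ' * E' * w k' l
        = (μ' * Real.exp (μ' * t)) • (Complex.exp (Complex.I * k' * i) * w k' l) := by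
      rw [hE', Complex.real_smul]; push_cast; ring
    rw [e2]
    calc _ ≤ _ := e1
      _ ≤ Real.exp (M₂ * T) * (M₂ * 2 * H ^ (2 * P))
          + M₃ * (T * Real.exp (M₂ * T) * (M₂ * 2 * H ^ (2 * P))) := by gcongr
      _ = _ := by rw [hD, hD']; ring
  have hHP0 : 0 ≤ H ^ (2 * P) := by positivity
  have hX : 0 ≤ D' + M₃ * D + (M₁ + M₃ * R) := by positivity
  constructor
  · calc ‖ensembleMean (φ t i) - E‖ = ‖(ensembleMean (φ t i) - E') + (E' - E)‖ := by
          rw [sub_add_sub_cancel]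
      _ ≤ D * H ^ (2 * P) + R * H ^ (2 * P) := (norm_add_le _ _).trans (add_le_add hval hEE)
      _ = (D + R) * H ^ (2 * P) := by ring
      _ ≤ _ := mul_le_mul_of_nonneg_right (le_add_of_nonneg_right hX) hHP0
  · have e1 : ‖(μ' : ℂ) * E' - μ * E‖ ≤ (M₁ + M₃ * R) * H ^ (2 * P) := by
      rw [show (μ' : ℂ) * E' - μ * E = ((μ' - μ : ℝ) : ℂ) * E' + μ * (E' - E) by push_cast; ring]
      refine (norm_add_le _ _).trans ?_
      rw [norm_mul _ E', norm_mul (μ : ℂ), Complex.norm_real, Complex.norm_real, Real.norm_eq_abs,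
        Real.norm_eq_abs]
      calc _ ≤ M₁ * H ^ (2 * P) * 1 + M₃ * (R * H ^ (2 * P)) := by gcongr
        _ = _ := by ring
    calc _ = ‖(ensembleMean (ensembleRate .wrapped κ d (φ t) i) - μ' * E') + (μ' * E' - μ * E)‖ := by
          rw [sub_add_sub_cancel]
      _ ≤ (D' + M₃ * D) * H ^ (2 * P) + (M₁ + M₃ * R) * H ^ (2 * P) :=
        (norm_add_le _ _).trans (add_le_add hrate e1)
      _ = (D' + M₃ * D + (M₁ + M₃ * R)) * H ^ (2 * P) := by ring
      _ ≤ _ := mul_le_mul_of_nonneg_right (le_add_of_nonneg_left (add_nonneg hD0 hR0)) hHP0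

theorem hasDerivAt_ensembleMean {y : ℝ → ZMod p → ℂ} {y' : ZMod p → ℂ} {t : ℝ}
    (h : ∀ l, HasDerivAt (fun s => y s l) (y' l) t) :
    HasDerivAt (fun s => ensembleMean (y s)) (ensembleMean y') t :=
  (HasDerivAt.fun_sum fun l _ => h l).const_smul (p : ℝ)⁻¹

theorem norm_exp_two_pi_I_mul_div (j : ℤ) (x y : ℝ) :
    ‖Complex.exp (2 * Real.pi * Complex.I * j * x / y)‖ = 1 := by
  rw [show (2 * Real.pi * Complex.I * j * x / y : ℂ)
    = ((2 * Real.pi * j * x / y : ℝ) : ℂ) * Complex.I by push_cast; ring,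
    Complex.norm_exp_ofReal_mul_I]

/-- With Lagrangian coupling of order `P`, band-limited solutions of the homogenised equation lift
to the patch scheme up to `O(H ^ (2 P))`: superpose the patch solutions for single wavenumbers. -/
theorem exists_lagrange_patchSolution {κ : ZMod p → ℝ} (hκ : ∀ l, 0 < κ l) {k₀ : ℝ}
    {w : ℝ → ZMod p → ℂ} {lam : ℝ → ℝ} {K : ℕ → ℝ} (h : IsSlowManifold κ k₀ w lam)
    (hK : HasSlowExpansion k₀ lam K) {n : ℕ} {r L : ℝ} (hn : 1 ≤ n) (hr : 0 < r) (hL : 0 < L)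
    (P : ℕ) (B : Finset ℤ) (T : ℝ) :
    ∃ (C : ℝ) (N₀ : ℕ), ∀ (N : ℕ) (H d x₀ M : ℝ) (V : ℝ → ℝ → ℝ), 1 ≤ N → N₀ ≤ N →
      H = L / N → d = r * H / n → IsHomogenisedSolution K d V →
      (∀ t, 0 ≤ t → IsBandLimited L B (V t)) → (∀ x, |V 0 x| ≤ M) →
      ∃ v : ℝ → ℤ → ℤ → ZMod p → ℝ, IsPatchSolution .wrapped κ d n N r (lagrangeShift P) v ∧
        ∀ t, 0 ≤ t → t ≤ T → ∀ I i : ℤ, 1 ≤ i → i ≤ n →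
          |ensembleMean (v t I i) - V t (patchPoint x₀ H d I i)| ≤ C * M * H ^ (2 * P) ∧
          ∃ e : ℝ, HasDerivWithinAt (fun s => ensembleMean (v s I i)
              - V s (patchPoint x₀ H d I i)) e (Ici 0) t ∧ |e| ≤ C * M * H ^ (2 * P) := by
  choose C hC0 hC using fun j : ℤ =>
    exists_lagrange_patch_mode hκ h hK hn hr P (abs_nonneg T) (2 * Real.pi * j / L)
  have htend : Tendsto (fun N : ℕ => L / N) atTop (𝓝[>] 0) := by
    refine tendsto_nhdsWithin_iff.2 ⟨tendsto_const_div_atTop_nhds_zero_nat L, ?_⟩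
    filter_upwards [eventually_gt_atTop 0] with N hN
    exact div_pos hL (by exact_mod_cast hN)
  obtain ⟨N₀, hN₀⟩ := eventually_atTop.1
    (htend.eventually ((Finset.eventually_all B).2 fun j _ => hC j))
  refine ⟨∑ j ∈ B, C j, N₀, fun N H d x₀ M V hN1 hN hH hd hV hVB hM => ?_⟩
  have hNpos : (0 : ℝ) < N := by exact_mod_cast hN1
  have hnpos : (0 : ℝ) < n := by exact_mod_cast hn
  have hHpos : 0 < H := by rw [hH]; positivity
  have hdpos : 0 < d := by rw [hd]; positivity
  have hLc : (L : ℂ) ≠ 0 := by exact_mod_cast hL.ne'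
  have hNc : (N : ℂ) ≠ 0 := by exact_mod_cast hNpos.ne'
  have hmode := hN₀ N hN
  rw [← hH] at hmode
  have hB : ∀ j ∈ B, |2 * Real.pi * j / L * d| < k₀ := fun j hj => (hmode j hj d _ _ hd rfl rfl).1
  choose! φ hode hright hleft hφ using fun j hj => (hmode j hj d _ _ hd rfl rfl).2
  obtain ⟨c, -, -, hcV, hcM⟩ := exists_modes hK hL hdpos hB hV hVB
  replace hcM := hcM M hM
  have hM0 : 0 ≤ M := (abs_nonneg _).trans (hM 0)
  set θ : ℤ → ℝ := fun j => 2 * Real.pi * j / L * H with hθ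
  set q : ℤ → ℝ := fun j => 2 * Real.pi * j / L * d with hq
  set b : ℤ → ℂ := fun j => c j * Complex.exp (2 * Real.pi * Complex.I * j * x₀ / L) with hb
  have hexp : ∀ j J : ℤ, Complex.exp (2 * Real.pi * Complex.I * j * J / N)
      = Complex.exp (Complex.I * θ j * J) := fun j J => by
    congr 1
    simp only [hθ, hH]
    push_cast
    field_simp
  -- A shift multiplies the modes of a superposition by their multipliers.
  have hshift : ∀ (ρ t : ℝ) (i : ℤ) (l : ZMod p) (I : ℤ),
      lagrangeShift P ρ (fun J => ((modeSum N B b (fun j => φ j t) J i l).re : ℂ)) I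
        = ((∑ j ∈ B, b j * (lagrangeMultiplier P ρ (θ j) * φ j t i l)
          * Complex.exp (2 * Real.pi * Complex.I * j * I / N)).re : ℂ) := by
    intro ρ t i l I
    rw [lagrangeShift_re]
    congr 2
    simp only [modeSum, hexp]
    rw [lagrangeShift_exp_sum P ρ B (fun j => b j * φ j t i l) θ I]
    exact Finset.sum_congr rfl fun j _ => by ring
  refine ⟨fun t I i l => (modeSum N B b (fun j => φ j t) I i l).re, ⟨?_, ?_, ?_, ?_⟩, ?_⟩
  · intro t _ I i h1 hin l
    rw [ensembleRate_re_modeSum]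
    exact (hasDerivAt_re_modeSum (fun j hj => hode j hj t i l h1 hin) I).hasDerivWithinAt
  · intro t _ I l
    simp only [memberShift, add_zero]
    rw [hshift]
    congr 2
    exact Finset.sum_congr rfl fun j hj => by beta_reduce; rw [hright j hj]
  · intro t _ I l
    simp only [memberShift, sub_zero]
    rw [hshift]
    congr 2
    exact Finset.sum_congr rfl fun j hj => by
      beta_reduce
      rw [hleft j hj, lagrangeMultiplier_neg]
  · intro t _ I i l
    rw [modeSum_periodic hN1]
  · intro t ht htT I i h1 hin
    set E : ℤ → ℝ → ℂ := fun j s =>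
      Complex.exp ((lam (q j) / d ^ 2 : ℝ) * s) * Complex.exp (Complex.I * q j * i) with hE
    have hdiff : ∀ s, 0 ≤ s → ensembleMean (fun l => (modeSum N B b (fun j => φ j s) I i l).re)
        - V s (patchPoint x₀ H d I i)
        = (∑ j ∈ B, b j * (ensembleMean (φ j s i) - E j s)
          * Complex.exp (2 * Real.pi * Complex.I * j * I / N)).re := by
      intro s hs
      rw [ensembleMean_re, ensembleMean_modeSum, ← Complex.ofReal_re (V s _), hcV s hs,
        ← Complex.sub_re, ← Finset.sum_sub_distrib]
      congr 1
      refine Finset.sum_congr rfl fun j hj => ?_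
      rw [exp_patchPoint hL hN1 hH]
      simp only [hb, hE, hq]
      ring
    have hbound : ∀ X : ℤ → ℂ, (∀ j ∈ B, ‖X j‖ ≤ C j * H ^ (2 * P)) →
        |(∑ j ∈ B, b j * X j * Complex.exp (2 * Real.pi * Complex.I * j * I / N)).re|
          ≤ (∑ j ∈ B, C j) * M * H ^ (2 * P) := by
      intro X hX
      refine (Complex.abs_re_le_norm _).trans ((norm_sum_le _ _).trans ?_)
      rw [Finset.sum_mul, Finset.sum_mul]
      refine Finset.sum_le_sum fun j hj => ?_
      have e1 : ‖b j‖ ≤ M := by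
        rw [hb, norm_mul, norm_exp_two_pi_I_mul_div, mul_one]; exact hcM j
      have e2 := norm_exp_two_pi_I_mul_div j I N
      push_cast at e2
      rw [norm_mul, norm_mul, e2, mul_one]
      calc ‖b j‖ * ‖X j‖ ≤ M * (C j * H ^ (2 * P)) := by
            gcongr
            exact hX j hj
        _ = _ := by ring
    have hTabs : t ≤ |T| := htT.trans (le_abs_self T)
    refine ⟨?_, _, ?_, hbound (fun j => ensembleMean (ensembleRate .wrapped κ d (φ j t) i)
      - (lam (q j) / d ^ 2 : ℝ) * E j t) fun j hj => (hφ j hj t i ht hTabs h1 hin).2⟩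
    · rw [hdiff t ht]
      exact hbound _ fun j hj => (hφ j hj t i ht hTabs h1 hin).1
    · have h2 : HasDerivAt (fun s => ∑ j ∈ B, b j * (ensembleMean (φ j s i) - E j s)
            * Complex.exp (2 * Real.pi * Complex.I * j * I / N))
          (∑ j ∈ B, b j * (ensembleMean (ensembleRate .wrapped κ d (φ j t) i)
            - (lam (q j) / d ^ 2 : ℝ) * E j t)
            * Complex.exp (2 * Real.pi * Complex.I * j * I / N)) t := by
        refine HasDerivAt.fun_sum fun j hj => HasDerivAt.mul_const (HasDerivAt.const_mul _
          (HasDerivAt.sub (hasDerivAt_ensembleMean fun l => hode j hj t i l h1 hin) ?_)) _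
        refine ((hasDerivAt_cexp_mul_ofReal _ t).mul_const _).congr_deriv ?_
        simp only [hE]
        ring
      have h3 := Complex.reCLM.hasFDerivAt.comp_hasDerivAt t h2
      exact h3.hasDerivWithinAt.congr (fun s hs => hdiff s hs) (hdiff t ht)

end Lagrange

end PatchEnsemble

theorem mainTheorem3 {p : ℕ} [NeZero p] (κ : ZMod p → ℝ) (hκ : ∀ l, 0 < κ l) :
    ∃ (k₀ : ℝ) (w : ℝ → ZMod p → ℂ) (lam : ℝ → ℝ) (K : ℕ → ℝ),
      -- the slow manifold of the Fourier-transformed ensemble, and its evolution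
      PatchEnsemble.IsSlowManifold κ k₀ w lam ∧
      PatchEnsemble.HasSlowExpansion k₀ lam K ∧
      K 0 = p / ∑ l, (κ l)⁻¹ ∧
      -- the coefficients do not depend on the choice of the slow manifold
      (∀ (k₁ : ℝ) (w₁ : ℝ → ZMod p → ℂ) (lam₁ : ℝ → ℝ) (K₁ : ℕ → ℝ),
        PatchEnsemble.IsSlowManifold κ k₁ w₁ lam₁ →
        PatchEnsemble.HasSlowExpansion k₁ lam₁ K₁ → K₁ = K) ∧
      -- superpositions over `|k| ≤ k_c` on the slow manifold solve the ensemble system, hence the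
      -- phase-shifted heterogeneous diffusions, and their means solve the homogenised equation
      (∀ (d kc : ℝ) (Y : ℝ → ℂ), 0 < d → 0 < kc → kc < k₀ → Continuous Y →
        ∃ (v : ℝ → ℤ → ZMod p → ℂ) (V : ℝ → ℝ → ℂ),
          (∀ t i l, v t i l = ∫ k in (-kc)..kc, Complex.exp (Complex.I * k * i)
            * (Y k * (Real.exp (lam k * t / d ^ 2) : ℂ) * w k l)) ∧
          (∀ t x, V t x = ∫ k in (-kc)..kc, Complex.exp (Complex.I * k * x / d)
            * (Y k * (Real.exp (lam k * t / d ^ 2) : ℂ))) ∧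
          PatchEnsemble.IsEnsembleSolution .wrapped κ d v ∧
          (∀ φ : ZMod p, PatchEnsemble.IsDiffusionSolution κ d φ
            (fun t i => v t i ((i : ZMod p) + φ))) ∧
          (∀ t, 0 ≤ t → ∀ i : ℤ, PatchEnsemble.ensembleMean (v t i) = V t (i * d)) ∧
          PatchEnsemble.IsHomogenisedSolution K d V) ∧
      -- consistency of the patch scheme, for every patch size, in both arrangements
      ∀ (a : PatchEnsemble.Arrangement) (n : ℕ) (r L : ℝ), 1 ≤ n → 0 < r → r ≤ 1 → 0 < L →
        -- spectral coupling: exact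
        (∀ (N : ℕ) (S B : Finset ℤ) (H d x₀ : ℝ) (V : ℝ → ℝ → ℝ), 1 ≤ N →
          (∀ j : ℤ, ∃! k : ℤ, k ∈ S ∧ k ≡ j [ZMOD N]) → B ⊆ S →
          H = L / N → d = r * H / n →
          (∀ j ∈ B, |2 * Real.pi * j / L * d| < k₀) →
          PatchEnsemble.IsHomogenisedSolution K d V →
          (∀ t, 0 ≤ t → PatchEnsemble.IsBandLimited L B (V t)) →
          ∃ v : ℝ → ℤ → ℤ → ZMod p → ℝ,
            PatchEnsemble.IsPatchSolution a κ d n N r (PatchEnsemble.spectralShift N S) v ∧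
            ∀ t, 0 ≤ t → ∀ I i : ℤ, 1 ≤ i → i ≤ n →
              PatchEnsemble.ensembleMean (v t I i)
                = V t (PatchEnsemble.patchPoint x₀ H d I i)) ∧
        -- Lagrangian coupling of order `P`: errors `O(H ^ (2 P))`, in values and in time derivatives
        (∀ (P : ℕ) (B : Finset ℤ) (T : ℝ), 1 ≤ P →
          ∃ (C : ℝ) (N₀ : ℕ), ∀ (N : ℕ) (H d x₀ M : ℝ) (V : ℝ → ℝ → ℝ), 1 ≤ N → N₀ ≤ N →
            H = L / N → d = r * H / n →
            PatchEnsemble.IsHomogenisedSolution K d V →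
            (∀ t, 0 ≤ t → PatchEnsemble.IsBandLimited L B (V t)) →
            (∀ x, |V 0 x| ≤ M) →
            ∃ v : ℝ → ℤ → ℤ → ZMod p → ℝ,
              PatchEnsemble.IsPatchSolution a κ d n N r (PatchEnsemble.lagrangeShift P) v ∧
              ∀ t, 0 ≤ t → t ≤ T → ∀ I i : ℤ, 1 ≤ i → i ≤ n →
                |PatchEnsemble.ensembleMean (v t I i)
                  - V t (PatchEnsemble.patchPoint x₀ H d I i)| ≤ C * M * H ^ (2 * P) ∧
                ∃ e : ℝ, HasDerivWithinAt (fun s => PatchEnsemble.ensembleMean (v s I i)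
                    - V s (PatchEnsemble.patchPoint x₀ H d I i)) e (Set.Ici 0) t ∧
                  |e| ≤ C * M * H ^ (2 * P)) := by
  obtain ⟨k₀, β, w, lam, K, h, hK, hβ, hlam, hgap⟩ := PatchEnsemble.exists_slowManifold hκ
  refine ⟨k₀, w, lam, K, h, hK, h.leading_coefficient hκ hK, ?_, ?_, ?_⟩
  · intro k₁ w₁ lam₁ K₁ h₁ hK₁
    exact PatchEnsemble.coefficients_unique h hK hβ hgap h₁ hK₁
  · intro d kc Y hd hkc hkc' hY
    have hv := h.superposition_isEnsembleSolution (d := d) hkc hkc' hY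
    exact ⟨_, _, fun _ _ _ => rfl, fun _ _ => rfl, hv, hv.isDiffusionSolution,
      fun t _ i => h.ensembleMean_superposition hd hkc hkc' hY t i,
      h.superposition_isHomogenisedSolution hK hd hkc hkc' hY⟩
  · intro a n r L hn hr _ hL
    refine ⟨?_, ?_⟩
    · intro N S B H d x₀ V hN hS hBS hH hd hB hV hVB
      obtain ⟨v, hv, hmean⟩ := PatchEnsemble.exists_spectral_patchSolution (x₀ := x₀) h hK
        (fun k hk l => PatchEnsemble.conj_eigenvector h hlam hgap hk l) hn hr hL hN hS hBS hH hd hB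
        hV hVB
      cases a
      · exact ⟨v, hv, fun t ht I i _ _ => hmean t ht I i⟩
      · refine ⟨_, hv.stacked, fun t ht I i _ _ => ?_⟩
        rw [← hmean t ht I i]
        exact PatchEnsemble.ensembleMean_add_right _ _
    · intro P B T _
      obtain ⟨C, N₀, hC⟩ :=
        PatchEnsemble.exists_lagrange_patchSolution hκ h hK hn hr hL P B T
      refine ⟨C, N₀, fun N H d x₀ M V hN hN₀ hH hd hV hVB hM => ?_⟩
      obtain ⟨v, hv, herr⟩ := hC N H d x₀ M V hN hN₀ hH hd hV hVB hM
      cases a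
      · exact ⟨v, hv, herr⟩
      · refine ⟨_, hv.stacked, fun t ht htT I i h1 hn => ?_⟩
        have hmean : ∀ s, PatchEnsemble.ensembleMean (fun l : ZMod p => v s I i (l + i))
            = PatchEnsemble.ensembleMean (v s I i) :=
          fun s => PatchEnsemble.ensembleMean_add_right _ _
        simp only [hmean]
        exact herr t ht htT I i h1 hn
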